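/- Let $d\ge 3$, $\langle x\rangle:=(1+|x|^2)^{1/2}$ and $\log^*t:=\max\{1,\log t\}$. **Model.** Let $\beta,\varrho,C_3,C_5,C_6>0$ and $C_1,C_2,C_4,C_7,C_8\in\mathbf R$ be constants. Let $e,\omega\ge 0$ and $Q$ be even real functions in $C^{2d}(\mathbf R^d)$, let $\mu\in\mathbf R$, and put $\Phi_\pm(p,k):=e(k+p)\pm\omega(k)$. Assume, for all $p,k$ and $0\le \ell\le 2d$: (i) $|\nabla^\ell e(k)|\le C_1(1+\langle k\rangle^{2-\ell})$, $|\nabla^\ell \omega(k)|\le C_2(1+\langle k\rangle^{2-\ell})$ and $|\nabla^\ell Q(k)|\le C_7\langle k\rangle^{-2d-12}$; (ii) $\Phi_\pm(p,k)\to\infty$ as $k\to\infty$, and $C_3\le \mathrm{Hess}_k\Phi_\pm(p,k)\le C_4$; (iii) (transversality) for $0<\delta_1,\delta_2\le\varrho$, $p_1\ne p_2$, $\theta_1,\theta_2\in\mathbf R$, $q\in\mathbf R^d$ and each choice of the sign, $$\big|\{k\in B(q,\varrho):\ |\Phi_\pm(p_1,k)-\theta_1|\le\delta_1,\ |\Phi_\pm(p_2,k)-\theta_2|\le\delta_2\}\big|\le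 \frac{C_5\,\delta_1\delta_2\,\varrho^{d-2}}{|p_1-p_2|};$$ (iv) $\omega(k)-\mu/\beta\ge C_6$. Put $\mathcal N(k):=\frac{e^{-\beta\omega(k)+\mu}}{1-e^{-\beta\omega(k)+\mu}}$ and $M(k,\sigma):=|Q(k)|^2\big(\mathcal N(k)+\frac{\sigma+1}2\big)$ for $\sigma\in\{\pm1\}$. **Finite box.** For $L>0$ let $\Lambda_L=[-\sqrt{2\pi}L/2,\sqrt{2\pi}L/2]^d$, $\Lambda^*=(\sqrt{2\pi}L^{-1}\mathbf Z)^d$ and $\int_{\Lambda^*} f(k)\,dk:=L^{-d}\sum_{k\in\Lambda^*}f(k)$. Let $\gamma_e=\gamma_{e,L}$ be a density matrix (a positive operator of trace $1$) on $L^2_{per}(\Lambda_L)$, with momentum kernel $\widehat\gamma_e(p,q)$ normalized so that $\int_{\Lambda^*}\widehat\gamma_e(p,p)\,dp=1$, and assume $$\limsup_{L\to\infty}\int_{\Lambda^*}\langle p\rangle^{3d+12}\,\widehat\gamma_e(p,p)\,dp\le C_8 .$$ **Graphs.** Let $\mathcal M(n,N)$ be the set of $m=(m_0,\dots,m_n)\in\mathbf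 N_0^{n+1}$ with $n+2\sum_j m_j=N$. For such $m$ put $\mu(j)=j+2\sum_{i<j}m_i$, $I_j(m)=\{\mu(j)+1,\mu(j)+3,\dots,\mu(j)+2m_j-1\}$ and $I^c_j(m)=\{\mu(j),\mu(j)+2,\dots,\mu(j)+2m_j\}$. Let $\int_0^{t*}[ds_b]_0^N$ denote integration over $s_0,\dots,s_N\ge 0$ with the constraint $\delta(t-\sum_b s_b)$, and put $$\Theta(s,p,\Omega)=\sum_{\sigma=\pm1}\int_{\Lambda^*} e^{-is[\Phi_\sigma(p,k)+\Omega]}M(k,\sigma)\,dk .$$ For $p\in\Lambda^*$, $k=(k_1,\dots,k_n)\in(\Lambda^*)^n$ and $\sigma\in\{\pm1\}^n$ put $p_j=p+\sum_{\ell>j}k_\ell$, $\Omega_j=\sum_{\ell>j}\sigma_\ell\,\omega(k_\ell)$ and $$A_m(t;p,k,\sigma)=\int_0^{t*}[ds_b]_0^N\prod_{j=0}^n\Big[\prod_{b\in I_j^c(m)}e^{-is_b[e(p_j)+\Omega_j]}\prod_{b\in I_j(m)}\Theta(s_b,p_j,\Omega_j)\Big].$$ For $m,\tilde m\in\mathcal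 M(n,N)$, a permutation $\pi$ of $\{1,\dots,n\}$ and a coupling constant $\lambda\in\mathbf R$, the contribution of the pairing graph is $$C_{m,\tilde m,\pi}(t)=\lambda^{2N}\sum_{\sigma\in\{\pm1\}^n}\int_{\Lambda^*}dp\,\widehat\gamma_e(p,p)\int_{(\Lambda^*)^n}\prod_{j=1}^n M(k_j,\sigma_j)\,dk_j\; A_m(t;p,k,\sigma)\,\overline{A_{\tilde m}(t;p,k\circ\pi^{-1},\sigma\circ\pi^{-1})} .$$ **Claim.** There is a constant $C$, depending only on $d,\beta,\varrho,C_1,\dots,C_8$, such that for all $e,\omega,Q,\mu,\gamma_{e,L}$ as above, all $\lambda\in\mathbf R$, $t>0$, $n\le N$, $m,\tilde m\in\mathcal M(n,N)$ and every crossing pairing $\pi\ne\mathrm{id}$, the sum that defines $C_{m,\tilde m,\pi}(t)$ converges absolutely for every $L>0$ and $$\limsup_{L\to\infty}|C_{m,\tilde m,\pi}(t)|\le t^{-1/2}\,(C\lambda^2t)^N\,(\log^*t)^4 .$$ -/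

import Mathlib

open Filter MeasureTheory
open scoped Topology ENNReal BigOperators ComplexConjugate

noncomputable section

namespace PhononBoltzmann

/-- Momentum space `ℝ^d` with the Euclidean norm. -/
abbrev Mom (d : ℕ) : Type := EuclideanSpace ℝ (Fin d)

/-- The bracket `⟨k⟩ = (1 + |k|^2)^{1/2}`. -/
def bracket {d : ℕ} (k : Mom d) : ℝ := Real.sqrt (‖k‖ ^ 2 + 1)

/-- `log* t = max {1, log t}`. -/
def logStar (t : ℝ) : ℝ := max 1 (Real.log t)

/-- A sign in `{+1, -1}` as a real number. -/
def sgn (σ : ℤˣ) : ℝ := ((σ : ℤ) : ℝ)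

/-! ### The dispersion relations and the coupling function -/

/-- `Φ_σ(p, k) = e(k + p) + σ ω(k)`. -/
def Phi {d : ℕ} (e ω : Mom d → ℝ) (σ : ℤˣ) (p k : Mom d) : ℝ := e (k + p) + sgn σ * ω k

/-- The neighbourhood `{k : |Φ_σ(p, k) - θ| ≤ δ}` of a level set. -/
def levelLayer {d : ℕ} (e ω : Mom d → ℝ) (σ : ℤˣ) (p : Mom d) (θ δ : ℝ) : Set (Mom d) :=
  {k | |Phi e ω σ p k - θ| ≤ δ}

/-- The expected number of phonons in the mode `k` at inverse temperature `β` and chemical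
potential `μ` (Bose-Einstein distribution). -/
def phononNumber {d : ℕ} (ω : Mom d → ℝ) (β μ : ℝ) (k : Mom d) : ℝ :=
  Real.exp (-β * ω k + μ) / (1 - Real.exp (-β * ω k + μ))

/-- `M(k, σ) = |Q(k)|^2 (𝒩(k) + (σ + 1) / 2)`. -/
def vertexWeight {d : ℕ} (ω Q : Mom d → ℝ) (β μ : ℝ) (k : Mom d) (σ : ℤˣ) : ℝ :=
  |Q k| ^ 2 * (phononNumber ω β μ k + (sgn σ + 1) / 2)

/-- The transversality condition, on balls of the fixed radius `ρ`. -/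
def Transversal {d : ℕ} (e ω : Mom d → ℝ) (ρ C₅ : ℝ) : Prop :=
  ∀ (σ : ℤˣ) (δ₁ δ₂ : ℝ), 0 < δ₁ → δ₁ ≤ ρ → 0 < δ₂ → δ₂ ≤ ρ →
    ∀ (p₁ p₂ : Mom d), p₁ ≠ p₂ → ∀ (θ₁ θ₂ : ℝ) (q : Mom d),
      volume (levelLayer e ω σ p₁ θ₁ δ₁ ∩ levelLayer e ω σ p₂ θ₂ δ₂ ∩ Metric.ball q ρ)
        ≤ ENNReal.ofReal (C₅ * δ₁ * δ₂ * ρ ^ (d - 2) / ‖p₁ - p₂‖)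

/-- The standing assumptions on the electron dispersion relation `e`, the phonon dispersion
relation `ω`, the form factor `Q` and the chemical potential `μ`, at inverse temperature `β`,
with quantitative constants. -/
structure Admissible (d : ℕ) (β ρ C₁ C₂ C₃ C₄ C₅ C₆ C₇ : ℝ)
    (e ω Q : Mom d → ℝ) (μ : ℝ) : Prop where
  e_nonneg : ∀ k, 0 ≤ e k
  ω_nonneg : ∀ k, 0 ≤ ω k
  e_even : ∀ k, e (-k) = e k
  ω_even : ∀ k, ω (-k) = ω k
  e_contDiff : ContDiff ℝ ((2 * d : ℕ) : ℕ∞) e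
  ω_contDiff : ContDiff ℝ ((2 * d : ℕ) : ℕ∞) ω
  e_bound : ∀ ℓ : ℕ, ℓ ≤ 2 * d → ∀ k,
    ‖iteratedFDeriv ℝ ℓ e k‖ ≤ C₁ * (1 + bracket k ^ ((2 : ℤ) - (ℓ : ℤ)))
  ω_bound : ∀ ℓ : ℕ, ℓ ≤ 2 * d → ∀ k,
    ‖iteratedFDeriv ℝ ℓ ω k‖ ≤ C₂ * (1 + bracket k ^ ((2 : ℤ) - (ℓ : ℤ)))
  Phi_tendsto : ∀ (σ : ℤˣ) (p : Mom d),
    Tendsto (fun k => Phi e ω σ p k) (cocompact (Mom d)) atTop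
  hess_lower : ∀ (σ : ℤˣ) (p k v : Mom d),
    C₃ * ‖v‖ ^ 2 ≤ iteratedFDeriv ℝ 2 (fun k' => Phi e ω σ p k') k ![v, v]
  hess_upper : ∀ (σ : ℤˣ) (p k v : Mom d),
    iteratedFDeriv ℝ 2 (fun k' => Phi e ω σ p k') k ![v, v] ≤ C₄ * ‖v‖ ^ 2
  transversal : Transversal e ω ρ C₅
  gap : ∀ k, C₆ ≤ ω k - μ / β
  Q_even : ∀ k, Q (-k) = Q k
  Q_contDiff : ContDiff ℝ ((2 * d : ℕ) : ℕ∞) Q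
  Q_bound : ∀ ℓ : ℕ, ℓ ≤ 2 * d → ∀ k,
    ‖iteratedFDeriv ℝ ℓ Q k‖ ≤ C₇ * bracket k ^ (-(2 * (d : ℤ) + 12))

/-! ### The finite box: dual lattice and electron density matrices -/

/-- The point `√(2π) L⁻¹ z` of the dual lattice `Λ* = (√(2π) L⁻¹ ℤ)^d`. -/
def latticePt {d : ℕ} (L : ℝ) (z : Fin d → ℤ) : Mom d :=
  WithLp.toLp 2 (fun i => Real.sqrt (2 * Real.pi) / L * (z i : ℝ))

/-- The electron state space `L²_per(Λ_L)`; the box of side `√(2π) L` is rescaled to the unit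
torus by `x = √(2π) L u`, so that the plane wave of momentum `latticePt L z` becomes the Fourier
mode `z`. -/
abbrev ElectronSpace (d : ℕ) : Type :=
  Lp ℂ 2 (Measure.pi (fun _ : Fin d => (AddCircle.haarAddCircle : Measure UnitAddCircle)))

/-- The normalized plane wave of momentum `latticePt L z`: the Fourier mode
`u ↦ exp(2πi z·u)`. -/
def planeWave {d : ℕ} (z : Fin d → ℤ) : ElectronSpace d :=
  ContinuousMap.toLp (E := ℂ) 2
    (Measure.pi (fun _ : Fin d => (AddCircle.haarAddCircle : Measure UnitAddCircle))) ℂ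
    (UnitAddTorus.mFourier z)

/-- Density matrices: positive operators of trace one; the trace is computed in the orthonormal
basis of plane waves. -/
structure IsDensityMatrix {d : ℕ} (γ : ElectronSpace d →L[ℂ] ElectronSpace d) : Prop where
  positive : γ.IsPositive
  trace_one : HasSum (fun z : Fin d → ℤ =>
    inner ℂ (planeWave z) (γ (planeWave z))) 1

/-- The momentum space kernel `γ̂(p, q)` for lattice momenta `p = latticePt L z` and
`q = latticePt L w`, normalized with respect to `∫_{Λ*} dp = L^{-d} ∑_{p ∈ Λ*}`:
for a density matrix, `∫_{Λ*} γ̂(p, p) dp = 1`. -/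
def momKernel {d : ℕ} (L : ℝ) (γ : ElectronSpace d →L[ℂ] ElectronSpace d)
    (z w : Fin d → ℤ) : ℂ :=
  (L : ℂ) ^ d * inner ℂ (planeWave z) (γ (planeWave w))

/-- The moment `∫_{Λ*} ⟨p⟩^{3d+12} γ̂(p, p) dp`. -/
def momentumMoment {d : ℕ} (L : ℝ) (γ : ElectronSpace d →L[ℂ] ElectronSpace d) : ℝ≥0∞ :=
  ∑' z : Fin d → ℤ,
    ENNReal.ofReal ((L ^ d)⁻¹ * (bracket (latticePt L z) ^ (3 * d + 12) * (momKernel L γ z z).re))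

/-! ### Collision patterns -/

/-- `𝓜(n, N)`: the `(n+1)`-tuples of natural numbers with `n + 2 |m| = N`. -/
def patterns (n N : ℕ) : Set (Fin (n + 1) → ℕ) := {m | n + 2 * ∑ j, m j = N}

/-- `μ(j) = j + 2 ∑_{i < j} m_i`. -/
def extIndex {n : ℕ} (m : Fin (n + 1) → ℕ) (j : Fin (n + 1)) : ℕ :=
  (j : ℕ) + 2 * ∑ i ∈ Finset.univ.filter (fun i => i < j), m i

/-- `I_j = {μ(j) + 1, μ(j) + 3, …, μ(j) + 2 m_j - 1}`. -/
def innerSet {n : ℕ} (N : ℕ) (m : Fin (n + 1) → ℕ) (j : Fin (n + 1)) : Finset (Fin (N + 1)) :=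
  Finset.univ.filter (fun b : Fin (N + 1) =>
    (b : ℕ) ∈ (Finset.range (m j)).image (fun r => extIndex m j + (2 * r + 1)))

/-- `I_j^c = {μ(j), μ(j) + 2, …, μ(j) + 2 m_j}`. -/
def outerSet {n : ℕ} (N : ℕ) (m : Fin (n + 1) → ℕ) (j : Fin (n + 1)) : Finset (Fin (N + 1)) :=
  Finset.univ.filter (fun b : Fin (N + 1) =>
    (b : ℕ) ∈ (Finset.range (m j + 1)).image (fun r => extIndex m j + 2 * r))

/-! ### The amplitude of a pairing graph -/

/-- `∫_0^{t*} [ds_j]_0^N F(s) = ∫_0^t ⋯ ∫_0^t ∏ ds_j δ(t - ∑ s_j) F(s)`: the delta function fixes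
`s_0 = t - (s_1 + ⋯ + s_N)`. -/
def timeIntegral (N : ℕ) (t : ℝ) (F : (Fin (N + 1) → ℝ) → ℂ) : ℂ :=
  ∫ s in {s : Fin N → ℝ | (∀ i, 0 ≤ s i) ∧ ∑ i, s i ≤ t},
    F (Fin.cons (t - ∑ i, s i) s : Fin (N + 1) → ℝ)

/-- `Θ(s, p, Ω) = ∑_σ ∫_{Λ*} exp(-is [Φ_σ(p, k) + Ω]) M(k, σ) dk`. -/
def Theta {d : ℕ} (e ω Q : Mom d → ℝ) (β μ L : ℝ) (s : ℝ) (p : Mom d) (Ω : ℝ) : ℂ :=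
  ∑ σ : ℤˣ, ((L : ℂ) ^ d)⁻¹ * ∑' z : Fin d → ℤ,
    Complex.exp (-Complex.I * ((s * (Phi e ω σ p (latticePt L z) + Ω) : ℝ) : ℂ)) *
      (vertexWeight ω Q β μ (latticePt L z) σ : ℂ)

/-- `p_j = p_n + ∑_{ℓ = j+1}^n k_ℓ`; the momentum `k_ℓ`, `1 ≤ ℓ ≤ n`, is `k (ℓ - 1)`. -/
def electronMom {d n : ℕ} (p : Mom d) (k : Fin n → Mom d) (j : Fin (n + 1)) : Mom d :=
  p + ∑ ℓ ∈ Finset.univ.filter (fun ℓ : Fin n => (j : ℕ) ≤ (ℓ : ℕ)), k ℓ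

/-- `Ω_j = ∑_{ℓ = j+1}^n σ_ℓ ω(k_ℓ)`. -/
def phononEnergy {d n : ℕ} (ω : Mom d → ℝ) (k : Fin n → Mom d) (σ : Fin n → ℤˣ)
    (j : Fin (n + 1)) : ℝ :=
  ∑ ℓ ∈ Finset.univ.filter (fun ℓ : Fin n => (j : ℕ) ≤ (ℓ : ℕ)), sgn (σ ℓ) * ω (k ℓ)

/-- One collision history with external momenta `k`, signs `σ` and incoming momentum `p = p_n`:
`∫_0^{t*} [ds_b]_0^N ∏_j [∏_{b ∈ I_j^c} exp(-i s_b [e(p_j) + Ω_j]) ∏_{b ∈ I_j} Θ(s_b, p_j, Ω_j)]`. -/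
def history {d n : ℕ} (e ω Q : Mom d → ℝ) (β μ L : ℝ) (N : ℕ) (m : Fin (n + 1) → ℕ) (t : ℝ)
    (p : Mom d) (k : Fin n → Mom d) (σ : Fin n → ℤˣ) : ℂ :=
  timeIntegral N t (fun s => ∏ j : Fin (n + 1),
    ((∏ b ∈ outerSet N m j, Complex.exp
        (-Complex.I * ((s b * (e (electronMom p k j) + phononEnergy ω k σ j) : ℝ) : ℂ))) *
      ∏ b ∈ innerSet N m j, Theta e ω Q β μ L (s b) (electronMom p k j) (phononEnergy ω k σ j)))

/-- `Y_{m, m', π}(t; p, p', k, k', σ)`. The second history carries the signs `σ ∘ π⁻¹`, and all of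
its phases and its factors `Θ` are complex conjugated. -/
def graphAmplitude {d n : ℕ} (e ω Q : Mom d → ℝ) (β μ L : ℝ) (N : ℕ) (m m' : Fin (n + 1) → ℕ)
    (π : Equiv.Perm (Fin n)) (t : ℝ) (p p' : Mom d) (k k' : Fin n → Mom d)
    (σ : Fin n → ℤˣ) : ℂ :=
  history e ω Q β μ L N m t p k σ *
    conj (history e ω Q β μ L N m' t p' k' (fun ℓ => σ (π.symm ℓ)))

/-- The summand, at `k ∈ (Λ*)^n` and `p_n ∈ Λ*`, of the integral that defines `C_{m, m', π}(t)`,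
summed over the signs. The lattice delta functions `δ(k_j - k'_{π(j)})` and `δ(p_n - p'_n)` have
been integrated out: `k' = k ∘ π⁻¹` and `p'_n = p_n`. -/
def graphSummand {d n : ℕ} (e ω Q : Mom d → ℝ) (β μ L : ℝ)
    (γ : ElectronSpace d →L[ℂ] ElectronSpace d) (N : ℕ) (m m' : Fin (n + 1) → ℕ)
    (π : Equiv.Perm (Fin n)) (t : ℝ) (x : (Fin n → Fin d → ℤ) × (Fin d → ℤ)) : ℂ :=
  ∑ σ : Fin n → ℤˣ,
    (∏ j, (vertexWeight ω Q β μ (latticePt L (x.1 j)) (σ j) : ℂ)) * momKernel L γ x.2 x.2 *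
      graphAmplitude e ω Q β μ L N m m' π t (latticePt L x.2) (latticePt L x.2)
        (fun j => latticePt L (x.1 j)) (fun j => latticePt L (x.1 (π.symm j))) σ

/-- `C_{m, m', π}(t) = λ^{2N} ∑_σ ∫ dν_π Y_{m, m', π}(t)` in the box of size `L`, where the integral
over `n + 1` momenta in `Λ*` is `L^{-d(n+1)}` times the sum. -/
def graphValue {d n : ℕ} (e ω Q : Mom d → ℝ) (β μ L : ℝ)
    (γ : ElectronSpace d →L[ℂ] ElectronSpace d) (lam : ℝ) (N : ℕ) (m m' : Fin (n + 1) → ℕ)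
    (π : Equiv.Perm (Fin n)) (t : ℝ) : ℂ :=
  (lam : ℂ) ^ (2 * N) * (((L : ℂ) ^ d)⁻¹) ^ (n + 1) *
    ∑' x : (Fin n → Fin d → ℤ) × (Fin d → ℤ), graphSummand e ω Q β μ L γ N m m' π t x

end PhononBoltzmann

end

noncomputable section

namespace PhononBoltzmann

/-! ### The bracket -/

/-! Write `R = |α - E + i/t|⁻¹` for the regularized propagator (`res`, or `eres` in `ℝ≥0∞`). A
history is an `(N+1)`-fold convolution in time, so damping by `e^{-s/t}` and Fourier inversion bound
it by an energy integral `∫ dα` of a product of transforms. A phase with energy `E` yields a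
propagator `R`. A recollision `Θ` yields only a constant, because in infinite volume `Θ(s)` decays
like `(1+s)^{-5/4}`, which is integrable (`oscillatory_decay`). This decay comes from two
integrations by parts along dilations centred at the minimum of the convex phase, and it needs `d ≥
3`. Each recollision also duplicates a propagator, which costs at most `t`; together the two
histories lose `t^{N-n}` in this way (`Regular.enorm_historyWith_le`).

What remains is the integral over the `n` exchanged momenta of the two products of `R`. The decay
also gives `∫ R² M ≤ Bt` and `∫ R M ≤ B log t`, and transversality gives `∫ R R' M ≤ B (log t)² (1 +
|p - p' + i/t|⁻¹)` (`exists_propagatorBounds`). Without crossing one would apply Schwarz and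
integrate the squares one momentum at a time, which gives `t^n`.

If `π ≠ 1`, let `r` be the largest index moved by `π`, and `a = π⁻¹ r < r`. Beyond `r` both
histories carry the same momenta, so the `r`-th propagator of the second history depends, apart from
these common momenta, on `k_a` only. Schwarz is applied to all propagators but a few
(`prod_mul_prod_le`), so that this one can be integrated over `k_a` together with the `a`-th
propagator of the first history. Transversality replaces `t` by logarithms and the singularity
`|k_{a+1} + ⋯ + k_r|⁻¹`, which costs `t^{2/5}` in the `k_{a+1}` integral, and the unsquared
propagator `r` saves another `t`. With the factor `t` spent in the Schwarz step the total is
`t^{n-3/5}` times logarithms (`Regular.lintegral_ladderProd_le`, `Regular.lintegral_crossing_le`).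

The last propagator depends on `p` alone, so the energy integrals cost one logarithm each, apart
from a tail controlled by the fourth moment of `M` (`Regular.lintegral_resolventIntegral_le`). Five
logarithms are absorbed in `t^{1/10}`, which leaves `t^{N-1/2}` (`exists_graphLim_bound`); for `t ≤
1` the volume of the simplices suffices.

Finally, lattice sums are integrals of step functions. Dominated convergence, jointly in `L → ∞` and
in the incoming momentum, together with compactness transfers the bound to large boxes with growth
`⟨p⟩⁴` (`Regular.eventually_norm_graphBox_le`), and the moment assumption on the density matrix sums
over `p`. -/

lemma one_le_bracket {d : ℕ} (k : Mom d) : 1 ≤ bracket k := by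
  rw [bracket, Real.le_sqrt (by norm_num) (by positivity)]
  nlinarith [sq_nonneg ‖k‖]

lemma bracket_pos {d : ℕ} (k : Mom d) : 0 < bracket k := lt_of_lt_of_le one_pos (one_le_bracket k)

lemma continuous_bracket {d : ℕ} : Continuous (bracket : Mom d → ℝ) := by
  unfold bracket; fun_prop

lemma norm_le_bracket {d : ℕ} (k : Mom d) : ‖k‖ ≤ bracket k :=
  Real.le_sqrt_of_sq_le (by linarith)

lemma bracket_sq {d : ℕ} (k : Mom d) : bracket k ^ 2 = ‖k‖ ^ 2 + 1 :=
  Real.sq_sqrt (by positivity)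

lemma bracket_le_add {d : ℕ} (k l : Mom d) : bracket k ≤ (1 + ‖k - l‖) * bracket l := by
  have h : bracket k ≤ bracket l + ‖k - l‖ := by
    rw [bracket, Real.sqrt_le_left (by have := bracket_pos l; positivity)]
    have h1 : ‖k‖ ≤ ‖l‖ + ‖k - l‖ := by
      have := norm_add_le l (k - l); simpa using this
    nlinarith [bracket_sq l, norm_le_bracket l, norm_nonneg (k - l), norm_nonneg k, norm_nonneg l,
      mul_le_mul_of_nonneg_right (norm_le_bracket l) (norm_nonneg (k - l))]
  nlinarith [one_le_bracket l, norm_nonneg (k - l)]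

/-- The weight `⟨k⟩^{-m}`. -/
def wt {d : ℕ} (m : ℕ) (k : Mom d) : ℝ := (bracket k ^ m)⁻¹

lemma wt_pos {d : ℕ} (m : ℕ) (k : Mom d) : 0 < wt m k := by
  have := bracket_pos k; unfold wt; positivity

lemma continuous_wt {d : ℕ} (m : ℕ) : Continuous (wt m : Mom d → ℝ) := by
  unfold wt
  exact (continuous_bracket.pow m).inv₀ fun k => (pow_pos (bracket_pos k) m).ne'

lemma wt_add {d : ℕ} (m n : ℕ) (k : Mom d) : wt (m + n) k = wt m k * wt n k := by
  unfold wt; rw [pow_add, mul_inv]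

lemma bracket_pow_mul_wt {d : ℕ} (m n : ℕ) (k : Mom d) : bracket k ^ m * wt (m + n) k = wt n k := by
  have := bracket_pos k
  rw [wt_add]; unfold wt; field_simp

lemma wt_le_one {d : ℕ} (m : ℕ) (k : Mom d) : wt m k ≤ 1 := by
  unfold wt; exact inv_le_one_of_one_le₀ (one_le_pow₀ (one_le_bracket k))

lemma wt_anti {d : ℕ} {m n : ℕ} (h : m ≤ n) (k : Mom d) : wt n k ≤ wt m k := by
  unfold wt
  have := bracket_pos k
  exact inv_anti₀ (by positivity) (pow_le_pow_right₀ (one_le_bracket k) h)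

/-- Peetre's inequality. It moves weights to the centre of a ball in `Regular.vtx_le_of_ball`, and
from a lattice point to the points of its cell in `wt_snap_le`. -/
lemma wt_le_of_dist {d : ℕ} (m : ℕ) (k l : Mom d) : wt m k ≤ (1 + ‖k - l‖) ^ m * wt m l := by
  have hk := bracket_pos k
  have hl := bracket_pos l
  have h := pow_le_pow_left₀ hl.le (bracket_le_add l k) m
  rw [mul_pow, norm_sub_rev] at h
  unfold wt
  rw [← div_eq_mul_inv, inv_eq_one_div, div_le_div_iff₀ (by positivity) (by positivity)]
  linarith

lemma integrable_wt {d : ℕ} : Integrable (wt (d + 1) : Mom d → ℝ) := by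
  have h := integrable_rpow_neg_one_add_norm_sq (E := Mom d) (μ := volume) (r := (d : ℝ) + 1)
    (by simp)
  refine h.congr (Eventually.of_forall fun k => ?_)
  simp only [wt, bracket]
  rw [Real.sqrt_eq_rpow, ← Real.rpow_mul_natCast (by positivity),
    ← Real.rpow_neg (by positivity), add_comm]
  congr 1; push_cast; ring

lemma integrable_wt' {d m : ℕ} (h : d + 1 ≤ m) : Integrable (wt m : Mom d → ℝ) :=
  integrable_wt.mono' (continuous_wt m).aestronglyMeasurable
    (Eventually.of_forall fun k => by
      rw [Real.norm_of_nonneg (wt_pos m k).le]; exact wt_anti h k)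

/-! ### Derivatives along dilations -/

/-- `F'` is the derivative of `F` along the dilations centred at `k₀`: `F' k = DF(k) (k - k₀)`. -/
def HasEuler {d : ℕ} {E : Type*} [NormedAddCommGroup E] [NormedSpace ℝ E] (k₀ : Mom d)
    (F F' : Mom d → E) : Prop :=
  ∀ (x : Mom d) (τ : ℝ), HasDerivAt (fun τ => F (k₀ + Real.exp τ • x)) (F' (k₀ + Real.exp τ • x)) τ

section Euler

variable {d : ℕ} {k₀ : Mom d}

lemma HasEuler.congr_deriv {E : Type*} [NormedAddCommGroup E] [NormedSpace ℝ E]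
    {F F' G : Mom d → E} (h : HasEuler k₀ F F') (hG : ∀ k, F' k = G k) : HasEuler k₀ F G :=
  fun x τ => by rw [← hG]; exact h x τ

lemma HasEuler.of_hasFDerivAt {E : Type*} [NormedAddCommGroup E] [NormedSpace ℝ E]
    {F F' : Mom d → E} (D : Mom d → Mom d →L[ℝ] E) (h : ∀ k, HasFDerivAt F (D k) k)
    (hF : ∀ k, F' k = D k (k - k₀)) : HasEuler k₀ F F' := by
  intro x τ
  have h1 : HasDerivAt (fun τ : ℝ => k₀ + Real.exp τ • x) (Real.exp τ • x) τ :=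
    ((Real.hasDerivAt_exp τ).smul_const x).const_add k₀
  have := (h (k₀ + Real.exp τ • x)).comp_hasDerivAt τ h1
  rw [hF]; simpa [Function.comp_def] using this

lemma HasEuler.const {E : Type*} [NormedAddCommGroup E] [NormedSpace ℝ E] (c : E) :
    HasEuler k₀ (fun _ => c) (fun _ => 0) := fun _ τ => hasDerivAt_const τ c

lemma HasEuler.add {E : Type*} [NormedAddCommGroup E] [NormedSpace ℝ E]
    {F F' G G' : Mom d → E} (hF : HasEuler k₀ F F') (hG : HasEuler k₀ G G') :
    HasEuler k₀ (fun k => F k + G k) (fun k => F' k + G' k) := fun x τ => (hF x τ).add (hG x τ)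

lemma HasEuler.mul {𝔸 : Type*} [NormedRing 𝔸] [NormedAlgebra ℝ 𝔸]
    {F F' G G' : Mom d → 𝔸} (hF : HasEuler k₀ F F') (hG : HasEuler k₀ G G') :
    HasEuler k₀ (fun k => F k * G k) (fun k => F' k * G k + F k * G' k) :=
  fun x τ => (hF x τ).mul (hG x τ)

lemma HasEuler.const_mul {𝔸 : Type*} [NormedRing 𝔸] [NormedAlgebra ℝ 𝔸] (c : 𝔸)
    {F F' : Mom d → 𝔸} (hF : HasEuler k₀ F F') :
    HasEuler k₀ (fun k => c * F k) (fun k => c * F' k) :=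
  fun x τ => (hF x τ).const_mul c

lemma HasEuler.inv {F F' : Mom d → ℝ} (hF : HasEuler k₀ F F') (h0 : ∀ k, F k ≠ 0) :
    HasEuler k₀ (fun k => (F k)⁻¹) (fun k => -F' k / F k ^ 2) :=
  fun x τ => (hF x τ).inv (h0 _)

lemma HasEuler.exp {F F' : Mom d → ℝ} (hF : HasEuler k₀ F F') :
    HasEuler k₀ (fun k => Real.exp (F k)) (fun k => Real.exp (F k) * F' k) :=
  fun x τ => (hF x τ).exp

lemma HasEuler.cexp {F F' : Mom d → ℂ} (hF : HasEuler k₀ F F') :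
    HasEuler k₀ (fun k => Complex.exp (F k)) (fun k => Complex.exp (F k) * F' k) :=
  fun x τ => (hF x τ).cexp

lemma HasEuler.ofReal {F F' : Mom d → ℝ} (hF : HasEuler k₀ F F') :
    HasEuler k₀ (fun k => (F k : ℂ)) (fun k => (F' k : ℂ)) :=
  fun x τ => (hF x τ).ofReal_comp

/-- The adjoint of the Euler derivation is minus itself minus the dimension. -/
lemma HasEuler.integral_eq {F F' : Mom d → ℂ} (hF : HasEuler k₀ F F') (hd : d ≠ 0)
    (hc' : Continuous F') (hi : Integrable F) (hi' : Integrable F') :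
    ∫ k, F' k = -(d : ℂ) * ∫ k, F k := by
  -- Boundary terms at infinity are avoided by integrating `d/dτ F(k₀ + e^τ x)` over `0 ≤ τ ≤ 1` and
  -- over `x`. By Fubini each `x`-integral only picks up the Jacobian `e^{-dτ}`, so integrability of
  -- `F` and `F'` is enough.
  have hdil : ∀ (G : Mom d → ℂ) (τ : ℝ),
      ∫ x, G (k₀ + Real.exp τ • x) = (Real.exp (-(d * τ)) : ℝ) • ∫ x, G x := by
    intro G τ
    rw [Measure.integral_comp_smul volume (fun x => G (k₀ + x)) (Real.exp τ),
      integral_add_left_eq_self]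
    congr 1
    rw [abs_of_pos (by positivity), ← Real.exp_nat_mul, ← Real.exp_neg]
    simp
  have hFTC : ∀ x, ∫ τ in (0 : ℝ)..1, F' (k₀ + Real.exp τ • x)
      = F (k₀ + Real.exp 1 • x) - F (k₀ + Real.exp 0 • x) := by
    intro x
    exact intervalIntegral.integral_eq_sub_of_hasDerivAt (fun τ _ => hF x τ)
      (by apply Continuous.intervalIntegrable; fun_prop)
  have hint : ∀ (G : Mom d → ℂ), Integrable G → ∀ τ : ℝ,
      Integrable (fun x => G (k₀ + Real.exp τ • x)) := fun G hG τ =>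
    (hG.comp_add_left k₀).comp_smul (Real.exp_pos τ).ne'
  have hprod : Integrable (Function.uncurry fun (τ : ℝ) (x : Mom d) => F' (k₀ + Real.exp τ • x))
      ((volume.restrict (Set.uIoc (0 : ℝ) 1)).prod volume) := by
    rw [integrable_prod_iff (by
      apply Continuous.aestronglyMeasurable
      simp only [Function.uncurry_def]; fun_prop)]
    refine ⟨Eventually.of_forall fun τ => hint F' hi' τ, ?_⟩
    have : ∀ τ : ℝ, ∫ x, ‖F' (k₀ + Real.exp τ • x)‖ = Real.exp (-(d * τ)) * ∫ x, ‖F' x‖ := by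
      intro τ
      rw [Measure.integral_comp_smul volume (fun x => ‖F' (k₀ + x)‖) (Real.exp τ),
        integral_add_left_eq_self (fun x => ‖F' x‖)]
      congr 1
      rw [abs_of_pos (by positivity), ← Real.exp_nat_mul, ← Real.exp_neg]
      simp
    simp only [Function.uncurry_apply_pair, this]
    have hcont : Continuous fun τ : ℝ => Real.exp (-(d * τ)) * ∫ x, ‖F' x‖ := by fun_prop
    rw [Set.uIoc_of_le zero_le_one]
    exact hcont.integrableOn_Ioc
  have hswap := intervalIntegral_integral_swap hprod
  simp only [hFTC, hdil] at hswap
  rw [integral_sub (hint F hi 1) (hint F hi 0), hdil, hdil, intervalIntegral.integral_smul_const]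
    at hswap
  have hd' : (d : ℝ) ≠ 0 := by exact_mod_cast hd
  have hE : ∫ τ in (0 : ℝ)..1, Real.exp (-(d * τ)) = (1 - Real.exp (-d)) / d := by
    have : ∀ τ ∈ Set.uIcc (0 : ℝ) 1, HasDerivAt (fun τ => -Real.exp (-(d * τ)) / d)
        (Real.exp (-(d * τ))) τ := by
      intro τ _
      have h1 : HasDerivAt (fun τ : ℝ => -(d * τ)) (-(d : ℝ)) τ := by
        have := ((hasDerivAt_id' τ).const_mul (d : ℝ)).fun_neg
        rwa [mul_one] at this
      have := (h1.exp.neg).div_const (d : ℝ)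
      convert! this using 1; field_simp
    rw [intervalIntegral.integral_eq_sub_of_hasDerivAt this
      (by apply Continuous.intervalIntegrable; fun_prop)]
    simp; ring
  have hne : (1 - Real.exp (-d)) ≠ 0 := by
    have : Real.exp (-(d : ℝ)) < 1 := by
      rw [Real.exp_lt_one_iff]
      have : (0 : ℝ) < d := by positivity
      linarith
    linarith
  rw [hE] at hswap
  simp only [Complex.real_smul] at hswap
  have hne' : ((1 - Real.exp (-d) : ℝ) : ℂ) ≠ 0 := by exact_mod_cast hne
  have hdc : (d : ℂ) ≠ 0 := by exact_mod_cast hd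
  apply mul_left_cancel₀ hne'
  push_cast at hswap ⊢
  field_simp at hswap
  simp at hswap
  linear_combination hswap

end Euler

end PhononBoltzmann

end

noncomputable section

namespace PhononBoltzmann

/-! ### Decay of oscillatory integrals with a convex phase -/

section Dispersive

variable {d : ℕ} {k₀ : Mom d}

/-- One integration by parts along dilations in `∫ e^{-isΦ} f`. -/
lemma oscillatory_step (hd : d ≠ 0) {Φ ψ q u a : Mom d → ℝ} {f f₁ : Mom d → ℂ} {s A : ℝ}
    (hs : 0 ≤ s) (hΦ : HasEuler k₀ Φ ψ) (hψ : HasEuler k₀ ψ (fun k => ψ k + q k))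
    (hψ0 : ∀ k, 0 ≤ ψ k) (hu : ∀ k, u k = (1 + s * ψ k)⁻¹)
    (ha : ∀ k, a k = s * u k * (ψ k + q k)) (haA : ∀ k, |a k| ≤ A)
    (cΦ : Continuous Φ) (cψ : Continuous ψ) (cq : Continuous q) (cf : Continuous f)
    (cf₁ : Continuous f₁) (hf : HasEuler k₀ f f₁) (hfi : Integrable f) (hfi₁ : Integrable f₁) :
    ∫ k, Complex.exp (-Complex.I * ((s * Φ k : ℝ) : ℂ)) * f k
      = ∫ k, Complex.exp (-Complex.I * ((s * Φ k : ℝ) : ℂ)) *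
        ((u k : ℂ) * ((1 - Complex.I * d + Complex.I * a k) * f k - Complex.I * f₁ k)) := by
  have hpos : ∀ k, 0 < 1 + s * ψ k := fun k => by have := mul_nonneg hs (hψ0 k); linarith
  have hu0 : ∀ k, 0 ≤ u k := fun k => by rw [hu]; exact (inv_pos.2 (hpos k)).le
  have hu1 : ∀ k, u k ≤ 1 := fun k => by
    rw [hu]; exact inv_le_one_of_one_le₀ (by have := mul_nonneg hs (hψ0 k); linarith)
  have huψ : ∀ k, u k * (1 + s * ψ k) = 1 := fun k => by
    rw [hu]; exact inv_mul_cancel₀ (hpos k).ne'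
  have cu : Continuous u := by
    rw [funext hu]; exact (by fun_prop : Continuous fun k => 1 + s * ψ k).inv₀ fun k => (hpos k).ne'
  have ca : Continuous a := by rw [funext ha]; fun_prop
  have hEu : HasEuler k₀ u (fun k => -(u k * a k)) := by
    rw [funext hu]
    refine (((HasEuler.const (1 : ℝ)).add (hψ.const_mul s)).inv fun k => (hpos k).ne').congr_deriv
      fun k => ?_
    rw [ha, hu]
    have := (hpos k).ne'
    field_simp
    ring
  set e : Mom d → ℂ := fun k => Complex.exp (-Complex.I * ((s * Φ k : ℝ) : ℂ)) with he
  have ce : Continuous e := by fun_prop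
  have hne : ∀ k, ‖e k‖ = 1 := fun k => by
    simp only [he]; rw [Complex.norm_exp]; simp
  have hEe : HasEuler k₀ e (fun k => e k * (-Complex.I * ((s * ψ k : ℝ) : ℂ))) :=
    (((hΦ.const_mul s).ofReal).const_mul (-Complex.I)).cexp
  -- The Euler derivation sends the phase `e` to `-isψe`, so `e = u (e + i · Euler e)` with `u =
  -- (1+sψ)⁻¹`. Unlike division by `sψ` this is regular at the critical point. The adjoint is then
  -- applied to `uf`, where the Euler derivative of `u` is `-ua`.
  have hF := hEe.mul (hEu.ofReal.mul hf)
  set F : Mom d → ℂ := fun k => e k * ((u k : ℂ) * f k) with hFdef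
  have hFi : Integrable F := by
    refine hfi.mono (by apply Continuous.aestronglyMeasurable; fun_prop)
      (Eventually.of_forall fun k => ?_)
    simp only [hFdef, norm_mul, hne, one_mul, Complex.norm_real, Real.norm_of_nonneg (hu0 k)]
    exact mul_le_of_le_one_left (norm_nonneg _) (hu1 k)
  set G : Mom d → ℂ := fun k => e k * ((u k : ℂ) *
    ((1 - Complex.I * d + Complex.I * a k) * f k - Complex.I * f₁ k)) with hG
  have hGi : Integrable G := by
    refine ((hfi.norm.const_mul (1 + d + A)).add hfi₁.norm).mono'
      (by apply Continuous.aestronglyMeasurable; fun_prop) (Eventually.of_forall fun k => ?_)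
    simp only [hG, norm_mul, hne, one_mul, Complex.norm_real, Real.norm_of_nonneg (hu0 k)]
    refine (mul_le_of_le_one_left (norm_nonneg _) (hu1 k)).trans ?_
    refine (norm_sub_le _ _).trans ?_
    simp only [Pi.add_apply, norm_mul, Complex.norm_I, one_mul]
    gcongr
    refine (norm_add_le _ _).trans ?_
    gcongr
    · refine (norm_sub_le _ _).trans ?_
      simp
    · simpa using haA k
  have hkey : ∀ k, e k * ((-Complex.I * ((s * ψ k : ℝ) : ℂ))) * ((u k : ℂ) * f k) +
      e k * (((-(u k * a k) : ℝ) : ℂ) * f k + (u k : ℂ) * f₁ k)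
      = -Complex.I * (e k * f k) + Complex.I * G k - d * F k := by
    intro k
    have h1 : (u k : ℂ) * (1 + s * ψ k) = 1 := by exact_mod_cast huψ k
    simp only [hG, hFdef]
    push_cast
    linear_combination (-Complex.I * e k * f k) * h1 +
      (u k * e k * d * f k - u k * e k * a k * f k + u k * e k * f₁ k) * Complex.I_sq
  have hei : Integrable (fun k => e k * f k) :=
    hfi.mono (by apply Continuous.aestronglyMeasurable; fun_prop)
      (Eventually.of_forall fun k => by simp [hne])
  have hR : Integrable (fun k => -Complex.I * (e k * f k) + Complex.I * G k - d * F k) :=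
    ((hei.const_mul _).add (hGi.const_mul _)).sub (hFi.const_mul _)
  have hint := hF.integral_eq hd (by fun_prop) hFi (by simpa only [hkey] using hR)
  simp only [hkey] at hint
  have i1 := hei.const_mul (-Complex.I)
  have i2 := hGi.const_mul Complex.I
  rw [integral_sub (f := fun k => -Complex.I * (e k * f k) + Complex.I * G k) (i1.add i2)
    (hFi.const_mul _), integral_add i1 i2, integral_const_mul, integral_const_mul,
    integral_const_mul] at hint
  have : Complex.I * (∫ k, e k * f k) = Complex.I * ∫ k, G k := by
    linear_combination -hint
  exact mul_left_cancel₀ Complex.I_ne_zero this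

/-- The singular weight `|x|^{-5/2}` on the unit ball. -/
def sing {d : ℕ} (x : Mom d) : ℝ := if ‖x‖ < 1 then ‖x‖ ^ (-(5 / 2) : ℝ) else 0

lemma sing_nonneg {d : ℕ} (x : Mom d) : 0 ≤ sing x := by
  unfold sing; split_ifs <;> positivity

lemma measurable_sing {d : ℕ} : Measurable (sing : Mom d → ℝ) := by
  unfold sing
  exact Measurable.ite (measurableSet_lt measurable_norm measurable_const) (by fun_prop) (by fun_prop)

/-- In polar coordinates the density is `y^{d-1-5/2} ≤ y^{-1/2}` on `(0,1)`, because `d - 1 ≥ 2`. -/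
lemma integrable_sing (hd : 3 ≤ d) : Integrable (sing : Mom d → ℝ) := by
  have : Nontrivial (Mom d) := by
    have : Nonempty (Fin d) := ⟨⟨0, by omega⟩⟩
    infer_instance
  have h : IntegrableOn (fun x : Mom d => (fun y : ℝ => y ^ (-(5 / 2) : ℝ)) ‖x‖)
      (Metric.ball 0 1) := by
    rw [integrableOn_fun_norm_addHaar volume (f := fun y : ℝ => y ^ (-(5 / 2) : ℝ)) (r := 1)]
    have h1 : IntegrableOn (fun y : ℝ => y ^ (-(1 / 2) : ℝ)) (Set.Ioo 0 1) := by
      have := (intervalIntegral.intervalIntegrable_rpow' (a := 0) (b := 1) (r := -(1 / 2))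
        (by norm_num)).1
      exact this.mono_set Set.Ioo_subset_Ioc_self
    refine Integrable.mono' h1 (by apply Measurable.aestronglyMeasurable; fun_prop) ?_
    filter_upwards [ae_restrict_mem measurableSet_Ioo] with y hy
    have hy0 : 0 < y := hy.1
    rw [smul_eq_mul, Real.norm_of_nonneg (by positivity), ← Real.rpow_natCast,
      ← Real.rpow_add hy0]
    apply Real.rpow_le_rpow_of_exponent_ge hy0 hy.2.le
    simp only [finrank_euclideanSpace, Fintype.card_fin]
    have : ((d - 1 : ℕ) : ℝ) ≥ 2 := by
      have : 2 ≤ d - 1 := by omega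
      exact_mod_cast this
    linarith
  rw [← integrable_indicator_iff Metric.isOpen_ball.measurableSet] at h
  refine h.congr (Eventually.of_forall fun x => ?_)
  simp [Set.indicator, sing]

/-- Interpolation: `U² ≤ (sc‖x‖²)^{-θ}` for `0 ≤ θ ≤ 2`. Inside the unit ball `θ = 5/4` leaves the
integrable singularity `‖x‖^{-5/2}`. Outside, `θ = 3/2` cancels the cubic growth exactly, which is
why the final constant does not depend on `k₀`. -/
lemma damped_le {c s X U : ℝ} (hc : 0 < c) (hs : 1 ≤ s) (hX : 0 ≤ X) (hU : U = (1 + s * X)⁻¹)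
    {x : Mom d} (hx0 : x ≠ 0) (hx : c * ‖x‖ ^ 2 ≤ X) :
    U ^ 2 * (1 + ‖x‖) ^ 3 ≤ 8 * (c ^ (-(5 / 4) : ℝ) + c ^ (-(3 / 2) : ℝ)) * s ^ (-(5 / 4) : ℝ) *
      (1 + sing x) := by
  have hs0 : 0 < s := by linarith
  have hy : 0 < ‖x‖ := norm_pos_iff.2 hx0
  have hU0 : 0 < U := by rw [hU]; positivity
  set z := s * (c * ‖x‖ ^ 2) with hz
  have hz0 : 0 < z := by positivity
  have hUz : U ≤ (1 + z)⁻¹ := by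
    rw [hU]
    exact inv_anti₀ (by positivity) (by have := mul_le_mul_of_nonneg_left hx hs0.le; linarith)
  have hpow : ∀ θ : ℝ, 0 ≤ θ → θ ≤ 2 → U ^ 2 ≤ z ^ (-θ) := by
    intro θ h0 h2
    calc U ^ 2 ≤ ((1 + z)⁻¹) ^ 2 := by gcongr
      _ = (1 + z) ^ (-2 : ℝ) := by
        rw [Real.rpow_neg (by positivity), inv_pow]; norm_cast
      _ ≤ (1 + z) ^ (-θ) := Real.rpow_le_rpow_of_exponent_le (by linarith) (by linarith)
      _ ≤ z ^ (-θ) := Real.rpow_le_rpow_of_nonpos hz0 (by linarith) (by linarith)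
  have hzpow : ∀ θ : ℝ, z ^ (-θ) = s ^ (-θ) * (c ^ (-θ) * ‖x‖ ^ (-(2 * θ))) := by
    intro θ
    rw [hz, Real.mul_rpow hs0.le (by positivity), Real.mul_rpow hc.le (by positivity),
      ← Real.rpow_natCast, ← Real.rpow_mul hy.le]
    congr 3; push_cast; ring
  have hc1 : 0 < c ^ (-(5 / 4) : ℝ) := by positivity
  have hc2 : 0 < c ^ (-(3 / 2) : ℝ) := by positivity
  have hs1 : 0 < s ^ (-(5 / 4) : ℝ) := by positivity
  by_cases h1 : ‖x‖ < 1
  · have hsing : sing x = ‖x‖ ^ (-(5 / 2) : ℝ) := by simp [sing, h1]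
    have h3 : (1 + ‖x‖) ^ 3 ≤ 8 := by
      calc (1 + ‖x‖) ^ 3 ≤ (2 : ℝ) ^ 3 := by gcongr; linarith
        _ = 8 := by norm_num
    have := hpow (5 / 4) (by norm_num) (by norm_num)
    rw [hzpow] at this
    norm_num at this
    have hsg : 0 < ‖x‖ ^ (-(5 / 2) : ℝ) := by positivity
    calc U ^ 2 * (1 + ‖x‖) ^ 3
        ≤ (s ^ (-(5 / 4) : ℝ) * (c ^ (-(5 / 4) : ℝ) * ‖x‖ ^ (-(5 / 2) : ℝ))) * 8 := by gcongr
      _ = 8 * c ^ (-(5 / 4) : ℝ) * s ^ (-(5 / 4) : ℝ) * ‖x‖ ^ (-(5 / 2) : ℝ) := by ring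
      _ ≤ _ := by rw [hsing]; gcongr <;> linarith
  · have hsing : sing x = 0 := by simp [sing, h1]
    push Not at h1
    have h3 : (1 + ‖x‖) ^ 3 ≤ 8 * ‖x‖ ^ 3 := by
      calc (1 + ‖x‖) ^ 3 ≤ (2 * ‖x‖) ^ 3 := by gcongr; linarith
        _ = 8 * ‖x‖ ^ 3 := by ring
    have := hpow (3 / 2) (by norm_num) (by norm_num)
    rw [hzpow, show -(2 * (3 / 2 : ℝ)) = -3 by norm_num] at this
    have hs2 : s ^ (-(3 / 2) : ℝ) ≤ s ^ (-(5 / 4) : ℝ) :=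
      Real.rpow_le_rpow_of_exponent_le hs (by norm_num)
    have hxx : ‖x‖ ^ (-3 : ℝ) * ‖x‖ ^ 3 = 1 := by
      rw [← Real.rpow_natCast, ← Real.rpow_add hy]; norm_num
    calc U ^ 2 * (1 + ‖x‖) ^ 3
        ≤ (s ^ (-(3 / 2) : ℝ) * (c ^ (-(3 / 2) : ℝ) * ‖x‖ ^ (-3 : ℝ))) * (8 * ‖x‖ ^ 3) := by
          gcongr
      _ = 8 * c ^ (-(3 / 2) : ℝ) * s ^ (-(3 / 2) : ℝ) * (‖x‖ ^ (-3 : ℝ) * ‖x‖ ^ 3) := by ring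
      _ ≤ 8 * (c ^ (-(5 / 4) : ℝ) + c ^ (-(3 / 2) : ℝ)) * s ^ (-(5 / 4) : ℝ) * 1 := by
        rw [hxx]
        gcongr
        linarith
      _ ≤ _ := by rw [hsing]; simp

/-- The constant in the decay estimate for oscillatory integrals. -/
def dispConst (d : ℕ) (c A B : ℝ) : ℝ :=
  (2 * (1 + d + (1 + A / c)) ^ 2 + ((1 + A / c) ^ 2 + 1 + 3 * (A / c)) + (1 + d + (1 + A / c))) *
    B * (8 * (c ^ (-(5 / 4) : ℝ) + c ^ (-(3 / 2) : ℝ))) *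
      (∫ k : Mom d, wt (d + 1) k + sing k)

set_option maxHeartbeats 1000000 in
/-- An oscillatory integral with a uniformly convex phase decays like `s^{-5/4}` in dimension
at least three, uniformly in the position of the critical point. -/
theorem oscillatory_decay (hd : 3 ≤ d) {Φ ψ q r : Mom d → ℝ} {f f₁ f₂ : Mom d → ℂ} {s c A B : ℝ}
    (hs : 1 ≤ s) (hc : 0 < c) (hA : 0 ≤ A) (hB : 0 ≤ B)
    (hΦ : HasEuler k₀ Φ ψ) (hψ : HasEuler k₀ ψ (fun k => ψ k + q k))
    (hq : HasEuler k₀ q (fun k => 2 * q k + r k))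
    (cΦ : Continuous Φ) (cψ : Continuous ψ) (cq : Continuous q) (cr : Continuous r)
    (bψ : ∀ k, c * ‖k - k₀‖ ^ 2 ≤ ψ k) (bq : ∀ k, |q k| ≤ A * ‖k - k₀‖ ^ 2)
    (br : ∀ k, |r k| ≤ A * ‖k - k₀‖ ^ 3)
    (cf : Continuous f) (cf₁ : Continuous f₁) (cf₂ : Continuous f₂)
    (hf : HasEuler k₀ f f₁) (hf₁ : HasEuler k₀ f₁ f₂)
    (bf : ∀ k, ‖f k‖ + ‖f₁ k‖ + ‖f₂ k‖ ≤ B * (1 + ‖k - k₀‖) ^ 2 * wt (d + 4) k) :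
    ‖∫ k, Complex.exp (-Complex.I * ((s * Φ k : ℝ) : ℂ)) * f k‖
      ≤ dispConst d c A B * s ^ (-(5 / 4) : ℝ) := by
  have hd0 : d ≠ 0 := by omega
  have hs0 : 0 < s := by linarith
  have hψ0 : ∀ k, 0 ≤ ψ k := fun k => le_trans (by positivity) (bψ k)
  have hpos : ∀ k, 0 < 1 + s * ψ k := fun k => by have := mul_nonneg hs0.le (hψ0 k); linarith
  set u : Mom d → ℝ := fun k => (1 + s * ψ k)⁻¹ with hu
  have hu0 : ∀ k, 0 < u k := fun k => inv_pos.2 (hpos k)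
  have hu1 : ∀ k, u k ≤ 1 := fun k =>
    inv_le_one_of_one_le₀ (by have := mul_nonneg hs0.le (hψ0 k); linarith)
  have cu : Continuous u :=
    (by fun_prop : Continuous fun k => 1 + s * ψ k).inv₀ fun k => (hpos k).ne'
  have huψ : ∀ k, s * u k * ψ k ≤ 1 := fun k => by
    have : u k * (1 + s * ψ k) = 1 := inv_mul_cancel₀ (hpos k).ne'
    nlinarith [hu0 k]
  have hux : ∀ k, s * u k * ‖k - k₀‖ ^ 2 ≤ 1 / c := fun k => by
    rw [le_div_iff₀ hc]
    have := mul_le_mul_of_nonneg_left (bψ k) (mul_nonneg hs0.le (hu0 k).le)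
    linarith [huψ k]
  set a : Mom d → ℝ := fun k => s * u k * (ψ k + q k) with ha
  have ca : Continuous a := by fun_prop
  have hsuq : ∀ k, |s * u k * q k| ≤ A / c := fun k => by
    rw [abs_mul, abs_of_nonneg (mul_nonneg hs0.le (hu0 k).le)]
    calc s * u k * |q k| ≤ s * u k * (A * ‖k - k₀‖ ^ 2) := by
          gcongr
          · exact mul_nonneg hs0.le (hu0 k).le
          · exact bq k
      _ = A * (s * u k * ‖k - k₀‖ ^ 2) := by ring
      _ ≤ A * (1 / c) := by gcongr; exact hux k
      _ = A / c := by ring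
  have hsur : ∀ k, |s * u k * r k| ≤ A / c * ‖k - k₀‖ := fun k => by
    rw [abs_mul, abs_of_nonneg (mul_nonneg hs0.le (hu0 k).le)]
    calc s * u k * |r k| ≤ s * u k * (A * ‖k - k₀‖ ^ 3) := by
          gcongr
          · exact mul_nonneg hs0.le (hu0 k).le
          · exact br k
      _ = A * (s * u k * ‖k - k₀‖ ^ 2) * ‖k - k₀‖ := by ring
      _ ≤ A * (1 / c) * ‖k - k₀‖ := by gcongr; exact hux k
      _ = A / c * ‖k - k₀‖ := by ring
  set A₁ := 1 + A / c with hA₁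
  have hAc : 0 ≤ A / c := by positivity
  have haA : ∀ k, |a k| ≤ A₁ := fun k => by
    have h1 : a k = s * u k * ψ k + s * u k * q k := by simp only [ha]; ring
    rw [h1]
    refine (abs_add_le _ _).trans (add_le_add ?_ (hsuq k))
    rw [abs_of_nonneg (mul_nonneg (mul_nonneg hs0.le (hu0 k).le) (hψ0 k))]
    exact huψ k
  -- The Euler derivative of `a`. The cubic term `r` makes it grow linearly in `‖k - k₀‖`; this is
  -- one of the three powers absorbed by `damped_le`, the other two being those allowed for `f`.
  set a' : Mom d → ℝ := fun k => -a k ^ 2 + s * u k * (ψ k + 3 * q k + r k) with ha'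
  have ca' : Continuous a' := by fun_prop
  have hEu : HasEuler k₀ u (fun k => -(u k * a k)) := by
    refine (((HasEuler.const (1 : ℝ)).add (hψ.const_mul s)).inv fun k => (hpos k).ne').congr_deriv
      fun k => ?_
    simp only [ha, hu]
    have := (hpos k).ne'
    field_simp
    ring
  have hEa : HasEuler k₀ a a' :=
    ((hEu.const_mul s).mul (hψ.add hq)).congr_deriv fun k => by simp only [ha', ha]; ring
  have haA' : ∀ k, |a' k| ≤ (A₁ ^ 2 + 1 + 3 * (A / c)) * (1 + ‖k - k₀‖) := fun k => by
    have h1 : a' k = -a k ^ 2 + s * u k * ψ k + 3 * (s * u k * q k) + s * u k * r k := by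
      simp only [ha']; ring
    have h2 : |a k| ^ 2 ≤ A₁ ^ 2 := pow_le_pow_left₀ (abs_nonneg _) (haA k) 2
    rw [sq_abs] at h2
    have h3 := abs_le.1 (hsuq k)
    have h4 := abs_le.1 (hsur k)
    have h5 : 0 ≤ s * u k * ψ k := mul_nonneg (mul_nonneg hs0.le (hu0 k).le) (hψ0 k)
    have h6 := huψ k
    have h7 := norm_nonneg (k - k₀)
    have h8 : 0 ≤ (A₁ ^ 2 + 1 + 3 * (A / c)) * ‖k - k₀‖ := by positivity
    have h9 : A / c * ‖k - k₀‖ ≤ (A₁ ^ 2 + 1 + 3 * (A / c)) * ‖k - k₀‖ := by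
      gcongr; nlinarith [sq_nonneg A₁]
    have h10 := sq_nonneg (a k)
    rw [h1, abs_le]
    constructor <;> linarith [h3.1, h3.2, h4.1, h4.2]
  -- the weight dominating all the functions involved
  set w : Mom d → ℝ := fun k => B * (1 + ‖k - k₀‖) ^ 2 * wt (d + 4) k with hw
  -- Here the three powers are absorbed by the weight, as `d + 4 = 3 + (d + 1)`, at the price of a
  -- constant depending on `k₀`. It serves only for integrability and does not enter the final
  -- bound.
  have hwi : Integrable (fun k => (1 + ‖k - k₀‖) * w k) := by
    refine (integrable_wt.const_mul (B * (8 * (1 + ‖k₀‖) ^ 3))).mono'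
      (by apply Continuous.aestronglyMeasurable; have := continuous_wt (d := d) (d + 4); fun_prop)
      (Eventually.of_forall fun k => ?_)
    have h0 := wt_pos (d + 4) k
    rw [Real.norm_of_nonneg (by positivity)]
    have h1 : 1 + ‖k - k₀‖ ≤ 2 * (1 + ‖k₀‖) * bracket k := by
      have := norm_sub_le k k₀
      nlinarith [one_le_bracket k, norm_le_bracket k, norm_nonneg k₀,
        mul_le_mul_of_nonneg_left (one_le_bracket k) (norm_nonneg k₀)]
    have h2 : (1 + ‖k - k₀‖) ^ 3 ≤ (2 * (1 + ‖k₀‖) * bracket k) ^ 3 := by gcongr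
    calc (1 + ‖k - k₀‖) * w k = B * ((1 + ‖k - k₀‖) ^ 3 * wt (d + 4) k) := by
          simp only [hw]; ring
      _ ≤ B * ((2 * (1 + ‖k₀‖) * bracket k) ^ 3 * wt (d + 4) k) := by gcongr
      _ = B * (8 * (1 + ‖k₀‖) ^ 3) * (bracket k ^ 3 * wt (3 + (d + 1)) k) := by
          rw [show d + 4 = 3 + (d + 1) by ring]; ring
      _ = _ := by rw [bracket_pow_mul_wt]
  have hw0 : ∀ k, 0 ≤ w k := fun k => by have := wt_pos (d + 4) k; positivity
  have hdom : ∀ (g : Mom d → ℂ), Continuous g → (∃ K : ℝ, ∀ k, ‖g k‖ ≤ K * ((1 + ‖k - k₀‖) * w k)) →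
      Integrable g := fun g hg ⟨K, hK⟩ =>
    (hwi.const_mul K).mono' hg.aestronglyMeasurable (Eventually.of_forall hK)
  have hw1 : ∀ k, w k ≤ (1 + ‖k - k₀‖) * w k := fun k =>
    le_mul_of_one_le_left (hw0 k) (by linarith [norm_nonneg (k - k₀)])
  have bf0 : ∀ k, ‖f k‖ ≤ w k := fun k => by
    have := bf k; linarith [norm_nonneg (f₁ k), norm_nonneg (f₂ k)]
  have bf1 : ∀ k, ‖f₁ k‖ ≤ w k := fun k => by
    have := bf k; linarith [norm_nonneg (f k), norm_nonneg (f₂ k)]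
  have bf2 : ∀ k, ‖f₂ k‖ ≤ w k := fun k => by
    have := bf k; linarith [norm_nonneg (f₁ k), norm_nonneg (f k)]
  have hfi : Integrable f := hdom f cf ⟨1, fun k => by linarith [bf0 k, hw1 k]⟩
  have hfi₁ : Integrable f₁ := hdom f₁ cf₁ ⟨1, fun k => by linarith [bf1 k, hw1 k]⟩
  have step1 := oscillatory_step hd0 hs0.le hΦ hψ hψ0 (fun k => rfl) (fun k => rfl) haA cΦ cψ cq
    cf cf₁ hf hfi hfi₁
  set D : ℝ := 1 + d + A₁ with hD
  have hcoef : ∀ k, ‖(1 - Complex.I * d + Complex.I * a k : ℂ)‖ ≤ D := fun k => by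
    refine (norm_add_le _ _).trans ?_
    refine (add_le_add (norm_sub_le _ _) le_rfl).trans ?_
    simpa [hD] using haA k
  set g₁ : Mom d → ℂ := fun k => (1 - Complex.I * d + Complex.I * a k) * f k - Complex.I * f₁ k
    with hg₁
  set g₁' : Mom d → ℂ := fun k => Complex.I * a' k * f k +
    (1 - Complex.I * d + Complex.I * a k) * f₁ k - Complex.I * f₂ k with hg₁'
  have hEg₁ : HasEuler k₀ g₁ g₁' := by
    have h1 := ((HasEuler.const (k₀ := k₀) (1 - Complex.I * d : ℂ)).add
      (hEa.ofReal.const_mul Complex.I)).mul hf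
    have h2 := h1.add (hf₁.const_mul (-Complex.I))
    refine HasEuler.congr_deriv (F := g₁) (F' := _) (by
      convert! h2 using 1; funext k; simp only [hg₁]; ring) fun k => ?_
    simp only [hg₁']; ring
  have cg₁ : Continuous g₁ := by fun_prop
  have cg₁' : Continuous g₁' := by fun_prop
  set g : Mom d → ℂ := fun k => (u k : ℂ) * g₁ k with hg
  set g' : Mom d → ℂ := fun k => (u k : ℂ) * (g₁' k - a k * g₁ k) with hg'
  have hEg : HasEuler k₀ g g' := (hEu.ofReal.mul hEg₁).congr_deriv fun k => by
    simp only [hg']; push_cast; ring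
  have cg : Continuous g := by fun_prop
  have cg' : Continuous g' := by fun_prop
  have hA₁0 : 0 ≤ A₁ := by positivity
  have hD0 : 0 ≤ D := by positivity
  have bg₁ : ∀ k, ‖g₁ k‖ ≤ D * w k := fun k => by
    calc ‖g₁ k‖ ≤ ‖(1 - Complex.I * d + Complex.I * a k : ℂ)‖ * ‖f k‖ + ‖f₁ k‖ := by
          refine (norm_sub_le _ _).trans ?_; simp
      _ ≤ D * ‖f k‖ + D * ‖f₁ k‖ := by
          gcongr
          · exact hcoef k
          · refine le_mul_of_one_le_left (norm_nonneg _) ?_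
            simp only [hD]; have : (0 : ℝ) ≤ d := by positivity
            linarith
      _ ≤ D * w k := by
          rw [← mul_add]; gcongr
          have := bf k; linarith [norm_nonneg (f₂ k)]
  set A₂ := A₁ ^ 2 + 1 + 3 * (A / c) with hA₂
  have hD1 : 1 ≤ D := by
    simp only [hD]; have : (0 : ℝ) ≤ d := by positivity
    linarith
  have hA₂0 : 0 ≤ A₂ := by positivity
  have bg₁' : ∀ k, ‖g₁' k‖ ≤ (A₂ + D) * ((1 + ‖k - k₀‖) * w k) := fun k => by
    have hx := norm_nonneg (k - k₀)
    calc ‖g₁' k‖ ≤ |a' k| * ‖f k‖ + ‖(1 - Complex.I * d + Complex.I * a k : ℂ)‖ * ‖f₁ k‖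
          + ‖f₂ k‖ := by
          refine (norm_sub_le _ _).trans (add_le_add ((norm_add_le _ _).trans ?_) ?_) <;> simp
      _ ≤ A₂ * (1 + ‖k - k₀‖) * ‖f k‖ + D * ‖f₁ k‖ + ‖f₂ k‖ := by
          gcongr
          · exact haA' k
          · exact hcoef k
      _ ≤ (A₂ + D) * (1 + ‖k - k₀‖) * ‖f k‖ + (A₂ + D) * (1 + ‖k - k₀‖) * ‖f₁ k‖ +
          (A₂ + D) * (1 + ‖k - k₀‖) * ‖f₂ k‖ := by
          gcongr
          · linarith
          · nlinarith
          · refine le_mul_of_one_le_left (norm_nonneg _) ?_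
            nlinarith
      _ = (A₂ + D) * ((1 + ‖k - k₀‖) * (‖f k‖ + ‖f₁ k‖ + ‖f₂ k‖)) := by ring
      _ ≤ _ := by gcongr; exact bf k
  have bg : ∀ k, ‖g k‖ ≤ D * ((1 + ‖k - k₀‖) * w k) := fun k => by
    simp only [hg, norm_mul, Complex.norm_real, Real.norm_of_nonneg (hu0 k).le]
    refine (mul_le_of_le_one_left (norm_nonneg _) (hu1 k)).trans ((bg₁ k).trans ?_)
    gcongr; exact hw1 k
  have bdiff : ∀ k, ‖g₁' k - a k * g₁ k‖ ≤ (A₂ + D + A₁ * D) * ((1 + ‖k - k₀‖) * w k) := fun k => by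
    refine (norm_sub_le _ _).trans ?_
    rw [norm_mul, Complex.norm_real, Real.norm_eq_abs]
    have h1 : |a k| * ‖g₁ k‖ ≤ A₁ * (D * ((1 + ‖k - k₀‖) * w k)) := by
      gcongr
      · exact haA k
      · refine (bg₁ k).trans ?_; gcongr; exact hw1 k
    linarith [bg₁' k]
  have bg' : ∀ k, ‖g' k‖ ≤ (A₂ + D + A₁ * D) * ((1 + ‖k - k₀‖) * w k) := fun k => by
    simp only [hg', norm_mul, Complex.norm_real, Real.norm_of_nonneg (hu0 k).le]
    exact (mul_le_of_le_one_left (norm_nonneg _) (hu1 k)).trans (bdiff k)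
  have step2 := oscillatory_step hd0 hs0.le hΦ hψ hψ0 (fun k => rfl) (fun k => rfl) haA cΦ cψ cq
    cg cg' hEg (hdom g cg ⟨_, bg⟩) (hdom g' cg' ⟨_, bg'⟩)
  rw [step1]
  change ‖∫ k, Complex.exp (-Complex.I * ((s * Φ k : ℝ) : ℂ)) * g k‖ ≤ _
  rw [step2]
  set κ : ℝ := 2 * D ^ 2 + A₂ + D with hκ
  set c₈ : ℝ := 8 * (c ^ (-(5 / 4) : ℝ) + c ^ (-(3 / 2) : ℝ)) with hc₈
  have hi1 : Integrable (fun k => wt (d + 1) k + sing (k - k₀)) :=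
    integrable_wt.add ((integrable_sing hd).comp_sub_right k₀)
  have hfinal : ‖∫ k, Complex.exp (-Complex.I * ((s * Φ k : ℝ) : ℂ)) * ((u k : ℂ) *
      ((1 - Complex.I * d + Complex.I * a k) * g k - Complex.I * g' k))‖
      ≤ ∫ k, κ * B * c₈ * s ^ (-(5 / 4) : ℝ) * (wt (d + 1) k + sing (k - k₀)) := by
    refine norm_integral_le_of_norm_le (hi1.const_mul _) ?_
    -- The critical point must be discarded: `0 ^ (-(5/2))` is `0` for real powers, so `sing`
    -- vanishes there and does not dominate.
    have hnull : ∀ᵐ k : Mom d, k ≠ k₀ := by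
      have : Nontrivial (Mom d) := by
        have : Nonempty (Fin d) := ⟨⟨0, by omega⟩⟩
        infer_instance
      simp [ae_iff]
    filter_upwards [hnull] with k hk
    have hE : ‖Complex.exp (-Complex.I * ((s * Φ k : ℝ) : ℂ))‖ = 1 := by
      rw [Complex.norm_exp]; simp
    rw [norm_mul, hE, one_mul]
    have h1 : (u k : ℂ) * ((1 - Complex.I * d + Complex.I * a k) * g k - Complex.I * g' k)
        = ((u k : ℂ)) ^ 2 * ((1 - Complex.I * d + Complex.I * a k) * g₁ k
          - Complex.I * (g₁' k - a k * g₁ k)) := by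
      simp only [hg, hg']; ring
    rw [h1, norm_mul, norm_pow, Complex.norm_real, Real.norm_of_nonneg (hu0 k).le]
    have h2 : ‖(1 - Complex.I * d + Complex.I * a k) * g₁ k - Complex.I * (g₁' k - a k * g₁ k)‖
        ≤ κ * ((1 + ‖k - k₀‖) * w k) := by
      refine (norm_sub_le _ _).trans ?_
      rw [norm_mul, norm_mul, Complex.norm_I, one_mul]
      have h3 : ‖(1 - Complex.I * d + Complex.I * a k : ℂ)‖ * ‖g₁ k‖
          ≤ D * (D * ((1 + ‖k - k₀‖) * w k)) := by
        gcongr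
        · exact hcoef k
        · refine (bg₁ k).trans ?_; gcongr; exact hw1 k
      have h4 : A₁ * D ≤ D ^ 2 := by
        rw [sq]; gcongr
        simp only [hD]; have : (0 : ℝ) ≤ d := by positivity
        linarith
      have h5 : 0 ≤ (1 + ‖k - k₀‖) * w k := (hw0 k).trans (hw1 k)
      calc _ ≤ D * (D * ((1 + ‖k - k₀‖) * w k)) + (A₂ + D + A₁ * D) * ((1 + ‖k - k₀‖) * w k) :=
            add_le_add h3 (bdiff k)
        _ ≤ _ := by rw [hκ]; nlinarith
    have hsg := sing_nonneg (k - k₀)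
    have hwt := wt_pos (d + 4) k
    have hdamp := damped_le hc hs (hψ0 k) (rfl : u k = _) (sub_ne_zero.2 hk) (bψ k)
    have hκ0 : 0 ≤ κ := by positivity
    have hc₈0 : 0 ≤ c₈ := by positivity
    calc u k ^ 2 * ‖(1 - Complex.I * d + Complex.I * a k) * g₁ k
          - Complex.I * (g₁' k - a k * g₁ k)‖
        ≤ u k ^ 2 * (κ * ((1 + ‖k - k₀‖) * w k)) := by gcongr
      _ = κ * B * (u k ^ 2 * (1 + ‖k - k₀‖) ^ 3) * wt (d + 4) k := by simp only [hw]; ring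
      _ ≤ κ * B * (c₈ * s ^ (-(5 / 4) : ℝ) * (1 + sing (k - k₀))) * wt (d + 4) k := by
          gcongr
      _ = κ * B * c₈ * s ^ (-(5 / 4) : ℝ) * (wt (d + 4) k + sing (k - k₀) * wt (d + 4) k) := by
          ring
      _ ≤ _ := by
          gcongr
          · exact wt_anti (by omega) k
          · exact mul_le_of_le_one_right hsg (wt_le_one _ k)
  refine hfinal.trans (le_of_eq ?_)
  have i2 : ∫ k : Mom d, wt (d + 1) k + sing (k - k₀) = ∫ k : Mom d, wt (d + 1) k + sing k := by
    rw [integral_add integrable_wt ((integrable_sing hd).comp_sub_right k₀),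
      integral_add integrable_wt (integrable_sing hd), integral_sub_right_eq_self]
  rw [integral_const_mul, i2, dispConst]
  ring

end Dispersive

end PhononBoltzmann

end

noncomputable section

namespace PhononBoltzmann

/-! ### Consequences of the standing assumptions -/

/-- The properties of the dispersion relations and of the vertex weight used in the estimates. -/
structure Regular (d : ℕ) (K ρ C₅ : ℝ) (e ω : Mom d → ℝ) (M : Mom d → ℤˣ → ℝ) : Prop where
  one_le : 1 ≤ K
  e_cont : Continuous e
  ω_cont : Continuous ω
  M_cont : ∀ σ, Continuous fun k => M k σ
  M_nonneg : ∀ k σ, 0 ≤ M k σ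
  M_le : ∀ k σ, M k σ ≤ K * wt (d + 5) k
  e_le : ∀ k, |e k| ≤ K * bracket k ^ 2
  ω_le : ∀ k, |ω k| ≤ K * bracket k ^ 2
  decay : ∀ (σ : ℤˣ) (p : Mom d) (s : ℝ), 0 ≤ s →
    ‖∫ k, Complex.exp (-Complex.I * ((s * Phi e ω σ p k : ℝ) : ℂ)) * (M k σ : ℂ)‖
      ≤ K * (1 + s) ^ (-(5 / 4) : ℝ)
  transversal : Transversal e ω ρ C₅

/-! ### Euler derivatives expressed by iterated Fréchet derivatives -/

section

variable {d : ℕ} {k₀ : Mom d}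

lemma hasEuler_fderiv {F : Mom d → ℝ} (hF : ContDiff ℝ 1 F) :
    HasEuler k₀ F (fun k => fderiv ℝ F k (k - k₀)) :=
  HasEuler.of_hasFDerivAt (fderiv ℝ F)
    (fun k => (hF.differentiable (by norm_num) k).hasFDerivAt) fun _ => rfl

lemma hasEuler_fderiv_two {F : Mom d → ℝ} (hF : ContDiff ℝ 2 F) :
    HasEuler k₀ (fun k => fderiv ℝ F k (k - k₀))
      (fun k => fderiv ℝ F k (k - k₀) + fderiv ℝ (fderiv ℝ F) k (k - k₀) (k - k₀)) := by
  have h1 : ContDiff ℝ 1 (fderiv ℝ F) := hF.fderiv_right (by norm_num)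
  refine HasEuler.of_hasFDerivAt _ (fun k =>
    ((h1.differentiable (by norm_num) k).hasFDerivAt).clm_apply
      ((hasFDerivAt_id k).sub_const k₀)) fun k => ?_
  simp
  ring

lemma hasEuler_fderiv_three {F : Mom d → ℝ} (hF : ContDiff ℝ 3 F) :
    HasEuler k₀ (fun k => fderiv ℝ (fderiv ℝ F) k (k - k₀) (k - k₀))
      (fun k => 2 * fderiv ℝ (fderiv ℝ F) k (k - k₀) (k - k₀) +
        fderiv ℝ (fderiv ℝ (fderiv ℝ F)) k (k - k₀) (k - k₀) (k - k₀)) := by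
  have h1 : ContDiff ℝ 2 (fderiv ℝ F) := hF.fderiv_right (by norm_num)
  have h2 : ContDiff ℝ 1 (fderiv ℝ (fderiv ℝ F)) := h1.fderiv_right (by norm_num)
  refine HasEuler.of_hasFDerivAt _ (fun k =>
    (((h2.differentiable (by norm_num) k).hasFDerivAt).clm_apply
      ((hasFDerivAt_id k).sub_const k₀)).clm_apply ((hasFDerivAt_id k).sub_const k₀)) fun k => ?_
  simp
  ring

lemma norm_fderiv_eq (F : Mom d → ℝ) (k : Mom d) :
    ‖fderiv ℝ F k‖ = ‖iteratedFDeriv ℝ 1 F k‖ := by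
  rw [← norm_iteratedFDeriv_fderiv, norm_iteratedFDeriv_zero]

lemma norm_fderiv_two_eq (F : Mom d → ℝ) (k : Mom d) :
    ‖fderiv ℝ (fderiv ℝ F) k‖ = ‖iteratedFDeriv ℝ 2 F k‖ := by
  rw [← norm_iteratedFDeriv_fderiv, ← norm_iteratedFDeriv_fderiv, norm_iteratedFDeriv_zero]

set_option maxSynthPendingDepth 6 in
set_option synthInstance.maxHeartbeats 200000 in
lemma norm_fderiv_three_eq (F : Mom d → ℝ) (k : Mom d) :
    ‖fderiv ℝ (fderiv ℝ (fderiv ℝ F)) k‖ = ‖iteratedFDeriv ℝ 3 F k‖ := by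
  rw [← norm_iteratedFDeriv_fderiv, ← norm_iteratedFDeriv_fderiv, ← norm_iteratedFDeriv_fderiv,
    norm_iteratedFDeriv_zero]

set_option maxSynthPendingDepth 6 in
set_option synthInstance.maxHeartbeats 200000 in
lemma abs_fderiv_three_le (F : Mom d → ℝ) (k x : Mom d) :
    |fderiv ℝ (fderiv ℝ (fderiv ℝ F)) k x x x| ≤ ‖iteratedFDeriv ℝ 3 F k‖ * ‖x‖ ^ 3 := by
  rw [← norm_fderiv_three_eq, ← Real.norm_eq_abs]
  calc _ ≤ ‖fderiv ℝ (fderiv ℝ (fderiv ℝ F)) k‖ * ‖x‖ * ‖x‖ * ‖x‖ := by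
        refine (ContinuousLinearMap.le_opNorm₂ _ _ _).trans ?_
        gcongr
        exact ContinuousLinearMap.le_opNorm _ _
    _ = _ := by ring

lemma sgn_eq (σ : ℤˣ) : sgn σ = 1 ∨ sgn σ = -1 := by
  rcases Int.units_eq_one_or σ with rfl | rfl <;> simp [sgn]

lemma abs_sgn (σ : ℤˣ) : |sgn σ| = 1 := by
  rcases sgn_eq σ with h | h <;> simp [h]

end

/-! ### Bounds on the phase and on the phonon number from the standing assumptions -/

section

variable {d : ℕ} {β ρ C₁ C₂ C₃ C₄ C₅ C₆ C₇ : ℝ} {e ω Q : Mom d → ℝ} {μ : ℝ}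

lemma wt_eq_zpow (m : ℕ) (k : Mom d) : bracket k ^ (-(m : ℤ)) = wt m k := by
  rw [wt, zpow_neg, zpow_natCast]

lemma Admissible.norm_Q (h : Admissible d β ρ C₁ C₂ C₃ C₄ C₅ C₆ C₇ e ω Q μ) {ℓ : ℕ}
    (hℓ : ℓ ≤ 2 * d) (k : Mom d) : ‖iteratedFDeriv ℝ ℓ Q k‖ ≤ |C₇| * wt (2 * d + 12) k := by
  have h1 := h.Q_bound ℓ hℓ k
  have h2 : bracket k ^ (-(2 * (d : ℤ) + 12)) = wt (2 * d + 12) k := by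
    rw [← wt_eq_zpow]; push_cast; rfl
  rw [h2] at h1
  have := wt_pos (2 * d + 12) k
  exact h1.trans (by gcongr; exact le_abs_self _)

lemma contDiff_of_le {F : Mom d → ℝ} {m n : ℕ} (hn : n ≤ m)
    (h : ContDiff ℝ ((m : ℕ) : ℕ∞) F) : ContDiff ℝ n F :=
  h.of_le (by
    have : (n : ℕ∞) ≤ (m : ℕ∞) := by exact_mod_cast hn
    exact_mod_cast this)

lemma contDiff_Phi {n : WithTop ℕ∞} (he : ContDiff ℝ n e) (hω : ContDiff ℝ n ω) (σ : ℤˣ)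
    (p : Mom d) : ContDiff ℝ n (fun k => Phi e ω σ p k) := by
  unfold Phi
  exact (he.comp (contDiff_id.add contDiff_const)).add (contDiff_const.mul hω)

lemma bracket_growth_le (k : Mom d) {ℓ : ℕ} (h : 2 ≤ ℓ) :
    1 + bracket k ^ ((2 : ℤ) - (ℓ : ℤ)) ≤ 2 := by
  have : bracket k ^ ((2 : ℤ) - (ℓ : ℤ)) ≤ 1 :=
    zpow_le_one_of_nonpos₀ (one_le_bracket k) (by omega)
  linarith

lemma Admissible.norm_Phi_three (hd : 3 ≤ d)
    (h : Admissible d β ρ C₁ C₂ C₃ C₄ C₅ C₆ C₇ e ω Q μ) (σ : ℤˣ) (p k : Mom d) :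
    ‖iteratedFDeriv ℝ 3 (fun k => Phi e ω σ p k) k‖ ≤ 2 * |C₁| + 2 * |C₂| := by
  have he : ContDiff ℝ (3 : ℕ) e := contDiff_of_le (by omega) h.e_contDiff
  have hω : ContDiff ℝ (3 : ℕ) ω := contDiff_of_le (by omega) h.ω_contDiff
  have h1 : (fun k => Phi e ω σ p k) = (fun k => e (k + p)) + sgn σ • ω := by
    funext k; simp [Phi]
  rw [h1, iteratedFDeriv_add_apply (f := fun k => e (k + p)) (g := sgn σ • ω)
    (he.comp (contDiff_id.add contDiff_const)).contDiffAt 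
    (show ContDiff ℝ (3 : ℕ) (sgn σ • ω) from hω.const_smul (sgn σ)).contDiffAt,
    iteratedFDeriv_comp_add_right, iteratedFDeriv_const_smul_apply hω.contDiffAt]
  refine (norm_add_le _ _).trans (add_le_add ?_ ?_)
  · refine (h.e_bound 3 (by omega) (k + p)).trans ?_
    have := bracket_growth_le (k + p) (by norm_num : 2 ≤ 3)
    have h0 : 0 ≤ 1 + bracket (k + p) ^ ((2 : ℤ) - ((3 : ℕ) : ℤ)) := by
      have := bracket_pos (k + p); positivity
    calc _ ≤ |C₁| * (1 + bracket (k + p) ^ ((2 : ℤ) - ((3 : ℕ) : ℤ))) := by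
          gcongr; exact le_abs_self _
      _ ≤ |C₁| * 2 := by gcongr
      _ = _ := by ring
  · rw [norm_smul, Real.norm_eq_abs, abs_sgn, one_mul]
    refine (h.ω_bound 3 (by omega) k).trans ?_
    have := bracket_growth_le k (by norm_num : 2 ≤ 3)
    have h0 : 0 ≤ 1 + bracket k ^ ((2 : ℤ) - ((3 : ℕ) : ℤ)) := by
      have := bracket_pos k; positivity
    calc _ ≤ |C₂| * (1 + bracket k ^ ((2 : ℤ) - ((3 : ℕ) : ℤ))) := by
          gcongr; exact le_abs_self _
      _ ≤ |C₂| * 2 := by gcongr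
      _ = _ := by ring

/-- Along the segment from the critical point to `k` the directional derivative starts at zero and
has slope at least `c‖k - k₀‖²`. This is the lower bound on `ψ` used in `oscillatory_decay`. -/
lemma le_fderiv_of_hessian_le {F : Mom d → ℝ} {c : ℝ} (hF : ContDiff ℝ 2 F)
    (hc : ∀ k v, c * ‖v‖ ^ 2 ≤ fderiv ℝ (fderiv ℝ F) k v v) {k₀ : Mom d}
    (h0 : fderiv ℝ F k₀ = 0) (k : Mom d) : c * ‖k - k₀‖ ^ 2 ≤ fderiv ℝ F k (k - k₀) := by
  set x := k - k₀ with hx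
  have h1 : ContDiff ℝ 1 (fderiv ℝ F) := hF.fderiv_right (by norm_num)
  have hder : ∀ l : ℝ, HasDerivAt (fun l : ℝ => fderiv ℝ F (k₀ + l • x) x - c * ‖x‖ ^ 2 * l)
      (fderiv ℝ (fderiv ℝ F) (k₀ + l • x) x x - c * ‖x‖ ^ 2) l := by
    intro l
    have h2 : HasDerivAt (fun l : ℝ => k₀ + l • x) x l := by
      simpa using ((hasDerivAt_id' l).smul_const x).const_add k₀
    have h3 := ((h1.differentiable (by norm_num) (k₀ + l • x)).hasFDerivAt).comp_hasDerivAt l h2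
    have h4 := h3.clm_apply (hasDerivAt_const l x)
    have h5 := h4.sub ((hasDerivAt_id' l).const_mul (c * ‖x‖ ^ 2))
    convert! h5 using 1
    simp
  have hmono : Monotone (fun l : ℝ => fderiv ℝ F (k₀ + l • x) x - c * ‖x‖ ^ 2 * l) :=
    monotone_of_deriv_nonneg (fun l => (hder l).differentiableAt) fun l => by
      rw [(hder l).deriv]; linarith [hc (k₀ + l • x) x]
  have := hmono (zero_le_one : (0 : ℝ) ≤ 1)
  simp only [zero_smul, add_zero, h0, one_smul, hx, add_sub_cancel] at this
  simp at this
  simpa [hx] using this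

/-- An upper bound for the phonon number. -/
def numBound (β C₆ : ℝ) : ℝ := Real.exp (-β * C₆) / (1 - Real.exp (-β * C₆))

/-- The gap, multiplied by `β`, keeps the Bose factor uniformly away from `1`, so that the phonon
number and its derivatives are bounded. -/
lemma Admissible.exp_le (hβ : 0 < β) (h : Admissible d β ρ C₁ C₂ C₃ C₄ C₅ C₆ C₇ e ω Q μ)
    (k : Mom d) : Real.exp (-β * ω k + μ) ≤ Real.exp (-β * C₆) := by
  rw [Real.exp_le_exp]
  have := mul_le_mul_of_nonneg_left (h.gap k) hβ.le
  have h2 : β * (ω k - μ / β) = β * ω k - μ := by field_simp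
  linarith

lemma exp_gap_lt_one (hβ : 0 < β) (hC₆ : 0 < C₆) : Real.exp (-β * C₆) < 1 := by
  rw [Real.exp_lt_one_iff]; nlinarith

lemma numBound_nonneg (hβ : 0 < β) (hC₆ : 0 < C₆) : 0 ≤ numBound β C₆ :=
  div_nonneg (Real.exp_pos _).le (by linarith [exp_gap_lt_one hβ hC₆])

lemma Admissible.phononNumber_mem (hβ : 0 < β) (hC₆ : 0 < C₆)
    (h : Admissible d β ρ C₁ C₂ C₃ C₄ C₅ C₆ C₇ e ω Q μ) (k : Mom d) :
    0 ≤ phononNumber ω β μ k ∧ phononNumber ω β μ k ≤ numBound β C₆ := by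
  have h1 := h.exp_le hβ k
  have h2 := exp_gap_lt_one hβ hC₆
  have h3 := Real.exp_pos (-β * ω k + μ)
  constructor
  · exact div_nonneg h3.le (by linarith)
  · exact div_le_div₀ (Real.exp_pos _).le h1 (by linarith) (by linarith)

lemma Admissible.continuous_phononNumber (hβ : 0 < β) (hC₆ : 0 < C₆)
    (h : Admissible d β ρ C₁ C₂ C₃ C₄ C₅ C₆ C₇ e ω Q μ) :
    Continuous (phononNumber ω β μ) := by
  have := h.ω_contDiff.continuous
  unfold phononNumber
  refine Continuous.div (by fun_prop) (by fun_prop) fun k => ?_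
  have h1 := h.exp_le hβ k
  have h2 := exp_gap_lt_one hβ hC₆
  linarith

lemma vertexWeight_mem (hβ : 0 < β) (hC₆ : 0 < C₆)
    (h : Admissible d β ρ C₁ C₂ C₃ C₄ C₅ C₆ C₇ e ω Q μ) (k : Mom d) (σ : ℤˣ) :
    0 ≤ vertexWeight ω Q β μ k σ ∧
      vertexWeight ω Q β μ k σ ≤ C₇ ^ 2 * (numBound β C₆ + 1) * wt (d + 5) k := by
  obtain ⟨h1, h2⟩ := h.phononNumber_mem hβ hC₆ k
  have h3 : 0 ≤ (sgn σ + 1) / 2 ∧ (sgn σ + 1) / 2 ≤ 1 := by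
    rcases sgn_eq σ with h | h <;> rw [h] <;> norm_num
  have h4 : |Q k| ≤ |C₇| * wt (2 * d + 12) k := by
    have := h.norm_Q (Nat.zero_le _) k
    rwa [norm_iteratedFDeriv_zero] at this
  have h5 := wt_pos (2 * d + 12) k
  refine ⟨mul_nonneg (by positivity) (by linarith [h3.1]), ?_⟩
  unfold vertexWeight
  calc |Q k| ^ 2 * (phononNumber ω β μ k + (sgn σ + 1) / 2)
      ≤ (|C₇| * wt (2 * d + 12) k) ^ 2 * (numBound β C₆ + 1) := by
        gcongr
        · linarith [h3.1]
        · exact h3.2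
    _ = C₇ ^ 2 * (numBound β C₆ + 1) * (wt (2 * d + 12) k * wt (2 * d + 12) k) := by
        rw [mul_pow, sq_abs]; ring
    _ ≤ C₇ ^ 2 * (numBound β C₆ + 1) * (wt (d + 5) k * 1) := by
        have := numBound_nonneg hβ hC₆
        have := wt_pos (d + 5) k
        gcongr
        · exact wt_anti (by omega) k
        · exact wt_le_one _ k
    _ = _ := by rw [mul_one]

end

end PhononBoltzmann

end

/-! ### Euler derivatives of the vertex weight and the decay of its oscillatory integrals -/

noncomputable section

namespace PhononBoltzmann

section

variable {d : ℕ} {β ρ C₁ C₂ C₃ C₄ C₅ C₆ C₇ : ℝ} {e ω Q : Mom d → ℝ} {μ : ℝ}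

/-- The constant bounding the Euler derivatives of the vertex weight. -/
def weightConst (β C₂ C₆ C₇ : ℝ) : ℝ :=
  let N₀ := numBound β C₆
  let n₁ := β * (N₀ * (N₀ + 1)) * (2 * |C₂|)
  let n₂ := β * ((2 * N₀ + 1) * n₁ * (2 * |C₂|) + N₀ * (N₀ + 1) * (4 * |C₂|))
  C₇ ^ 2 * (N₀ + 1) + C₇ ^ 2 * (2 * (N₀ + 1) + n₁) + C₇ ^ 2 * (6 * (N₀ + 1) + 4 * n₁ + n₂)

lemma weightConst_nonneg (hβ : 0 < β) (hC₆ : 0 < C₆) : 0 ≤ weightConst β C₂ C₆ C₇ := by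
  have := numBound_nonneg hβ hC₆
  unfold weightConst
  positivity

-- Each Euler derivative costs a factor `1 + ‖k - k₀‖`, and a derivative that falls on the phonon
-- number costs also `⟨k⟩`, since `∇ω` grows linearly. The decay of `Q²` pays for the powers of
-- `⟨k⟩`; the powers of `1 + ‖k - k₀‖` are left for `damped_le`.
set_option maxHeartbeats 1000000 in
lemma Admissible.exists_euler_vertexWeight (hd : 3 ≤ d) (hβ : 0 < β) (hC₆ : 0 < C₆)
    (h : Admissible d β ρ C₁ C₂ C₃ C₄ C₅ C₆ C₇ e ω Q μ) (σ : ℤˣ) (k₀ : Mom d) :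
    ∃ f₁ f₂ : Mom d → ℝ, Continuous f₁ ∧ Continuous f₂ ∧
      HasEuler k₀ (fun k => vertexWeight ω Q β μ k σ) f₁ ∧ HasEuler k₀ f₁ f₂ ∧
      ∀ k, |vertexWeight ω Q β μ k σ| + |f₁ k| + |f₂ k| ≤
        weightConst β C₂ C₆ C₇ * (1 + ‖k - k₀‖) ^ 2 * wt (d + 4) k := by
  have hω2 : ContDiff ℝ 2 ω := contDiff_of_le (n := 2) (by omega) h.ω_contDiff
  have hω1 : ContDiff ℝ 1 ω := contDiff_of_le (n := 1) (by omega) h.ω_contDiff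
  have hQ2 : ContDiff ℝ 2 Q := contDiff_of_le (n := 2) (by omega) h.Q_contDiff
  have hQ1 : ContDiff ℝ 1 Q := contDiff_of_le (n := 1) (by omega) h.Q_contDiff
  have cω' : Continuous (fderiv ℝ ω) := hω2.continuous_fderiv (by norm_num)
  have cω'' : Continuous (fderiv ℝ (fderiv ℝ ω)) :=
    (hω2.fderiv_right (m := 1) (by norm_num)).continuous_fderiv (by norm_num)
  have cQ' : Continuous (fderiv ℝ Q) := hQ2.continuous_fderiv (by norm_num)
  have cQ'' : Continuous (fderiv ℝ (fderiv ℝ Q)) :=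
    (hQ2.fderiv_right (m := 1) (by norm_num)).continuous_fderiv (by norm_num)
  have cQ := hQ1.continuous
  have cω := hω1.continuous
  set ω₁ : Mom d → ℝ := fun k => fderiv ℝ ω k (k - k₀) with hω₁
  set ω₂ : Mom d → ℝ := fun k => fderiv ℝ (fderiv ℝ ω) k (k - k₀) (k - k₀) with hω₂
  set Q₁ : Mom d → ℝ := fun k => fderiv ℝ Q k (k - k₀) with hQ₁
  set Q₂ : Mom d → ℝ := fun k => fderiv ℝ (fderiv ℝ Q) k (k - k₀) (k - k₀) with hQ₂
  have cω₁ : Continuous ω₁ := by fun_prop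
  have cω₂ : Continuous ω₂ := by fun_prop
  have cQ₁ : Continuous Q₁ := by fun_prop
  have cQ₂ : Continuous Q₂ := by fun_prop
  have eω : HasEuler k₀ ω ω₁ := hasEuler_fderiv hω1
  have eω₁ : HasEuler k₀ ω₁ (fun k => ω₁ k + ω₂ k) := hasEuler_fderiv_two hω2
  have eQ : HasEuler k₀ Q Q₁ := hasEuler_fderiv hQ1
  have eQ₁ : HasEuler k₀ Q₁ (fun k => Q₁ k + Q₂ k) := hasEuler_fderiv_two hQ2
  set N : Mom d → ℝ := phononNumber ω β μ with hN
  have cN : Continuous N := h.continuous_phononNumber hβ hC₆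
  -- With `g = e^{-βω+μ}` and `N = g/(1-g)` one has `dN/dg = 1/(1-g)²`, hence `dN = -β N(N+1) dω`.
  -- Derivatives of `N` are thus polynomials in `N` and in derivatives of `ω`.
  set N₁ : Mom d → ℝ := fun k => -β * (N k * (N k + 1) * ω₁ k) with hN₁
  have eN : HasEuler k₀ N N₁ := by
    have h1 := ((eω.const_mul (-β)).add (HasEuler.const μ)).exp
    have hlt : ∀ k, 1 - Real.exp (-β * ω k + μ) ≠ 0 := fun k => by
      have h1 := h.exp_le hβ k
      have h2 := exp_gap_lt_one hβ hC₆
      linarith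
    have h2 := h1.mul (((HasEuler.const (k₀ := k₀) (1 : ℝ)).add (h1.const_mul (-1))).inv
      fun k => by have := hlt k; intro h0; apply this; linarith)
    refine HasEuler.congr_deriv (F := N) (by
      convert! h2 using 1
      funext k
      simp only [hN, phononNumber]
      rw [div_eq_mul_inv]
      congr 2
      ring) fun k => ?_
    simp only [hN₁, hN, phononNumber]
    have := hlt k
    have h3 : 1 + -1 * Real.exp (-β * ω k + μ) = 1 - Real.exp (-β * ω k + μ) := by ring
    rw [h3]
    generalize Real.exp (-β * ω k + μ) = g at this ⊢
    field_simp
    ring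
  set N₂ : Mom d → ℝ := fun k => -β * ((2 * N k + 1) * N₁ k * ω₁ k +
    N k * (N k + 1) * (ω₁ k + ω₂ k)) with hN₂
  have eN₁ : HasEuler k₀ N₁ N₂ :=
    (((eN.mul (eN.add (HasEuler.const 1))).mul eω₁).const_mul (-β)).congr_deriv fun k => by
      simp only [hN₂]; ring
  set c : ℝ := (sgn σ + 1) / 2 with hc
  have hc01 : 0 ≤ c ∧ c ≤ 1 := by
    rcases sgn_eq σ with h | h <;> rw [hc, h] <;> norm_num
  set f₁ : Mom d → ℝ := fun k => 2 * Q k * Q₁ k * (N k + c) + Q k * Q k * N₁ k with hf₁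
  set f₂ : Mom d → ℝ := fun k => 2 * Q₁ k * Q₁ k * (N k + c) +
    2 * Q k * (Q₁ k + Q₂ k) * (N k + c) + 4 * Q k * Q₁ k * N₁ k + Q k * Q k * N₂ k with hf₂
  have hfeq : (fun k => vertexWeight ω Q β μ k σ) = fun k => Q k * Q k * (N k + c) := by
    funext k
    simp only [vertexWeight, sq_abs, hN, hc]; ring
  have eNc := eN.add (HasEuler.const (k₀ := k₀) c)
  refine ⟨f₁, f₂, by fun_prop, by fun_prop, ?_, ?_, ?_⟩
  · rw [hfeq]
    exact ((eQ.mul eQ).mul eNc).congr_deriv fun k => by simp only [hf₁]; ring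
  · have h1 := ((((eQ.const_mul 2).mul eQ₁).mul eNc)).add ((eQ.mul eQ).mul eN₁)
    exact h1.congr_deriv fun k => by simp only [hf₂]; ring
  · intro k
    have hV : vertexWeight ω Q β μ k σ = Q k * Q k * (N k + c) := congrFun hfeq k
    rw [hV]
    set X := 1 + ‖k - k₀‖ with hX
    set w := wt (2 * d + 12) k with hw
    set b := bracket k with hb
    have hb1 : 1 ≤ b := one_le_bracket k
    have hX1 : 1 ≤ X := by simp [hX]
    have hxX : ‖k - k₀‖ ≤ X := by simp [hX]
    have hw0 : 0 < w := wt_pos _ k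
    have hN0 := numBound_nonneg hβ hC₆
    obtain ⟨hNk0, hNk1⟩ := h.phononNumber_mem hβ hC₆ k
    set N₀ := numBound β C₆ with hN₀
    have bQ : |Q k| ≤ |C₇| * w := by
      have := h.norm_Q (Nat.zero_le _) k
      rwa [norm_iteratedFDeriv_zero] at this
    have bQ₁ : |Q₁ k| ≤ |C₇| * w * X := by
      rw [← Real.norm_eq_abs]
      refine (ContinuousLinearMap.le_opNorm _ _).trans ?_
      rw [norm_fderiv_eq]
      gcongr
      exact h.norm_Q (by omega) k
    have bQ₂ : |Q₂ k| ≤ |C₇| * w * X ^ 2 := by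
      rw [← Real.norm_eq_abs]
      refine (ContinuousLinearMap.le_opNorm₂ _ _ _).trans ?_
      rw [norm_fderiv_two_eq, mul_assoc, ← sq]
      gcongr
      exact h.norm_Q (by omega) k
    have bω₁ : |ω₁ k| ≤ 2 * |C₂| * b * X := by
      rw [← Real.norm_eq_abs]
      refine (ContinuousLinearMap.le_opNorm _ _).trans ?_
      rw [norm_fderiv_eq]
      gcongr
      refine (h.ω_bound 1 (by omega) k).trans ?_
      have h1 : ((2 : ℤ) - ((1 : ℕ) : ℤ)) = 1 := by norm_num
      rw [h1, zpow_one]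
      calc C₂ * (1 + b) ≤ |C₂| * (b + b) := by
            gcongr
            exact le_abs_self _
        _ = _ := by ring
    have bω₂ : |ω₂ k| ≤ 2 * |C₂| * X ^ 2 := by
      rw [← Real.norm_eq_abs]
      refine (ContinuousLinearMap.le_opNorm₂ _ _ _).trans ?_
      rw [norm_fderiv_two_eq, mul_assoc, ← sq]
      gcongr
      refine (h.ω_bound 2 (by omega) k).trans ?_
      have h1 := bracket_growth_le k (le_refl 2)
      have h0 : 0 ≤ 1 + bracket k ^ ((2 : ℤ) - ((2 : ℕ) : ℤ)) := by
        have := bracket_pos k; positivity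
      calc _ ≤ |C₂| * (1 + bracket k ^ ((2 : ℤ) - ((2 : ℕ) : ℤ))) := by
            gcongr; exact le_abs_self _
        _ ≤ |C₂| * 2 := by gcongr
        _ = _ := by ring
    set n₁ := β * (N₀ * (N₀ + 1)) * (2 * |C₂|) with hn₁
    set n₂ := β * ((2 * N₀ + 1) * n₁ * (2 * |C₂|) + N₀ * (N₀ + 1) * (4 * |C₂|)) with hn₂
    have hn₁0 : 0 ≤ n₁ := by positivity
    have hn₂0 : 0 ≤ n₂ := by positivity
    have bNN : |N k * (N k + 1)| ≤ N₀ * (N₀ + 1) := by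
      rw [abs_of_nonneg (mul_nonneg hNk0 (by linarith))]
      gcongr
    have bN₁ : |N₁ k| ≤ n₁ * (b * X) := by
      simp only [hN₁]
      rw [abs_mul, abs_mul, abs_neg, abs_of_pos hβ]
      calc β * (|N k * (N k + 1)| * |ω₁ k|) ≤ β * ((N₀ * (N₀ + 1)) * (2 * |C₂| * b * X)) := by
            gcongr
        _ = _ := by rw [hn₁]; ring
    have hbX : 1 ≤ b * X := by nlinarith
    have bN₂ : |N₂ k| ≤ n₂ * (b * X) ^ 2 := by
      simp only [hN₂]
      rw [abs_mul, abs_neg, abs_of_pos hβ]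
      have h1 : |2 * N k + 1| ≤ 2 * N₀ + 1 := by
        rw [abs_of_nonneg (by linarith)]; linarith
      have hX2 : X ^ 2 ≤ (b * X) ^ 2 := by
        gcongr; nlinarith
      have hbX2 : b * X ≤ (b * X) ^ 2 := by nlinarith
      calc β * |(2 * N k + 1) * N₁ k * ω₁ k + N k * (N k + 1) * (ω₁ k + ω₂ k)|
          ≤ β * (|2 * N k + 1| * |N₁ k| * |ω₁ k| + |N k * (N k + 1)| * (|ω₁ k| + |ω₂ k|)) := by
            gcongr
            refine (abs_add_le _ _).trans ?_
            rw [abs_mul, abs_mul, abs_mul (N k * (N k + 1))]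
            gcongr
            exact abs_add_le _ _
        _ ≤ β * ((2 * N₀ + 1) * (n₁ * (b * X)) * (2 * |C₂| * b * X) + (N₀ * (N₀ + 1)) *
            (2 * |C₂| * (b * X) ^ 2 + 2 * |C₂| * (b * X) ^ 2)) := by
            gcongr
            · refine bω₁.trans ?_
              rw [mul_assoc]
              gcongr
            · refine bω₂.trans ?_
              gcongr
        _ = _ := by rw [hn₂]; ring
    have hcN : |N k + c| ≤ N₀ + 1 := by
      rw [abs_of_nonneg (by linarith [hc01.1])]; linarith [hc01.2]
    set Y := C₇ ^ 2 * (w * w) with hY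
    have hC : |C₇| * |C₇| = C₇ ^ 2 := by rw [← abs_mul, ← sq, abs_of_nonneg (sq_nonneg _)]
    have hXb : X ≤ b * X := by nlinarith
    have hXb2 : X ^ 2 ≤ (b * X) ^ 2 := by gcongr
    have h1le : 1 ≤ (b * X) ^ 2 := one_le_pow₀ hbX
    have hbX2 : b * X ≤ (b * X) ^ 2 := by nlinarith
    have hXbX2 : X ≤ (b * X) ^ 2 := hXb.trans hbX2
    have bf₀ : |Q k * Q k * (N k + c)| ≤ C₇ ^ 2 * (N₀ + 1) * ((w * w) * (b * X) ^ 2) := by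
      rw [abs_mul, abs_mul]
      calc |Q k| * |Q k| * |N k + c| ≤ (|C₇| * w) * (|C₇| * w) * (N₀ + 1) := by gcongr
        _ = C₇ ^ 2 * (N₀ + 1) * ((w * w) * 1) := by rw [← hC]; ring
        _ ≤ _ := by gcongr
    have bf₁ : |f₁ k| ≤ C₇ ^ 2 * (2 * (N₀ + 1) + n₁) * ((w * w) * (b * X) ^ 2) := by
      simp only [hf₁]
      calc |2 * Q k * Q₁ k * (N k + c) + Q k * Q k * N₁ k|
          ≤ 2 * |Q k| * |Q₁ k| * |N k + c| + |Q k| * |Q k| * |N₁ k| := by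
            refine (abs_add_le _ _).trans ?_
            simp only [abs_mul, abs_two, le_refl]
        _ ≤ 2 * (|C₇| * w) * (|C₇| * w * (b * X) ^ 2) * (N₀ + 1) +
            (|C₇| * w) * (|C₇| * w) * (n₁ * (b * X) ^ 2) := by
            gcongr
            · exact bQ₁.trans (by gcongr)
            · exact bN₁.trans (by gcongr)
        _ = _ := by rw [← hC]; ring
    have bf₂ : |f₂ k| ≤ C₇ ^ 2 * (6 * (N₀ + 1) + 4 * n₁ + n₂) * ((w * w) * (b * X) ^ 2) := by
      simp only [hf₂]
      calc |2 * Q₁ k * Q₁ k * (N k + c) + 2 * Q k * (Q₁ k + Q₂ k) * (N k + c) +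
            4 * Q k * Q₁ k * N₁ k + Q k * Q k * N₂ k|
          ≤ 2 * |Q₁ k| * |Q₁ k| * |N k + c| + 2 * |Q k| * (|Q₁ k| + |Q₂ k|) * |N k + c| +
            4 * |Q k| * |Q₁ k| * |N₁ k| + |Q k| * |Q k| * |N₂ k| := by
            refine (abs_add_le _ _).trans (add_le_add ((abs_add_le _ _).trans
              (add_le_add ((abs_add_le _ _).trans (add_le_add ?_ ?_)) ?_)) ?_)
            · simp only [abs_mul, abs_two, le_refl]
            · simp only [abs_mul, abs_two]
              gcongr
              exact abs_add_le _ _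
            · simp only [abs_mul]
              norm_num
            · simp only [abs_mul, le_refl]
        _ ≤ 2 * (|C₇| * w * (b * X)) * (|C₇| * w * (b * X)) * (N₀ + 1) +
            2 * (|C₇| * w) * (|C₇| * w * (b * X) ^ 2 + |C₇| * w * (b * X) ^ 2) * (N₀ + 1) +
            4 * (|C₇| * w) * (|C₇| * w * (b * X)) * (n₁ * (b * X)) +
            (|C₇| * w) * (|C₇| * w) * (n₂ * (b * X) ^ 2) := by
            gcongr
            · exact bQ₁.trans (by gcongr)
            · exact bQ₁.trans (by gcongr)
            · exact bQ₁.trans (by gcongr)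
            · exact bQ₂.trans (by gcongr)
            · exact bQ₁.trans (by gcongr)
        _ = _ := by rw [← hC]; ring
    have hww : (w * w) * (b * X) ^ 2 ≤ X ^ 2 * wt (d + 4) k := by
      have h1 : w * w * b ^ 2 ≤ wt (d + 4) k := by
        rw [hw, ← wt_add, mul_comm, show 2 * d + 12 + (2 * d + 12) = 2 + (4 * d + 22) by ring,
          bracket_pow_mul_wt]
        exact wt_anti (by omega) k
      calc (w * w) * (b * X) ^ 2 = X ^ 2 * (w * w * b ^ 2) := by ring
        _ ≤ _ := by gcongr
    calc _ ≤ weightConst β C₂ C₆ C₇ * ((w * w) * (b * X) ^ 2) := by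
          refine (add_le_add (add_le_add bf₀ bf₁) bf₂).trans (le_of_eq ?_)
          simp only [weightConst]; ring
      _ ≤ weightConst β C₂ C₆ C₇ * (X ^ 2 * wt (d + 4) k) := by
          gcongr
          exact weightConst_nonneg hβ hC₆
      _ = _ := by ring

lemma Admissible.continuous_vertexWeight (hβ : 0 < β) (hC₆ : 0 < C₆)
    (h : Admissible d β ρ C₁ C₂ C₃ C₄ C₅ C₆ C₇ e ω Q μ) (σ : ℤˣ) :
    Continuous (fun k => vertexWeight ω Q β μ k σ) := by
  have := h.continuous_phononNumber hβ hC₆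
  have := h.Q_contDiff.continuous
  unfold vertexWeight
  fun_prop

/-- The phase is coercive, so it has a minimum `k₀`, at which the dilations are centred. The Hessian
bounds control `ψ` and `q`; the third derivative is bounded because `⟨k⟩^{2-3} ≤ 1`. No constant
depends on `p` or `k₀`. -/
lemma Admissible.decay_of_one_le (hd : 3 ≤ d) (hβ : 0 < β) (hC₃ : 0 < C₃) (hC₆ : 0 < C₆)
    (h : Admissible d β ρ C₁ C₂ C₃ C₄ C₅ C₆ C₇ e ω Q μ) (σ : ℤˣ) (p : Mom d) {s : ℝ}
    (hs : 1 ≤ s) :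
    ‖∫ k, Complex.exp (-Complex.I * ((s * Phi e ω σ p k : ℝ) : ℂ)) *
      (vertexWeight ω Q β μ k σ : ℂ)‖
      ≤ dispConst d C₃ (|C₃| + |C₄| + 2 * |C₁| + 2 * |C₂|) (weightConst β C₂ C₆ C₇) *
        s ^ (-(5 / 4) : ℝ) := by
  set F : Mom d → ℝ := fun k => Phi e ω σ p k with hF
  have hFn : ∀ n : ℕ, n ≤ 3 → ContDiff ℝ n F := fun n hn =>
    contDiff_Phi (contDiff_of_le (by omega) h.e_contDiff) (contDiff_of_le (by omega) h.ω_contDiff)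
      σ p
  have h1 : ContDiff ℝ 1 F := hFn 1 (by norm_num)
  have h2 : ContDiff ℝ 2 F := hFn 2 (by norm_num)
  have h3 : ContDiff ℝ 3 F := hFn 3 le_rfl
  obtain ⟨k₀, hk₀⟩ := h1.continuous.exists_forall_le (h.Phi_tendsto σ p)
  have hcrit : fderiv ℝ F k₀ = 0 :=
    IsLocalMin.fderiv_eq_zero (Eventually.of_forall hk₀)
  have c1 : Continuous (fderiv ℝ F) := h2.continuous_fderiv (by norm_num)
  have h3' : ContDiff ℝ 2 (fderiv ℝ F) := h3.fderiv_right (by norm_num)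
  have c2 : Continuous (fderiv ℝ (fderiv ℝ F)) := h3'.continuous_fderiv (by norm_num)
  have c3 : Continuous (fderiv ℝ (fderiv ℝ (fderiv ℝ F))) :=
    (h3'.fderiv_right (m := 1) (by norm_num)).continuous_fderiv (by norm_num)
  have hess : ∀ k v, fderiv ℝ (fderiv ℝ F) k v v = iteratedFDeriv ℝ 2 F k ![v, v] := fun k v => by
    rw [iteratedFDeriv_two_apply]; simp
  obtain ⟨f₁, f₂, cf₁, cf₂, ef, ef₁, bf⟩ := h.exists_euler_vertexWeight hd hβ hC₆ σ k₀
  have hA : ∀ y : ℝ, 0 ≤ y → ∀ x : ℝ, C₃ * y ≤ x → x ≤ C₄ * y →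
      |x| ≤ (|C₃| + |C₄| + 2 * |C₁| + 2 * |C₂|) * y := by
    intro y hy x hx1 hx2
    have h1 := neg_abs_le C₃
    have h2 := le_abs_self C₄
    have e3 := abs_nonneg C₃
    have e4 := abs_nonneg C₄
    have e1 := abs_nonneg C₁
    have e2 := abs_nonneg C₂
    rw [abs_le]
    constructor <;> nlinarith
  refine oscillatory_decay (k₀ := k₀) (ψ := fun k => fderiv ℝ F k (k - k₀))
    (q := fun k => fderiv ℝ (fderiv ℝ F) k (k - k₀) (k - k₀))
    (r := fun k => fderiv ℝ (fderiv ℝ (fderiv ℝ F)) k (k - k₀) (k - k₀) (k - k₀))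
    (f₁ := fun k => (f₁ k : ℂ)) (f₂ := fun k => (f₂ k : ℂ)) hd hs hC₃ (by positivity)
    (weightConst_nonneg hβ hC₆) (hasEuler_fderiv h1) (hasEuler_fderiv_two h2)
    (hasEuler_fderiv_three h3) h1.continuous (by fun_prop) (by fun_prop) (by fun_prop)
    (le_fderiv_of_hessian_le h2 (fun k v => by rw [hess]; exact h.hess_lower σ p k v) hcrit)
    (fun k => ?_) (fun k => ?_) ?_ (by fun_prop) (by fun_prop) ef.ofReal ef₁.ofReal (fun k => ?_)
  · refine hA _ (by positivity) _ ?_ ?_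
    · rw [hess]; exact h.hess_lower σ p k _
    · rw [hess]; exact h.hess_upper σ p k _
  · have hn := h.norm_Phi_three hd σ p k
    calc _ ≤ (2 * |C₁| + 2 * |C₂|) * ‖k - k₀‖ ^ 3 :=
          (abs_fderiv_three_le F k _).trans (by gcongr)
      _ ≤ _ := by
        gcongr
        linarith [abs_nonneg C₃, abs_nonneg C₄]
  · exact Complex.continuous_ofReal.comp (h.continuous_vertexWeight hβ hC₆ σ)
  · simpa only [Complex.norm_real, Real.norm_eq_abs] using bf k

/-- The constant in `Regular` for admissible data. -/
lemma exists_regular (hd : 3 ≤ d) (hβ : 0 < β) (hC₃ : 0 < C₃) (hC₆ : 0 < C₆) :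
    ∃ K : ℝ, ∀ (e ω Q : Mom d → ℝ) (μ : ℝ),
      Admissible d β ρ C₁ C₂ C₃ C₄ C₅ C₆ C₇ e ω Q μ →
        Regular d K ρ C₅ e ω (vertexWeight ω Q β μ) := by
  set D := dispConst d C₃ (|C₃| + |C₄| + 2 * |C₁| + 2 * |C₂|) (weightConst β C₂ C₆ C₇) with hD
  set m := C₇ ^ 2 * (numBound β C₆ + 1) with hm
  have hm0 : 0 ≤ m := by have := numBound_nonneg hβ hC₆; positivity
  set W := ∫ k : Mom d, wt (d + 5) k with hW
  have hW0 : 0 ≤ W := integral_nonneg fun k => (wt_pos _ k).le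
  have hD0 : 0 ≤ |D| := abs_nonneg D
  set K := 1 + m + 2 * |C₁| + 2 * |C₂| + 4 * (|D| + m * W) with hK
  have hmW : 0 ≤ m * W := by positivity
  have e1 := abs_nonneg C₁
  have e2 := abs_nonneg C₂
  refine ⟨K, fun e ω Q μ h => ?_⟩
  have hmem := vertexWeight_mem hβ hC₆ h
  have growth : ∀ {F : Mom d → ℝ} {c : ℝ} (k : Mom d),
      ‖iteratedFDeriv ℝ 0 F k‖ ≤ c * (1 + bracket k ^ ((2 : ℤ) - ((0 : ℕ) : ℤ))) →
      |F k| ≤ 2 * |c| * bracket k ^ 2 := by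
    intro F c k hk
    rw [norm_iteratedFDeriv_zero, Real.norm_eq_abs] at hk
    have h1 : bracket k ^ ((2 : ℤ) - ((0 : ℕ) : ℤ)) = bracket k ^ 2 := by norm_num
    rw [h1] at hk
    have h2 : 1 ≤ bracket k ^ 2 := one_le_pow₀ (one_le_bracket k)
    calc |F k| ≤ |c| * (1 + bracket k ^ 2) := hk.trans (by gcongr; exact le_abs_self _)
      _ ≤ |c| * (bracket k ^ 2 + bracket k ^ 2) := by gcongr
      _ = _ := by ring
  refine ⟨by linarith, h.e_contDiff.continuous, h.ω_contDiff.continuous,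
    h.continuous_vertexWeight hβ hC₆, fun k σ => (hmem k σ).1, fun k σ => ?_, fun k => ?_,
    fun k => ?_, fun σ p s hs => ?_, h.transversal⟩
  · refine (hmem k σ).2.trans ?_
    have := wt_pos (d + 5) k
    gcongr
    linarith
  · refine (growth k (h.e_bound 0 (Nat.zero_le _) k)).trans ?_
    gcongr; linarith
  · refine (growth k (h.ω_bound 0 (Nat.zero_le _) k)).trans ?_
    gcongr; linarith
  -- For `s ≥ 1` the power `s^{-5/4}` is compared with `(2s)^{-5/4} ≤ (1+s)^{-5/4}`; for `s ≤ 1` the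
  -- trivial bound by the mass of the weight is enough. In both cases the loss `2^{5/4}` is at most
  -- `4`.
  · have h54 : (4 : ℝ)⁻¹ ≤ 2 ^ (-(5 / 4) : ℝ) := by
      calc (4 : ℝ)⁻¹ = 2 ^ (-2 : ℝ) := by rw [Real.rpow_neg (by norm_num)]; norm_num
        _ ≤ _ := Real.rpow_le_rpow_of_exponent_le (by norm_num) (by norm_num)
    rcases le_total 1 s with h1 | h1
    · refine (h.decay_of_one_le hd hβ hC₃ hC₆ σ p h1).trans ?_
      have h2 : s ^ (-(5 / 4) : ℝ) ≤ 4 * (1 + s) ^ (-(5 / 4) : ℝ) := by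
        have h3 : (2 * s) ^ (-(5 / 4) : ℝ) ≤ (1 + s) ^ (-(5 / 4) : ℝ) :=
          Real.rpow_le_rpow_of_nonpos (by linarith) (by linarith) (by norm_num)
        rw [Real.mul_rpow (by norm_num) hs] at h3
        have h4 : 0 < s ^ (-(5 / 4) : ℝ) := by positivity
        nlinarith
      have h5 : 0 < (1 + s) ^ (-(5 / 4) : ℝ) := by positivity
      calc D * s ^ (-(5 / 4) : ℝ) ≤ |D| * (4 * (1 + s) ^ (-(5 / 4) : ℝ)) := by
            gcongr; exact le_abs_self _
        _ ≤ K * (1 + s) ^ (-(5 / 4) : ℝ) := by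
            rw [← mul_assoc]; gcongr; linarith
    · have h2 : ‖∫ k, Complex.exp (-Complex.I * ((s * Phi e ω σ p k : ℝ) : ℂ)) *
          (vertexWeight ω Q β μ k σ : ℂ)‖ ≤ ∫ k : Mom d, m * wt (d + 5) k := by
        refine norm_integral_le_of_norm_le ((integrable_wt' (by omega)).const_mul _)
          (Eventually.of_forall fun k => ?_)
        rw [norm_mul, Complex.norm_exp, Complex.norm_real, Real.norm_of_nonneg (hmem k σ).1]
        simpa using (hmem k σ).2
      rw [integral_const_mul] at h2
      have h3 : (4 : ℝ)⁻¹ ≤ (1 + s) ^ (-(5 / 4) : ℝ) :=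
        h54.trans (Real.rpow_le_rpow_of_nonpos (by linarith) (by linarith) (by norm_num))
      refine h2.trans ?_
      calc m * W = 4 * (m * W) * (4 : ℝ)⁻¹ := by ring
        _ ≤ K * (1 + s) ^ (-(5 / 4) : ℝ) := by gcongr; linarith

end

end PhononBoltzmann

end

noncomputable section

namespace PhononBoltzmann

/-! ### The regularized propagator -/

/-- `|x + i/t|⁻¹`. -/
def res (t x : ℝ) : ℝ := (Real.sqrt (x ^ 2 + t⁻¹ ^ 2))⁻¹

lemma res_pos {t : ℝ} (ht : 0 < t) (x : ℝ) : 0 < res t x := by unfold res; positivity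

lemma res_sq (t x : ℝ) : res t x ^ 2 = (x ^ 2 + t⁻¹ ^ 2)⁻¹ := by
  rw [res, inv_pow, Real.sq_sqrt (by positivity)]

lemma res_le {t : ℝ} (ht : 0 < t) (x : ℝ) : res t x ≤ t := by
  have h : t⁻¹ ≤ Real.sqrt (x ^ 2 + t⁻¹ ^ 2) := Real.le_sqrt_of_sq_le (by nlinarith [sq_nonneg x])
  calc res t x ≤ (t⁻¹)⁻¹ := inv_anti₀ (by positivity) h
    _ = t := inv_inv t

lemma res_le_inv {t x : ℝ} (hx : 0 < |x|) : res t x ≤ |x|⁻¹ :=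
  inv_anti₀ hx (Real.le_sqrt_of_sq_le (by rw [sq_abs]; nlinarith [sq_nonneg t⁻¹]))

lemma continuous_res {t : ℝ} (ht : 0 < t) : Continuous (res t) := by
  unfold res
  exact (by fun_prop : Continuous fun x : ℝ => Real.sqrt (x ^ 2 + t⁻¹ ^ 2)).inv₀ fun x => by
    positivity

/-- `1 + log t`. -/
def lg (t : ℝ) : ℝ := 1 + Real.log t

lemma one_le_lg {t : ℝ} (ht : 1 ≤ t) : 1 ≤ lg t := by
  unfold lg; linarith [Real.log_nonneg ht]

/-- The number of dyadic scales between `1/t` and `ρ`. -/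
def scales (ρ t : ℝ) : ℕ := ⌈Real.logb 2 (ρ * t)⌉₊

lemma scales_spec {ρ t : ℝ} (hρ : 0 < ρ) (ht : 0 < t) : t ≤ 2 ^ scales ρ t / ρ := by
  have h1 : Real.logb 2 (ρ * t) ≤ scales ρ t := Nat.le_ceil _
  rw [Real.logb_le_iff_le_rpow (by norm_num) (by positivity), Real.rpow_natCast] at h1
  rw [le_div_iff₀ hρ]; linarith

lemma scales_le {ρ t : ℝ} (hρ : 0 < ρ) (ht : 1 ≤ t) :
    (scales ρ t : ℝ) ≤ (3 + |Real.logb 2 ρ|) * lg t := by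
  have hlt := Real.log_nonneg ht
  have ha := abs_nonneg (Real.logb 2 ρ)
  have h0 : Real.logb 2 (ρ * t) ≤ |Real.logb 2 ρ| + 2 * Real.log t := by
    rw [Real.logb_mul hρ.ne' (by linarith)]
    have h2 : Real.logb 2 t ≤ 2 * Real.log t := by
      rw [Real.logb, div_le_iff₀ (Real.log_pos (by norm_num))]
      nlinarith [Real.log_two_gt_d9]
    linarith [le_abs_self (Real.logb 2 ρ)]
  have h1 : (scales ρ t : ℝ) ≤ |Real.logb 2 ρ| + 2 * Real.log t + 1 := by
    by_cases h : 0 ≤ Real.logb 2 (ρ * t)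
    · linarith [(Nat.ceil_lt_add_one h).le, show (scales ρ t : ℝ) = ⌈Real.logb 2 (ρ * t)⌉₊ from rfl]
    · have : scales ρ t = 0 := Nat.ceil_eq_zero.2 (by linarith)
      rw [this]; push_cast; linarith
  unfold lg
  nlinarith

/-- Dyadic decomposition of the propagator. -/
lemma res_dyadic {ρ t : ℝ} (hρ : 0 < ρ) (ht : 0 < t) (x : ℝ) :
    res t x ≤ 1 / ρ ∨ ∃ i < scales ρ t, |x| ≤ ρ / 2 ^ i ∧ res t x ≤ 2 * 2 ^ i / ρ := by
  have key : ∀ n : ℕ, res t x ≤ 1 / ρ ∨ (∃ i < n, |x| ≤ ρ / 2 ^ i ∧ res t x ≤ 2 * 2 ^ i / ρ) ∨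
      |x| ≤ ρ / 2 ^ n := by
    intro n
    induction n with
    | zero =>
      by_cases h : |x| ≤ ρ
      · right; right; simpa using h
      · left
        push Not at h
        exact (res_le_inv (hρ.trans h)).trans (by rw [one_div]; exact inv_anti₀ hρ h.le)
    | succ n ih =>
      rcases ih with h | ⟨i, hi, h⟩ | h
      · exact Or.inl h
      · exact Or.inr (Or.inl ⟨i, by omega, h⟩)
      · by_cases h' : |x| ≤ ρ / 2 ^ (n + 1)
        · exact Or.inr (Or.inr h')
        · push Not at h'
          have hpos : 0 < ρ / 2 ^ (n + 1) := by positivity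
          refine Or.inr (Or.inl ⟨n, by omega, h, (res_le_inv (hpos.trans h')).trans ?_⟩)
          calc |x|⁻¹ ≤ (ρ / 2 ^ (n + 1))⁻¹ := inv_anti₀ hpos h'.le
            _ = 2 * 2 ^ n / ρ := by rw [inv_div, pow_succ]; ring
  rcases key (scales ρ t) with h | h | h
  · exact Or.inl h
  · exact Or.inr h
  -- Below the smallest scale the regularization takes over: `res t x ≤ t ≤ 2 ^ scales ρ t / ρ`, and
  -- the point is counted at the scale `scales ρ t - 1`. If there are no scales at all, then `t ≤
  -- 1/ρ`.
  · have hs := (res_le ht x).trans (scales_spec hρ ht)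
    rcases Nat.eq_zero_or_pos (scales ρ t) with h0 | h0
    · left; simpa [h0] using hs
    · right
      refine ⟨scales ρ t - 1, by omega, h.trans ?_, hs.trans (le_of_eq ?_)⟩
      · gcongr
        · norm_num
        · omega
      · obtain ⟨m, hm⟩ : ∃ m, scales ρ t = m + 1 := ⟨scales ρ t - 1, by omega⟩
        rw [hm]; simp [pow_succ]; ring

/-! ### From measures of level layers to integrals of propagators -/

section Layers

variable {X : Type*} [MeasurableSpace X] {ν : Measure X}

/-- At the scale `i` the propagator is at most `2 · 2^i/ρ` on a layer of measure at most `cρ/2^i`.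
Every scale contributes `2c`, so the integral is proportional to the number of scales, i.e. to `log
t`. -/
lemma lintegral_res_le {ρ t m c : ℝ} (hρ : 0 < ρ) (ht : 0 < t) {x : X → ℝ}
    (hx : Measurable x) (hm : ν Set.univ ≤ ENNReal.ofReal m)
    (hlayer : ∀ δ > 0, ν {k | |x k| ≤ δ} ≤ ENNReal.ofReal (c * δ)) :
    ∫⁻ k, ENNReal.ofReal (res t (x k)) ∂ν ≤
      ENNReal.ofReal (1 / ρ) * ENNReal.ofReal m + scales ρ t * ENNReal.ofReal (2 * c) := by
  have hms : ∀ i : ℕ, MeasurableSet {k | |x k| ≤ ρ / 2 ^ i} := fun i =>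
    measurableSet_le (by fun_prop) measurable_const
  calc ∫⁻ k, ENNReal.ofReal (res t (x k)) ∂ν
      ≤ ∫⁻ k, ENNReal.ofReal (1 / ρ) + ∑ i ∈ Finset.range (scales ρ t),
          {k | |x k| ≤ ρ / 2 ^ i}.indicator (fun _ => ENNReal.ofReal (2 * 2 ^ i / ρ)) k ∂ν := by
        refine lintegral_mono fun k => ?_
        rcases res_dyadic hρ ht (x k) with h | ⟨i, hi, h1, h2⟩
        · exact (ENNReal.ofReal_le_ofReal h).trans le_self_add
        · refine le_trans ?_ le_add_self
          refine le_trans ?_ (Finset.single_le_sum (fun _ _ => zero_le) (Finset.mem_range.2 hi))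
          rw [Set.indicator_of_mem (by exact h1)]
          exact ENNReal.ofReal_le_ofReal h2
    _ = ENNReal.ofReal (1 / ρ) * ν Set.univ + ∑ i ∈ Finset.range (scales ρ t),
          ENNReal.ofReal (2 * 2 ^ i / ρ) * ν {k | |x k| ≤ ρ / 2 ^ i} := by
        rw [lintegral_add_left measurable_const, lintegral_const,
          lintegral_finsetSum _ fun i _ => measurable_const.indicator (hms i)]
        congr 1
        exact Finset.sum_congr rfl fun i _ => lintegral_indicator_const (hms i) _
    _ ≤ ENNReal.ofReal (1 / ρ) * ENNReal.ofReal m + ∑ i ∈ Finset.range (scales ρ t),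
          ENNReal.ofReal (2 * c) := by
        gcongr with i _
        refine (mul_le_mul_right (hlayer (ρ / 2 ^ i) (by positivity)) _).trans (le_of_eq ?_)
        rw [← ENNReal.ofReal_mul (by positivity)]
        congr 1
        field_simp
    _ = _ := by simp

/-- The same with a pair of scales, each pair contributing `4cD`. Where one of the propagators is at
most `1/ρ` the bound for the other one alone is used. Only thicknesses up to `ρ` occur, as
transversality requires. -/
lemma lintegral_res_mul_res_le {ρ t c B : ℝ} (hρ : 0 < ρ) (ht : 0 < t) {D : ℝ≥0∞}
    {x y : X → ℝ} (hx : Measurable x) (hy : Measurable y)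
    (hB1 : ∫⁻ k, ENNReal.ofReal (res t (x k)) ∂ν ≤ ENNReal.ofReal B)
    (hB2 : ∫⁻ k, ENNReal.ofReal (res t (y k)) ∂ν ≤ ENNReal.ofReal B)
    (hlayer : ∀ δ₁ δ₂, 0 < δ₁ → δ₁ ≤ ρ → 0 < δ₂ → δ₂ ≤ ρ →
      ν ({k | |x k| ≤ δ₁} ∩ {k | |y k| ≤ δ₂}) ≤ ENNReal.ofReal (c * (δ₁ * δ₂)) * D) :
    ∫⁻ k, ENNReal.ofReal (res t (x k)) * ENNReal.ofReal (res t (y k)) ∂ν ≤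
      ENNReal.ofReal (1 / ρ) * (2 * ENNReal.ofReal B) +
        (scales ρ t : ℝ≥0∞) ^ 2 * (ENNReal.ofReal (4 * c) * D) := by
  have hms : ∀ i j : ℕ, MeasurableSet ({k | |x k| ≤ ρ / 2 ^ i} ∩ {k | |y k| ≤ ρ / 2 ^ j}) :=
    fun i j => (measurableSet_le (by fun_prop) measurable_const).inter
      (measurableSet_le (by fun_prop) measurable_const)
  set r := ENNReal.ofReal (1 / ρ) with hr
  set a : ℕ → ℝ≥0∞ := fun i => ENNReal.ofReal (2 * 2 ^ i / ρ) with ha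
  have mx : Measurable fun k => ENNReal.ofReal (res t (x k)) :=
    ENNReal.measurable_ofReal.comp ((continuous_res ht).measurable.comp hx)
  have my : Measurable fun k => ENNReal.ofReal (res t (y k)) :=
    ENNReal.measurable_ofReal.comp ((continuous_res ht).measurable.comp hy)
  calc ∫⁻ k, ENNReal.ofReal (res t (x k)) * ENNReal.ofReal (res t (y k)) ∂ν
      ≤ ∫⁻ k, (r * ENNReal.ofReal (res t (x k)) + r * ENNReal.ofReal (res t (y k))) +
          ∑ i ∈ Finset.range (scales ρ t), ∑ j ∈ Finset.range (scales ρ t),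
          ({k | |x k| ≤ ρ / 2 ^ i} ∩ {k | |y k| ≤ ρ / 2 ^ j}).indicator
            (fun _ => a i * a j) k ∂ν := by
        refine lintegral_mono fun k => ?_
        rcases res_dyadic hρ ht (x k) with h | ⟨i, hi, h1, h2⟩
        · refine le_trans ?_ (le_self_add.trans' le_add_self)
          exact mul_le_mul_left (ENNReal.ofReal_le_ofReal h) _
        · rcases res_dyadic hρ ht (y k) with h' | ⟨j, hj, h1', h2'⟩
          · refine le_trans ?_ (le_self_add.trans' le_self_add)
            rw [mul_comm]
            exact mul_le_mul_left (ENNReal.ofReal_le_ofReal h') _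
          · refine le_trans ?_ le_add_self
            refine le_trans ?_ (Finset.single_le_sum (fun _ _ => zero_le) (Finset.mem_range.2 hi))
            refine le_trans ?_ (Finset.single_le_sum (fun _ _ => zero_le) (Finset.mem_range.2 hj))
            rw [Set.indicator_of_mem (by exact ⟨h1, h1'⟩)]
            exact mul_le_mul' (ENNReal.ofReal_le_ofReal h2) (ENNReal.ofReal_le_ofReal h2')
    _ = (r * ∫⁻ k, ENNReal.ofReal (res t (x k)) ∂ν + r * ∫⁻ k, ENNReal.ofReal (res t (y k)) ∂ν) +
          ∑ i ∈ Finset.range (scales ρ t), ∑ j ∈ Finset.range (scales ρ t),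
          a i * a j * ν ({k | |x k| ≤ ρ / 2 ^ i} ∩ {k | |y k| ≤ ρ / 2 ^ j}) := by
        rw [lintegral_add_left (by fun_prop), lintegral_add_left (by fun_prop),
          lintegral_const_mul _ mx, lintegral_const_mul _ my,
          lintegral_finsetSum _ fun i _ => Finset.measurable_sum _ fun j _ =>
            measurable_const.indicator (hms i j)]
        congr 1
        refine Finset.sum_congr rfl fun i _ => ?_
        rw [lintegral_finsetSum _ fun j _ => measurable_const.indicator (hms i j)]
        exact Finset.sum_congr rfl fun j _ => lintegral_indicator_const (hms i j) _
    _ ≤ (r * ENNReal.ofReal B + r * ENNReal.ofReal B) +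
          ∑ i ∈ Finset.range (scales ρ t), ∑ j ∈ Finset.range (scales ρ t),
          ENNReal.ofReal (4 * c) * D := by
        refine add_le_add (by gcongr)
          (Finset.sum_le_sum fun i _ => Finset.sum_le_sum fun j _ => ?_)
        have hle : ∀ i : ℕ, ρ / 2 ^ i ≤ ρ := fun i =>
          div_le_self hρ.le (one_le_pow₀ (by norm_num))
        refine (mul_le_mul_right (hlayer (ρ / 2 ^ i) (ρ / 2 ^ j) (by positivity) (hle i)
          (by positivity) (hle j)) _).trans (le_of_eq ?_)
        rw [← mul_assoc, ha]
        congr 1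
        rw [← ENNReal.ofReal_mul (by positivity), ← ENNReal.ofReal_mul (by positivity)]
        congr 1
        field_simp
        ring
    _ = _ := by
        simp only [Finset.sum_const, Finset.card_range, nsmul_eq_mul]
        ring

end Layers

end PhononBoltzmann

end

noncomputable section

namespace PhononBoltzmann

/-! ### Integrals of one and two propagators against the vertex weight -/

/-- The measure `M(k, σ) dk`. -/
def vtx {d : ℕ} (M : Mom d → ℤˣ → ℝ) (σ : ℤˣ) : Measure (Mom d) :=
  volume.withDensity fun k => ENNReal.ofReal (M k σ)

/-- `∫_0^∞ (1 + s)^{-5/4} ds`. -/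
def decayMass : ℝ := ∫ s in Set.Ioi (0 : ℝ), (1 + s) ^ (-(5 / 4) : ℝ)

lemma integrableOn_decay : IntegrableOn (fun s : ℝ => (1 + s) ^ (-(5 / 4) : ℝ)) (Set.Ioi 0) := by
  have := integrableOn_add_rpow_Ioi_of_lt (a := -(5 / 4)) (c := 0) (m := 1) (by norm_num)
    (by norm_num)
  simpa only [add_comm] using this

lemma decayMass_nonneg : 0 ≤ decayMass :=
  setIntegral_nonneg measurableSet_Ioi fun s hs => by
    have : (0 : ℝ) < s := hs
    positivity

/-- The mass `∫ ⟨k⟩^{-(d+1)} dk`. -/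
def wtMass (d : ℕ) : ℝ := ∫ k : Mom d, wt (d + 1) k

lemma wtMass_nonneg (d : ℕ) : 0 ≤ wtMass d := integral_nonneg fun k => (wt_pos _ k).le

section

variable {d : ℕ} {K ρ C₅ : ℝ} {e ω : Mom d → ℝ} {M : Mom d → ℤˣ → ℝ}

lemma Regular.continuous_Phi (H : Regular d K ρ C₅ e ω M) (σ : ℤˣ) (p : Mom d) :
    Continuous (fun k => Phi e ω σ p k) := by
  have := H.e_cont
  have := H.ω_cont
  unfold Phi
  fun_prop

lemma Regular.M_le_K (H : Regular d K ρ C₅ e ω M) (k : Mom d) (σ : ℤˣ) : M k σ ≤ K :=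
  (H.M_le k σ).trans (mul_le_of_le_one_right (by linarith [H.one_le]) (wt_le_one _ k))

lemma Regular.M_le' (H : Regular d K ρ C₅ e ω M) (k : Mom d) (σ : ℤˣ) :
    M k σ ≤ K * wt (d + 1) k :=
  (H.M_le k σ).trans (mul_le_mul_of_nonneg_left (wt_anti (by omega) k) (by linarith [H.one_le]))

lemma Regular.integrable_M (H : Regular d K ρ C₅ e ω M) (σ : ℤˣ) :
    Integrable (fun k => M k σ) :=
  (integrable_wt.const_mul K).mono' (H.M_cont σ).aestronglyMeasurable
    (Eventually.of_forall fun k => by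
      rw [Real.norm_of_nonneg (H.M_nonneg k σ)]; exact H.M_le' k σ)

lemma Regular.lintegral_vtx (H : Regular d K ρ C₅ e ω M) (σ : ℤˣ) {g : Mom d → ℝ≥0∞}
    (hg : Measurable g) : ∫⁻ k, g k ∂(vtx M σ) = ∫⁻ k, ENNReal.ofReal (M k σ) * g k := by
  rw [vtx, lintegral_withDensity_eq_lintegral_mul _ (H.M_cont σ).measurable.ennreal_ofReal hg]
  rfl

lemma Regular.lintegral_vtx_le (H : Regular d K ρ C₅ e ω M) (σ : ℤˣ) {g : Mom d → ℝ≥0∞}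
    (hg : Measurable g) : ∫⁻ k, g k ∂(vtx M σ) ≤ ENNReal.ofReal K * ∫⁻ k, g k := by
  rw [H.lintegral_vtx σ hg, ← lintegral_const_mul _ hg]
  exact lintegral_mono fun k => mul_le_mul_left (ENNReal.ofReal_le_ofReal (H.M_le_K k σ)) _

lemma lintegral_wt (d : ℕ) : ∫⁻ k : Mom d, ENNReal.ofReal (wt (d + 1) k)
    = ENNReal.ofReal (wtMass d) :=
  (ofReal_integral_eq_lintegral_ofReal integrable_wt
    (Eventually.of_forall fun k => (wt_pos _ k).le)).symm

lemma Regular.lintegral_vtx_bracket (H : Regular d K ρ C₅ e ω M) (σ : ℤˣ) :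
    ∫⁻ k, ENNReal.ofReal (bracket k ^ 4) ∂(vtx M σ) ≤ ENNReal.ofReal (K * wtMass d) := by
  have hb : Measurable fun k : Mom d => ENNReal.ofReal (bracket k ^ 4) :=
    (continuous_bracket.pow 4).measurable.ennreal_ofReal
  have hK : 0 ≤ K := by linarith [H.one_le]
  rw [H.lintegral_vtx σ hb, ENNReal.ofReal_mul hK, ← lintegral_wt,
    ← lintegral_const_mul _ (continuous_wt _).measurable.ennreal_ofReal]
  refine lintegral_mono fun k => ?_
  rw [← ENNReal.ofReal_mul (H.M_nonneg k σ), ← ENNReal.ofReal_mul hK]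
  refine ENNReal.ofReal_le_ofReal ?_
  have hb := bracket_pos k
  calc M k σ * bracket k ^ 4 ≤ K * wt (d + 5) k * bracket k ^ 4 := by
        gcongr; exact H.M_le k σ
    _ = K * (bracket k ^ 4 * wt (4 + (d + 1)) k) := by
        rw [show d + 5 = 4 + (d + 1) by ring]; ring
    _ = _ := by rw [bracket_pow_mul_wt]

lemma Regular.vtx_univ_le (H : Regular d K ρ C₅ e ω M) (σ : ℤˣ) :
    vtx M σ Set.univ ≤ ENNReal.ofReal (K * wtMass d) := by
  refine le_trans ?_ (H.lintegral_vtx_bracket σ)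
  rw [← lintegral_one]
  refine lintegral_mono fun k => ?_
  rw [← ENNReal.ofReal_one]
  exact ENNReal.ofReal_le_ofReal (one_le_pow₀ (one_le_bracket k))

/-- The square of the propagator is `t` times the real part of `(1/t + iy)⁻¹ = ∫₀^∞ e^{-s(1/t + iy)}
ds`. After Fubini the momentum integral is the oscillatory integral with decay `(1+s)^{-5/4}`, whose
integral over `s` is finite uniformly in `t`. -/
lemma Regular.integral_res_sq_le (H : Regular d K ρ C₅ e ω M) {t : ℝ} (ht : 0 < t) (σ : ℤˣ)
    (p : Mom d) (θ : ℝ) :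
    ∫ k, M k σ * res t (θ - Phi e ω σ p k) ^ 2 ≤ t * (K * decayMass) := by
  set η := t⁻¹ with hη
  have hη0 : 0 < η := by positivity
  set y : Mom d → ℝ := fun k => Phi e ω σ p k - θ with hy
  have cy : Continuous y := (H.continuous_Phi σ p).sub continuous_const
  set z : Mom d → ℂ := fun k => η + Complex.I * y k with hz
  have hzre : ∀ k, (z k).re = η := fun k => by simp [hz]
  have hzne : ∀ k, z k ≠ 0 := fun k h0 => by
    have := hzre k; rw [h0] at this; simp at this; linarith
  have hprod : Integrable (Function.uncurry fun (k : Mom d) (s : ℝ) =>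
      (M k σ : ℂ) * Complex.exp (-(z k) * s)) (volume.prod (volume.restrict (Set.Ioi 0))) := by
    have h1 := (H.integrable_M σ).mul_prod (integrableOn_exp_mul_Ioi (a := -η) (by linarith) 0)
    refine h1.mono ?_ (Eventually.of_forall fun ⟨k, s⟩ => ?_)
    · apply Continuous.aestronglyMeasurable
      have := H.M_cont σ
      simp only [Function.uncurry_def]
      fun_prop
    · simp only [Function.uncurry_apply_pair, norm_mul, Complex.norm_real, Complex.norm_exp]
      simp [hz]
  have hinner : ∀ k, ∫ s in Set.Ioi (0 : ℝ), (M k σ : ℂ) * Complex.exp (-(z k) * s)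
      = (M k σ : ℂ) * (z k)⁻¹ := fun k => by
    rw [integral_const_mul, integral_exp_mul_complex_Ioi (by rw [Complex.neg_re, hzre]; linarith)]
    have := hzne k
    simp
  have hswap := integral_integral_swap hprod
  simp only [hinner] at hswap
  have hnorm : ‖∫ k, (M k σ : ℂ) * (z k)⁻¹‖ ≤ K * decayMass := by
    rw [hswap, decayMass, ← integral_const_mul]
    refine norm_integral_le_of_norm_le (integrableOn_decay.const_mul K) ?_
    filter_upwards [ae_restrict_mem measurableSet_Ioi] with s hs
    have hs0 : (0 : ℝ) < s := hs
    have h1 : ∀ k, (M k σ : ℂ) * Complex.exp (-(z k) * s) =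
        Complex.exp ((-η + Complex.I * θ) * s) *
          (Complex.exp (-Complex.I * ((s * Phi e ω σ p k : ℝ) : ℂ)) * (M k σ : ℂ)) := fun k => by
      rw [← mul_assoc, ← Complex.exp_add, mul_comm]
      congr 2
      simp only [hz, hy]; push_cast; ring
    simp only [h1]
    rw [integral_const_mul, norm_mul, Complex.norm_exp]
    refine (mul_le_of_le_one_left (norm_nonneg _) ?_).trans (H.decay σ p s hs0.le)
    rw [Real.exp_le_one_iff]
    simp
    positivity
  have hre : ∫ k, M k σ * res t (θ - Phi e ω σ p k) ^ 2
      = t * (∫ k, (M k σ : ℂ) * (z k)⁻¹).re := by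
    have hi : Integrable fun k => (M k σ : ℂ) * (z k)⁻¹ := by
      have := hprod.integral_prod_left
      simpa only [Function.uncurry_apply_pair, hinner] using this
    have h2 := integral_re hi
    simp only [RCLike.re_to_complex] at h2
    rw [← h2, ← integral_const_mul]
    congr 1
    funext k
    rw [Complex.re_ofReal_mul, Complex.inv_re, hzre, res_sq, Complex.normSq_apply, hzre]
    simp only [hz, hy, Complex.add_im, Complex.ofReal_im, Complex.mul_im, Complex.I_re,
      Complex.I_im, Complex.ofReal_re]
    have : 0 < (θ - Phi e ω σ p k) ^ 2 + η ^ 2 := by positivity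
    have h3 : η * η + (0 + (0 * 0 + 1 * (Phi e ω σ p k - θ))) *
        (0 + (0 * 0 + 1 * (Phi e ω σ p k - θ))) = (θ - Phi e ω σ p k) ^ 2 + η ^ 2 := by ring
    rw [h3, div_eq_mul_inv]
    have h4 : t * η = 1 := mul_inv_cancel₀ ht.ne'
    linear_combination (-(M k σ * ((θ - Phi e ω σ p k) ^ 2 + η ^ 2)⁻¹)) * h4
  rw [hre]
  gcongr
  exact (Complex.re_le_norm _).trans hnorm

lemma Regular.measurable_arg (H : Regular d K ρ C₅ e ω M) (σ : ℤˣ) (p : Mom d) (θ : ℝ) :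
    Measurable fun k => θ - Phi e ω σ p k :=
  (continuous_const.sub (H.continuous_Phi σ p)).measurable

lemma Regular.lintegral_res_sq_le (H : Regular d K ρ C₅ e ω M) {t : ℝ} (ht : 0 < t) (σ : ℤˣ)
    (p : Mom d) (θ : ℝ) :
    ∫⁻ k, ENNReal.ofReal (res t (θ - Phi e ω σ p k)) ^ 2 ∂(vtx M σ)
      ≤ ENNReal.ofReal (t * (K * decayMass)) := by
  have hc : Continuous fun k => res t (θ - Phi e ω σ p k) :=
    (continuous_res ht).comp (continuous_const.sub (H.continuous_Phi σ p))
  rw [H.lintegral_vtx σ (hc.measurable.ennreal_ofReal.pow_const 2)]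
  have h1 : ∀ k, ENNReal.ofReal (M k σ) * ENNReal.ofReal (res t (θ - Phi e ω σ p k)) ^ 2
      = ENNReal.ofReal (M k σ * res t (θ - Phi e ω σ p k) ^ 2) := fun k => by
    rw [ENNReal.ofReal_mul (H.M_nonneg k σ), ENNReal.ofReal_pow (res_pos ht _).le]
  simp only [h1]
  rw [← ofReal_integral_eq_lintegral_ofReal]
  · exact ENNReal.ofReal_le_ofReal (H.integral_res_sq_le ht σ p θ)
  · refine ((H.integrable_M σ).mul_const (t ^ 2)).mono'
      ((H.M_cont σ).mul (hc.pow 2)).aestronglyMeasurable (Eventually.of_forall fun k => ?_)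
    have h0 := H.M_nonneg k σ
    have h2 := res_pos ht (θ - Phi e ω σ p k)
    rw [Real.norm_of_nonneg (by positivity)]
    gcongr
    exact res_le ht _
  · exact Eventually.of_forall fun k => mul_nonneg (H.M_nonneg k σ) (sq_nonneg _)

/-- Chebyshev's inequality for the squared propagator at time `1/δ`: on the layer `2δ² · res² ≥ 1`.
-/
lemma Regular.vtx_layer_le (H : Regular d K ρ C₅ e ω M) (σ : ℤˣ)
    (p : Mom d) (θ : ℝ) {δ : ℝ} (hδ : 0 < δ) :
    vtx M σ {k | |θ - Phi e ω σ p k| ≤ δ} ≤ ENNReal.ofReal (2 * (K * decayMass) * δ) := by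
  have hm : MeasurableSet {k | |θ - Phi e ω σ p k| ≤ δ} :=
    measurableSet_le (by have := H.measurable_arg σ p θ; fun_prop) measurable_const
  have h1 := H.lintegral_res_sq_le (inv_pos.2 hδ) σ p θ
  calc vtx M σ {k | |θ - Phi e ω σ p k| ≤ δ}
      = ∫⁻ k, {k | |θ - Phi e ω σ p k| ≤ δ}.indicator 1 k ∂(vtx M σ) := by
        rw [lintegral_indicator_one hm]
    _ ≤ ∫⁻ k, ENNReal.ofReal (2 * δ ^ 2) *
          ENNReal.ofReal (res δ⁻¹ (θ - Phi e ω σ p k)) ^ 2 ∂(vtx M σ) := by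
        refine lintegral_mono fun k => ?_
        by_cases hk : |θ - Phi e ω σ p k| ≤ δ
        · rw [Set.indicator_of_mem (by exact hk), Pi.one_apply,
            ← ENNReal.ofReal_pow (res_pos (inv_pos.2 hδ) _).le, ← ENNReal.ofReal_mul (by positivity),
            ENNReal.one_le_ofReal, res_sq, inv_inv, ← div_eq_mul_inv, le_div_iff₀ (by positivity)]
          have := sq_le_sq' (by linarith [abs_nonneg (θ - Phi e ω σ p k)]) hk
          rw [sq_abs] at this
          linarith
        · rw [Set.indicator_of_notMem (by exact hk)]
          exact zero_le
    _ = ENNReal.ofReal (2 * δ ^ 2) *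
          ∫⁻ k, ENNReal.ofReal (res δ⁻¹ (θ - Phi e ω σ p k)) ^ 2 ∂(vtx M σ) :=
        lintegral_const_mul _
          (((continuous_res (inv_pos.2 hδ)).measurable.comp
            (H.measurable_arg σ p θ)).ennreal_ofReal.pow_const 2)
    _ ≤ ENNReal.ofReal (2 * δ ^ 2) * ENNReal.ofReal (δ⁻¹ * (K * decayMass)) := by gcongr
    _ = _ := by
        rw [← ENNReal.ofReal_mul (by positivity)]
        congr 1
        field_simp

lemma Regular.lintegral_res_le (H : Regular d K ρ C₅ e ω M) (hρ : 0 < ρ) {t : ℝ} (ht : 1 ≤ t)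
    (σ : ℤˣ) (p : Mom d) (θ : ℝ) :
    ∫⁻ k, ENNReal.ofReal (res t (θ - Phi e ω σ p k)) ∂(vtx M σ) ≤
      ENNReal.ofReal ((1 / ρ * (K * wtMass d) +
        (3 + |Real.logb 2 ρ|) * (4 * (K * decayMass))) * lg t) := by
  have hJ := decayMass_nonneg
  have hW := wtMass_nonneg d
  have hK := H.one_le
  refine (PhononBoltzmann.lintegral_res_le hρ (by linarith) (H.measurable_arg σ p θ)
    (H.vtx_univ_le σ) fun δ hδ => H.vtx_layer_le σ p θ hδ).trans ?_
  rw [← ENNReal.ofReal_mul (by positivity), ← ENNReal.ofReal_natCast,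
    ← ENNReal.ofReal_mul (by positivity), ← ENNReal.ofReal_add (by positivity) (by positivity)]
  refine ENNReal.ofReal_le_ofReal ?_
  have h1 := scales_le hρ ht
  have h2 := one_le_lg ht
  have h3 : 0 ≤ 1 / ρ * (K * wtMass d) := by positivity
  have h4 : 0 ≤ 4 * (K * decayMass) := by positivity
  nlinarith [mul_le_mul_of_nonneg_right h1 h4]

/-- Transversality is only local. Averaging over the centre `q` of a ball containing `k`, moving the
weight from `k` to `q`, and exchanging the integrals reduces the global measure to `∫ ⟨q⟩^{-(d+5)}
|A ∩ B(q, ρ)| dq`, up to constants. -/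
lemma Regular.vtx_le_of_ball (H : Regular d K ρ C₅ e ω M) (hρ : 0 < ρ) (σ : ℤˣ)
    {A : Set (Mom d)} (hA : MeasurableSet A) {V : ℝ≥0∞}
    (hV : ∀ q, volume (A ∩ Metric.ball q ρ) ≤ V) :
    vtx M σ A ≤ ENNReal.ofReal (K * (1 + ρ) ^ (d + 5) * wtMass d *
      ((volume (Metric.ball (0 : Mom d) ρ)).toReal)⁻¹) * V := by
  have hK := H.one_le
  set b := volume (Metric.ball (0 : Mom d) ρ) with hb
  have hb0 : b ≠ 0 := (Metric.measure_ball_pos volume 0 hρ).ne'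
  have hbt : b ≠ ∞ := measure_ball_lt_top.ne
  set c := K * (1 + ρ) ^ (d + 5) with hc
  have hbq : ∀ k : Mom d, ∫⁻ q, (Metric.ball k ρ).indicator 1 q = b := fun k => by
    rw [lintegral_indicator_one measurableSet_ball, hb, Measure.addHaar_ball_center]
  have key : b * vtx M σ A ≤ ENNReal.ofReal (c * wtMass d) * V := by
    have hmeas : Measurable (Function.uncurry fun (k q : Mom d) =>
        A.indicator 1 k * ((Metric.ball k ρ).indicator (1 : Mom d → ℝ≥0∞) q *
          ENNReal.ofReal (c * wt (d + 5) q))) := by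
      have hset : MeasurableSet {x : Mom d × Mom d | dist x.2 x.1 < ρ} :=
        measurableSet_lt (by fun_prop) measurable_const
      have h1 : (fun x : Mom d × Mom d => (Metric.ball x.1 ρ).indicator (1 : Mom d → ℝ≥0∞) x.2)
          = {x : Mom d × Mom d | dist x.2 x.1 < ρ}.indicator 1 := by
        funext x; simp [Set.indicator, Metric.mem_ball]
      have h2 : Measurable fun x : Mom d × Mom d =>
          (Metric.ball x.1 ρ).indicator (1 : Mom d → ℝ≥0∞) x.2 := by
        rw [h1]; exact measurable_one.indicator hset
      have h3 : Measurable fun x : Mom d × Mom d => A.indicator (1 : Mom d → ℝ≥0∞) x.1 :=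
        (measurable_one.indicator hA).comp measurable_fst
      have h4 : Measurable fun x : Mom d × Mom d => ENNReal.ofReal (c * wt (d + 5) x.2) :=
        (((continuous_wt (d + 5)).measurable.const_mul c).comp measurable_snd).ennreal_ofReal
      exact h3.mul (h2.mul h4)
    calc b * vtx M σ A = ∫⁻ k, A.indicator 1 k * (ENNReal.ofReal (M k σ) * b) := by
          rw [← lintegral_indicator_one hA, H.lintegral_vtx σ (measurable_one.indicator hA),
            ← lintegral_const_mul b (f := fun k => ENNReal.ofReal (M k σ) * A.indicator 1 k)
              ((H.M_cont σ).measurable.ennreal_ofReal.mul (measurable_one.indicator hA))]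
          refine lintegral_congr fun k => ?_
          ring
      _ = ∫⁻ k, ∫⁻ q, A.indicator 1 k * ((Metric.ball k ρ).indicator 1 q *
            ENNReal.ofReal (M k σ)) := by
          refine lintegral_congr fun k => ?_
          rw [lintegral_const_mul _ ((measurable_one.indicator measurableSet_ball).mul_const _),
            lintegral_mul_const _ (measurable_one.indicator measurableSet_ball), hbq, mul_comm b]
      _ ≤ ∫⁻ k, ∫⁻ q, A.indicator 1 k * ((Metric.ball k ρ).indicator 1 q *
            ENNReal.ofReal (c * wt (d + 5) q)) := by
          refine lintegral_mono fun k => lintegral_mono fun q => ?_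
          by_cases hq : q ∈ Metric.ball k ρ
          · gcongr
            refine (H.M_le k σ).trans ?_
            rw [hc, mul_assoc]
            have := wt_pos (d + 5) q
            gcongr
            refine (wt_le_of_dist (d + 5) k q).trans ?_
            have h1 : ‖k - q‖ < ρ := by rwa [← dist_eq_norm, dist_comm]
            gcongr
          · simp [Set.indicator_of_notMem hq]
      _ = ∫⁻ q, ∫⁻ k, A.indicator 1 k * ((Metric.ball k ρ).indicator 1 q *
            ENNReal.ofReal (c * wt (d + 5) q)) := lintegral_lintegral_swap hmeas.aemeasurable
      _ = ∫⁻ q, ENNReal.ofReal (c * wt (d + 5) q) * volume (A ∩ Metric.ball q ρ) := by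
          refine lintegral_congr fun q => ?_
          rw [← lintegral_indicator_one (hA.inter measurableSet_ball),
            ← lintegral_const_mul _ (measurable_one.indicator (hA.inter measurableSet_ball))]
          refine lintegral_congr fun k => ?_
          have hsym : k ∈ Metric.ball q ρ ↔ q ∈ Metric.ball k ρ := Metric.mem_ball_comm
          by_cases h1 : k ∈ A <;> by_cases h2 : q ∈ Metric.ball k ρ <;>
            simp [Set.indicator, h1, h2, hsym, -Metric.mem_ball]
      _ ≤ ∫⁻ q : Mom d, ENNReal.ofReal (c * wt (d + 1) q) * V := by
          refine lintegral_mono fun q => mul_le_mul' (ENNReal.ofReal_le_ofReal ?_) (hV q)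
          gcongr
          exact wt_anti (by omega) q
      _ = _ := by
          have hc0 : 0 ≤ c := by positivity
          rw [lintegral_mul_const _ ((continuous_wt _).measurable.const_mul c).ennreal_ofReal]
          congr 1
          simp only [ENNReal.ofReal_mul hc0]
          rw [lintegral_const_mul _ (continuous_wt _).measurable.ennreal_ofReal, lintegral_wt]
  have hW := wtMass_nonneg d
  have h2 : ENNReal.ofReal (c * wtMass d * (b.toReal)⁻¹) = b⁻¹ * ENNReal.ofReal (c * wtMass d) := by
    rw [ENNReal.ofReal_mul (by positivity), ENNReal.ofReal_inv_of_pos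
      (ENNReal.toReal_pos hb0 hbt), ENNReal.ofReal_toReal hbt, mul_comm]
  calc vtx M σ A = b⁻¹ * (b * vtx M σ A) := by
        rw [← mul_assoc, ENNReal.inv_mul_cancel hb0 hbt, one_mul]
    _ ≤ b⁻¹ * (ENNReal.ofReal (c * wtMass d) * V) := by gcongr
    _ = _ := by rw [h2, ← mul_assoc]


/-- The propagator as an extended nonnegative number. -/
def eres (t x : ℝ) : ℝ≥0∞ := ENNReal.ofReal (res t x)

lemma eres_le {t : ℝ} (ht : 0 < t) (x : ℝ) : eres t x ≤ ENNReal.ofReal t :=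
  ENNReal.ofReal_le_ofReal (res_le ht x)

lemma measurable_eres {t : ℝ} (ht : 0 < t) : Measurable (eres t) :=
  (continuous_res ht).measurable.ennreal_ofReal

/-- The estimates of integrals of propagators against the vertex weight at time scale `t`. -/
structure PropagatorBounds (B t : ℝ) (e ω : Mom d → ℝ) (M : Mom d → ℤˣ → ℝ) : Prop where
  bracket_le : ∀ σ, ∫⁻ k, ENNReal.ofReal (bracket k ^ 4) ∂(vtx M σ) ≤ ENNReal.ofReal B
  sq_le : ∀ σ p θ, ∫⁻ k, eres t (θ - Phi e ω σ p k) ^ 2 ∂(vtx M σ) ≤ ENNReal.ofReal (B * t)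
  one_le : ∀ σ p θ, ∫⁻ k, eres t (θ - Phi e ω σ p k) ∂(vtx M σ) ≤ ENNReal.ofReal (B * lg t)
  two_le : ∀ σ p θ p' θ',
    ∫⁻ k, eres t (θ - Phi e ω σ p k) * eres t (θ' - Phi e ω σ p' k) ∂(vtx M σ)
      ≤ ENNReal.ofReal (B * lg t ^ 2) * (1 + eres t ‖p - p'‖)
  sq_sing_le : ∀ σ p θ v,
    ∫⁻ k, eres t (θ - Phi e ω σ p k) ^ 2 * (1 + eres t ‖k + v‖) ∂(vtx M σ)
      ≤ ENNReal.ofReal (B * t ^ (7 / 5 : ℝ))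
  one_sing_le : ∀ σ p θ v,
    ∫⁻ k, eres t (θ - Phi e ω σ p k) * (1 + eres t ‖k + v‖) ∂(vtx M σ)
      ≤ ENNReal.ofReal (B * lg t * t ^ (2 / 5 : ℝ))

/-- Transversality gives `(log t)² / ‖p - p'‖`. This is useless, or void, when the momenta are
closer than `1/t`; there one propagator is bounded by `t`, which is at most `2 res t ‖p - p'‖`. The
regularized singularity covers both cases. -/
lemma Regular.two_le (H : Regular d K ρ C₅ e ω M) (hρ : 0 < ρ) (hC₅ : 0 < C₅) {t b cν : ℝ}
    (ht : 1 ≤ t) (hb : 0 ≤ b) (hcν : 0 ≤ cν) (σ : ℤˣ)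
    (hone : ∀ p θ, ∫⁻ k, eres t (θ - Phi e ω σ p k) ∂(vtx M σ) ≤ ENNReal.ofReal (b * lg t))
    (hball : ∀ A : Set (Mom d), MeasurableSet A → ∀ V : ℝ≥0∞,
      (∀ q, volume (A ∩ Metric.ball q ρ) ≤ V) → vtx M σ A ≤ ENNReal.ofReal cν * V)
    (p : Mom d) (θ : ℝ) (p' : Mom d) (θ' : ℝ) :
    ∫⁻ k, eres t (θ - Phi e ω σ p k) * eres t (θ' - Phi e ω σ p' k) ∂(vtx M σ)
      ≤ ENNReal.ofReal ((1 / ρ * (2 * b) + 2 * b +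
        8 * (3 + |Real.logb 2 ρ|) ^ 2 * (cν * C₅ * ρ ^ (d - 2))) * lg t ^ 2) *
        (1 + eres t ‖p - p'‖) := by
  have ht0 : 0 < t := by linarith
  have hlg := one_le_lg ht
  set D := ‖p - p'‖ with hD
  set n := 3 + |Real.logb 2 ρ| with hn
  set c := cν * C₅ * ρ ^ (d - 2) with hc
  have hn0 : 0 ≤ n := by positivity
  have hc0 : 0 ≤ c := by positivity
  have hr := (res_pos ht0 D).le
  have hgoal : ENNReal.ofReal ((1 / ρ * (2 * b) + 2 * b + 8 * n ^ 2 * c) * lg t ^ 2) *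
      (1 + eres t D) = ENNReal.ofReal ((1 / ρ * (2 * b) + 2 * b + 8 * n ^ 2 * c) * lg t ^ 2 *
        (1 + res t D)) := by
    rw [ENNReal.ofReal_mul (q := 1 + res t D) (by positivity), ENNReal.ofReal_add zero_le_one hr,
      ENNReal.ofReal_one]
    rfl
  rw [hgoal]
  have hres : ∀ L : ℝ, 0 < L → D ≤ L → t⁻¹ ≤ L → (2 * L)⁻¹ ≤ res t D := by
    intro L hL h1 h2
    refine inv_anti₀ (by positivity) ?_
    rw [Real.sqrt_le_left (by positivity)]
    have h3 : D ^ 2 ≤ L ^ 2 := by gcongr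
    have h4 : t⁻¹ ^ 2 ≤ L ^ 2 := by gcongr
    nlinarith
  rcases lt_or_ge D t⁻¹ with hDt | hDt
  · calc ∫⁻ k, eres t (θ - Phi e ω σ p k) * eres t (θ' - Phi e ω σ p' k) ∂(vtx M σ)
        ≤ ∫⁻ k, ENNReal.ofReal t * eres t (θ' - Phi e ω σ p' k) ∂(vtx M σ) :=
          lintegral_mono fun k => mul_le_mul_left (eres_le ht0 _) _
      _ ≤ ENNReal.ofReal t * ENNReal.ofReal (b * lg t) := by
          rw [lintegral_const_mul _ (f := fun k => eres t (θ' - Phi e ω σ p' k))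
            ((measurable_eres ht0).comp (H.measurable_arg σ p' θ'))]
          gcongr
          exact hone p' θ'
      _ ≤ _ := by
          rw [← ENNReal.ofReal_mul ht0.le]
          refine ENNReal.ofReal_le_ofReal ?_
          have h1 := hres t⁻¹ (by positivity) hDt.le le_rfl
          have h2 : (2 * t⁻¹)⁻¹ = t / 2 := by field_simp
          rw [h2] at h1
          calc t * (b * lg t) ≤ (2 * res t D) * (b * (lg t * lg t)) := by
                gcongr
                · linarith
                · nlinarith
            _ = 2 * b * lg t ^ 2 * res t D := by ring
            _ ≤ _ := by
                gcongr
                · have h5 : 0 ≤ 1 / ρ * (2 * b) := by positivity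
                  have h6 : 0 ≤ 8 * n ^ 2 * c := by positivity
                  linarith
                · linarith
  · have hD0 : 0 < D := lt_of_lt_of_le (by positivity) hDt
    have hpp : p ≠ p' := by rw [← sub_ne_zero, ← norm_pos_iff]; exact hD0
    refine (lintegral_res_mul_res_le (c := c) (B := b * lg t) (D := ENNReal.ofReal D⁻¹) hρ ht0
      (H.measurable_arg σ p θ) (H.measurable_arg σ p' θ') (hone p θ) (hone p' θ')
      fun δ₁ δ₂ h1 h1' h2 h2' => ?_).trans ?_
    · have hms : ∀ p θ δ, MeasurableSet {k | |θ - Phi e ω σ p k| ≤ δ} := fun p θ δ =>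
        measurableSet_le (by have := H.measurable_arg σ p θ; fun_prop) measurable_const
      refine (hball _ ((hms p θ δ₁).inter (hms p' θ' δ₂))
        (ENNReal.ofReal (C₅ * δ₁ * δ₂ * ρ ^ (d - 2) / ‖p - p'‖)) fun q => ?_).trans (le_of_eq ?_)
      · convert H.transversal σ δ₁ δ₂ h1 h1' h2 h2' p p' hpp θ θ' q using 4
        · simp only [levelLayer, abs_sub_comm]
        · simp only [levelLayer, abs_sub_comm]
      · rw [← ENNReal.ofReal_mul hcν, ← ENNReal.ofReal_mul (by positivity)]
        congr 1
        rw [hc, div_eq_mul_inv]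
        ring
    · have hs := scales_le hρ ht
      have h1 := hres D hD0 le_rfl hDt
      have h2 : D⁻¹ ≤ 2 * res t D := by
        rw [mul_inv] at h1; linarith
      have e2 : (2 : ℝ≥0∞) = ENNReal.ofReal 2 := by simp
      rw [← ENNReal.ofReal_natCast, ← ENNReal.ofReal_pow (by positivity),
        ← ENNReal.ofReal_mul (by positivity), ← ENNReal.ofReal_mul (by positivity), e2,
        ← ENNReal.ofReal_mul (by norm_num), ← ENNReal.ofReal_mul (by positivity),
        ← ENNReal.ofReal_add (by positivity) (by positivity)]
      refine ENNReal.ofReal_le_ofReal ?_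
      have h3 : 1 / ρ * (2 * (b * lg t)) ≤ 1 / ρ * (2 * b) * lg t ^ 2 * (1 + res t D) := by
        calc 1 / ρ * (2 * (b * lg t)) = 1 / ρ * (2 * b) * (lg t * 1) * 1 := by ring
          _ ≤ 1 / ρ * (2 * b) * (lg t * lg t) * (1 + res t D) := by gcongr; linarith
          _ = _ := by ring
      have h4 : (scales ρ t : ℝ) ^ 2 * (4 * c * D⁻¹) ≤ 8 * n ^ 2 * c * lg t ^ 2 * (1 + res t D) := by
        calc (scales ρ t : ℝ) ^ 2 * (4 * c * D⁻¹) ≤ (n * lg t) ^ 2 * (4 * c * (2 * res t D)) := by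
              gcongr
          _ = 8 * n ^ 2 * c * lg t ^ 2 * res t D := by ring
          _ ≤ _ := by gcongr; linarith
      have h5 : 0 ≤ 2 * b * lg t ^ 2 * (1 + res t D) := by positivity
      calc _ ≤ _ := add_le_add h3 h4
        _ ≤ _ := by nlinarith

/-- The singularity is cut at the radius `t^{-2/5}`. Outside it is at most `t^{2/5}`; inside `‖z‖⁻¹
= ‖z‖^{3/2} ‖z‖^{-5/2} ≤ t^{-3/5} sing z`. The radius balances the two terms in both applications of
`Regular.sing_le`: `t · t^{2/5} = t² · t^{-3/5}` and, up to logarithms, `t^{2/5} = t · t^{-3/5}`. -/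
lemma one_add_eres_le {t : ℝ} (ht : 1 ≤ t) {z : Mom d} (hz : z ≠ 0) :
    1 + eres t ‖z‖ ≤ ENNReal.ofReal (2 * t ^ (2 / 5 : ℝ)) +
      ENNReal.ofReal (t ^ (-(3 / 5) : ℝ)) * ENNReal.ofReal (sing z) := by
  have ht0 : 0 < t := by linarith
  have hy : 0 < ‖z‖ := norm_pos_iff.2 hz
  have hs := sing_nonneg z
  have hr := (res_pos ht0 ‖z‖).le
  rw [← ENNReal.ofReal_mul (by positivity), ← ENNReal.ofReal_add (by positivity) (by positivity),
    eres, ← ENNReal.ofReal_one, ← ENNReal.ofReal_add zero_le_one hr]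
  refine ENNReal.ofReal_le_ofReal ?_
  have h1 : 1 ≤ t ^ (2 / 5 : ℝ) := Real.one_le_rpow ht (by norm_num)
  have hinv : res t ‖z‖ ≤ ‖z‖⁻¹ := by
    have := res_le_inv (t := t) (x := ‖z‖) (by rwa [abs_of_pos hy])
    rwa [abs_of_pos hy] at this
  set κ := t ^ (-(2 / 5) : ℝ) with hκ
  have hκ0 : 0 < κ := by positivity
  have hκ1 : κ ≤ 1 := Real.rpow_le_one_of_one_le_of_nonpos ht (by norm_num)
  rcases le_or_gt κ ‖z‖ with h | h
  · have h2 : ‖z‖⁻¹ ≤ t ^ (2 / 5 : ℝ) := by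
      calc ‖z‖⁻¹ ≤ κ⁻¹ := inv_anti₀ hκ0 h
        _ = _ := by rw [hκ, Real.rpow_neg ht0.le, inv_inv]
    have h3 : 0 ≤ t ^ (-(3 / 5) : ℝ) * sing z := by positivity
    linarith
  · have hsing : sing z = ‖z‖ ^ (-(5 / 2) : ℝ) := by simp [sing, h.trans_le hκ1]
    have h2 : ‖z‖⁻¹ ≤ t ^ (-(3 / 5) : ℝ) * sing z := by
      have h3 : ‖z‖ ^ (3 / 2 : ℝ) ≤ t ^ (-(3 / 5) : ℝ) := by
        calc ‖z‖ ^ (3 / 2 : ℝ) ≤ κ ^ (3 / 2 : ℝ) := by gcongr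
          _ = _ := by rw [hκ, ← Real.rpow_mul ht0.le]; norm_num
      calc ‖z‖⁻¹ = ‖z‖ ^ (3 / 2 : ℝ) * ‖z‖ ^ (-(5 / 2) : ℝ) := by
            rw [← Real.rpow_add hy, ← Real.rpow_neg_one]; norm_num
        _ ≤ _ := by rw [hsing]; gcongr
    linarith

/-- Away from the singularity the integral bound for `g` is used, near it the supremum `T` of `g`
and the integrability of `sing`. The singular point is a null set. -/
lemma Regular.sing_le (hd : 3 ≤ d) (H : Regular d K ρ C₅ e ω M) {t T : ℝ} (ht : 1 ≤ t) (σ : ℤˣ)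
    {g : Mom d → ℝ≥0∞} (hg : Measurable g) {b : ℝ≥0∞} (hb : ∫⁻ k, g k ∂(vtx M σ) ≤ b)
    (hT : ∀ k, g k ≤ ENNReal.ofReal T) (v : Mom d) :
    ∫⁻ k, g k * (1 + eres t ‖k + v‖) ∂(vtx M σ) ≤ b * ENNReal.ofReal (2 * t ^ (2 / 5 : ℝ)) +
      ENNReal.ofReal T * ENNReal.ofReal (t ^ (-(3 / 5) : ℝ)) *
        (ENNReal.ofReal K * ENNReal.ofReal (∫ k : Mom d, sing k)) := by
  have hnull : ∀ᵐ k ∂(vtx M σ), k + v ≠ 0 := by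
    have : Nontrivial (Mom d) := by
      have : Nonempty (Fin d) := ⟨⟨0, by omega⟩⟩
      infer_instance
    have hv : ∀ᵐ k : Mom d, k ≠ -v := by simp [ae_iff]
    exact (withDensity_absolutelyContinuous _ _).ae_le
      (hv.mono fun k hk h0 => hk (add_eq_zero_iff_eq_neg.1 h0))
  have hms : Measurable fun k : Mom d => ENNReal.ofReal (sing (k + v)) :=
    (measurable_sing.comp (measurable_add_const v)).ennreal_ofReal
  calc ∫⁻ k, g k * (1 + eres t ‖k + v‖) ∂(vtx M σ)
      ≤ ∫⁻ k, g k * ENNReal.ofReal (2 * t ^ (2 / 5 : ℝ)) + ENNReal.ofReal T *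
          ENNReal.ofReal (t ^ (-(3 / 5) : ℝ)) * ENNReal.ofReal (sing (k + v)) ∂(vtx M σ) := by
        refine lintegral_mono_ae ?_
        filter_upwards [hnull] with k hk
        refine (mul_le_mul_right (one_add_eres_le ht hk) _).trans ?_
        rw [mul_add, mul_assoc]
        gcongr
        exact hT k
    _ = (∫⁻ k, g k ∂(vtx M σ)) * ENNReal.ofReal (2 * t ^ (2 / 5 : ℝ)) + ENNReal.ofReal T *
          ENNReal.ofReal (t ^ (-(3 / 5) : ℝ)) *
            ∫⁻ k, ENNReal.ofReal (sing (k + v)) ∂(vtx M σ) := by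
        rw [lintegral_add_left (hg.mul_const _), lintegral_mul_const _ hg,
          lintegral_const_mul _ hms]
    _ ≤ _ := by
        gcongr
        refine (H.lintegral_vtx_le σ hms).trans ?_
        rw [lintegral_add_right_eq_self (fun k => ENNReal.ofReal (sing k)) v,
          ← ofReal_integral_eq_lintegral_ofReal (integrable_sing hd)
            (Eventually.of_forall sing_nonneg)]

lemma exists_propagatorBounds (hd : 3 ≤ d) (hρ : 0 < ρ) (hC₅ : 0 < C₅) (K : ℝ) :
    ∃ B : ℝ, 1 ≤ B ∧ ∀ (e ω : Mom d → ℝ) (M : Mom d → ℤˣ → ℝ), Regular d K ρ C₅ e ω M →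
      ∀ t, 1 ≤ t → PropagatorBounds B t e ω M := by
  by_cases hK : 1 ≤ K
  swap
  · exact ⟨1, le_rfl, fun e ω M H => absurd H.one_le hK⟩
  have hJ := decayMass_nonneg
  have hW := wtMass_nonneg d
  set J := K * decayMass with hJdef
  set m := K * wtMass d with hm
  set b := 1 / ρ * m + (3 + |Real.logb 2 ρ|) * (4 * J) with hb
  set cν := K * (1 + ρ) ^ (d + 5) * wtMass d * ((volume (Metric.ball (0 : Mom d) ρ)).toReal)⁻¹
    with hcν
  set b₂ := 1 / ρ * (2 * b) + 2 * b + 8 * (3 + |Real.logb 2 ρ|) ^ 2 * (cν * C₅ * ρ ^ (d - 2))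
    with hb₂
  set S := ∫ k : Mom d, sing k with hS
  have hS0 : 0 ≤ S := integral_nonneg sing_nonneg
  have hJ0 : 0 ≤ J := by positivity
  have hm0 : 0 ≤ m := by positivity
  have hb0 : 0 ≤ b := by positivity
  have hcν0 : 0 ≤ cν := by positivity
  have hb₂0 : 0 ≤ b₂ := by positivity
  set B := 1 + m + J + b + b₂ + (2 * J + K * S) + (2 * b + K * S) with hB
  have hKS : 0 ≤ K * S := by positivity
  refine ⟨B, by linarith, fun e ω M H t ht => ?_⟩
  have ht0 : 0 < t := by linarith
  have hlg := one_le_lg ht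
  have hone : ∀ σ p θ, ∫⁻ k, eres t (θ - Phi e ω σ p k) ∂(vtx M σ) ≤ ENNReal.ofReal (b * lg t) :=
    fun σ p θ => H.lintegral_res_le hρ ht σ p θ
  have hsq : ∀ σ p θ, ∫⁻ k, eres t (θ - Phi e ω σ p k) ^ 2 ∂(vtx M σ) ≤ ENNReal.ofReal (t * J) :=
    fun σ p θ => H.lintegral_res_sq_le ht0 σ p θ
  have hmeas : ∀ σ p θ, Measurable fun k => eres t (θ - Phi e ω σ p k) := fun σ p θ =>
    (measurable_eres ht0).comp (H.measurable_arg σ p θ)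
  refine ⟨fun σ => ?_, fun σ p θ => ?_, fun σ p θ => ?_, fun σ p θ p' θ' => ?_,
    fun σ p θ v => ?_, fun σ p θ v => ?_⟩
  · exact (H.lintegral_vtx_bracket σ).trans (ENNReal.ofReal_le_ofReal (by linarith))
  · refine (hsq σ p θ).trans (ENNReal.ofReal_le_ofReal ?_)
    rw [mul_comm]; gcongr; linarith
  · refine (hone σ p θ).trans (ENNReal.ofReal_le_ofReal ?_)
    gcongr; linarith
  · refine (H.two_le hρ hC₅ ht hb0 hcν0 σ (hone σ) (fun A hA V hV => H.vtx_le_of_ball hρ σ hA hV)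
      p θ p' θ').trans ?_
    gcongr
    linarith
  · refine (H.sing_le hd ht σ ((hmeas σ p θ).pow_const 2) (hsq σ p θ) (T := t ^ 2) (fun k => ?_)
      v).trans ?_
    · rw [ENNReal.ofReal_pow ht0.le]; gcongr; exact eres_le ht0 _
    · rw [← ENNReal.ofReal_mul (by positivity), ← ENNReal.ofReal_mul (by positivity),
        ← ENNReal.ofReal_mul (by positivity), ← ENNReal.ofReal_mul (by positivity),
        ← ENNReal.ofReal_add (by positivity) (by positivity)]
      refine ENNReal.ofReal_le_ofReal ?_
      have h1 : t * t ^ (2 / 5 : ℝ) = t ^ (7 / 5 : ℝ) := by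
        rw [← Real.rpow_one_add' ht0.le (by norm_num)]; norm_num
      have h2 : t ^ 2 * t ^ (-(3 / 5) : ℝ) = t ^ (7 / 5 : ℝ) := by
        rw [← Real.rpow_natCast, ← Real.rpow_add ht0]; norm_num
      calc t * J * (2 * t ^ (2 / 5 : ℝ)) + t ^ 2 * t ^ (-(3 / 5) : ℝ) * (K * S)
          = (2 * J + K * S) * t ^ (7 / 5 : ℝ) := by rw [h2, ← h1]; ring
        _ ≤ _ := by gcongr; linarith
  · refine (H.sing_le hd ht σ (hmeas σ p θ) (hone σ p θ) (T := t) (fun k => eres_le ht0 _)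
      v).trans ?_
    rw [← ENNReal.ofReal_mul (by positivity), ← ENNReal.ofReal_mul (by positivity),
      ← ENNReal.ofReal_mul (by positivity), ← ENNReal.ofReal_mul (by positivity),
      ← ENNReal.ofReal_add (by positivity) (by positivity)]
    refine ENNReal.ofReal_le_ofReal ?_
    have h2 : t * t ^ (-(3 / 5) : ℝ) = t ^ (2 / 5 : ℝ) := by
      rw [← Real.rpow_one_add' ht0.le (by norm_num)]; norm_num
    calc b * lg t * (2 * t ^ (2 / 5 : ℝ)) + t * t ^ (-(3 / 5) : ℝ) * (K * S)
        = 2 * b * lg t * t ^ (2 / 5 : ℝ) + K * S * 1 * t ^ (2 / 5 : ℝ) := by rw [h2]; ring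
      _ ≤ 2 * b * lg t * t ^ (2 / 5 : ℝ) + K * S * lg t * t ^ (2 / 5 : ℝ) := by gcongr
      _ = (2 * b + K * S) * lg t * t ^ (2 / 5 : ℝ) := by ring
      _ ≤ _ := by gcongr; linarith

end

end PhononBoltzmann

end

noncomputable section

namespace PhononBoltzmann

/-! ### Iterated integration in the order of the ladder -/

section Ladder

variable {X : Type*} [MeasurableSpace X]

lemma lintegral_pi_succ {n : ℕ} (ν : Fin (n + 1) → Measure X) [∀ i, SigmaFinite (ν i)]
    {f : (Fin (n + 1) → X) → ℝ≥0∞} (hf : Measurable f) :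
    ∫⁻ x, f x ∂(Measure.pi ν) =
      ∫⁻ y, ∫⁻ z, f (Fin.cons z y) ∂(ν 0) ∂(Measure.pi fun i : Fin n => ν i.succ) := by
  have h := measurePreserving_piFinSuccAbove ν 0
  rw [← (h.symm _).lintegral_comp_emb (MeasurableEquiv.measurableEmbedding _) f]
  rw [lintegral_prod_symm (fun z => f ((MeasurableEquiv.piFinSuccAbove (fun _ => X) 0).symm z))
    (hf.comp (MeasurableEquiv.measurable _)).aemeasurable]
  have e : ∀ (x : X) (y : Fin n → X), (MeasurableEquiv.piFinSuccAbove (fun _ => X) 0).symm (x, y) =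
      (Fin.cons x y : Fin (n + 1) → X) := fun x y => Fin.insertNth_zero' x y
  simp only [e, Fin.zero_succAbove]

/-- Integrals of products of functions, the `i`-th of which depends only on the variables
`x_i, …, x_{n-1}`, are bounded by successive integration. -/
lemma lintegral_pi_prod_le [Inhabited X] : ∀ {n : ℕ} (ν : Fin n → Measure X)
    [∀ i, SigmaFinite (ν i)] (G : Fin n → (Fin n → X) → ℝ≥0∞) (B : Fin n → ℝ≥0∞),
    (∀ i, Measurable (G i)) →
    (∀ i x y, (∀ l, i ≤ l → x l = y l) → G i x = G i y) →
    (∀ i x, ∫⁻ z, G i (Function.update x i z) ∂(ν i) ≤ B i) →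
    ∫⁻ x, ∏ i, G i x ∂(Measure.pi ν) ≤ ∏ i, B i
  | 0, ν, _, G, B, _, _, _ => by simp
  | n + 1, ν, _, G, B, hm, hdep, hB => by
    -- The later factors do not see the variable `0`, so it is frozen at `default`; the inner
    -- integral then acts on `G 0` alone and the induction continues with one variable fewer.
    have hcons : ∀ i : Fin n, ∀ (z : X) (y : Fin n → X),
        G i.succ (Fin.cons z y) = G i.succ (Fin.cons default y) := fun i z y =>
      hdep _ _ _ fun l hl => by
        obtain ⟨l', rfl⟩ := Fin.eq_succ_of_ne_zero
          (fun h0 => by rw [h0] at hl; exact absurd hl (by simp) : l ≠ 0)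
        simp
    have mc : ∀ z : X, Measurable fun y : Fin n → X => (Fin.cons z y : Fin (n + 1) → X) := fun z =>
      measurable_pi_lambda _ fun i => by
        refine Fin.cases ?_ (fun j => ?_) i
        · simp
        · simpa using measurable_pi_apply j
    have mc' : ∀ y : Fin n → X, Measurable fun z : X => (Fin.cons z y : Fin (n + 1) → X) := fun y =>
      measurable_pi_lambda _ fun i => by
        refine Fin.cases ?_ (fun j => ?_) i
        · simp only [Fin.cons_zero]; exact measurable_id
        · simp
    rw [lintegral_pi_succ ν (Finset.measurable_prod _ fun i _ => hm i)]
    calc ∫⁻ y, ∫⁻ z, ∏ i, G i (Fin.cons z y) ∂(ν 0) ∂(Measure.pi fun i : Fin n => ν i.succ)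
        ≤ ∫⁻ y, B 0 * ∏ i : Fin n, G i.succ (Fin.cons default y)
            ∂(Measure.pi fun i : Fin n => ν i.succ) := by
          refine lintegral_mono fun y => ?_
          simp only [Fin.prod_univ_succ, hcons]
          rw [lintegral_mul_const (f := fun z => G 0 (Fin.cons z y)) _ ((hm 0).comp (mc' y))]
          gcongr
          have := hB 0 (Fin.cons default y)
          simpa only [Fin.update_cons_zero] using this
      _ = B 0 * ∫⁻ y, ∏ i : Fin n, G i.succ (Fin.cons default y)
            ∂(Measure.pi fun i : Fin n => ν i.succ) :=
          lintegral_const_mul _ (Finset.measurable_prod _ fun i _ => (hm i.succ).comp (mc default))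
      _ ≤ B 0 * ∏ i : Fin n, B i.succ := by
          gcongr
          refine lintegral_pi_prod_le (fun i : Fin n => ν i.succ)
            (fun i y => G i.succ (Fin.cons default y)) (fun i => B i.succ)
            (fun i => (hm i.succ).comp (mc default)) (fun i x y hxy => hdep _ _ _ fun l hl => ?_)
            (fun i x => ?_)
          · refine Fin.cases (by simp) (fun l' hl' => ?_) l hl
            simpa using hxy l' (by simpa using hl')
          · have := hB i.succ (Fin.cons default x)
            simpa only [Fin.cons_update] using this
      _ = _ := by rw [Fin.prod_univ_succ]

lemma lintegral_pi_prod_eq : ∀ {n : ℕ} (ν : Fin n → Measure X)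
    [∀ i, SigmaFinite (ν i)] (f : Fin n → X → ℝ≥0∞), (∀ i, Measurable (f i)) →
    ∫⁻ x, ∏ i, f i (x i) ∂(Measure.pi ν) = ∏ i, ∫⁻ z, f i z ∂(ν i)
  | 0, ν, _, f, _ => by simp
  | n + 1, ν, _, f, hm => by
    rw [lintegral_pi_succ ν (f := fun x => ∏ i, f i (x i))
      (Finset.measurable_prod _ fun i _ => (hm i).comp (measurable_pi_apply i))]
    simp only [Fin.prod_univ_succ, Fin.cons_zero, Fin.cons_succ]
    simp only [lintegral_mul_const _ (hm 0)]
    rw [lintegral_const_mul _ (Finset.measurable_prod _ fun i _ =>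
      (hm i.succ).comp (measurable_pi_apply i)),
      lintegral_pi_prod_eq (fun i : Fin n => ν i.succ) (fun i => f i.succ) fun i => hm i.succ]

lemma pi_withDensity {n : ℕ} (ν : Fin n → Measure X) [∀ i, SigmaFinite (ν i)]
    (f : Fin n → X → ℝ≥0∞) (hf : ∀ i, Measurable (f i))
    [∀ i, SigmaFinite ((ν i).withDensity (f i))] :
    Measure.pi (fun i => (ν i).withDensity (f i)) =
      (Measure.pi ν).withDensity fun x => ∏ i, f i (x i) := by
  refine Measure.pi_eq (μ := fun i => (ν i).withDensity (f i)) fun s hs => ?_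
  rw [withDensity_apply _ (MeasurableSet.univ_pi hs), Measure.restrict_pi_pi,
    lintegral_pi_prod_eq _ _ hf]
  exact Finset.prod_congr rfl fun i _ => (withDensity_apply _ (hs i)).symm

/-- The second term of the Schwarz inequality is a ladder in the permuted momenta; with the signs
permuted accordingly it becomes an ordinary ladder. -/
lemma lintegral_pi_perm {n : ℕ} (ν : Fin n → Measure X) [∀ i, SigmaFinite (ν i)]
    (π : Equiv.Perm (Fin n)) (g : (Fin n → X) → ℝ≥0∞) :
    ∫⁻ k, g (fun j => k (π.symm j)) ∂(Measure.pi ν) =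
      ∫⁻ k, g k ∂(Measure.pi fun j => ν (π.symm j)) := by
  have h := measurePreserving_piCongrLeft (fun j => ν (π.symm j)) π
  have h2 : (fun i' => ν (π.symm (π i'))) = ν := by funext i; simp
  rw [h2] at h
  rw [← h.lintegral_comp_emb (MeasurableEquiv.measurableEmbedding _)]
  refine lintegral_congr fun k => ?_
  congr 1
  funext j
  obtain ⟨i, rfl⟩ := π.surjective j
  rw [MeasurableEquiv.coe_piCongrLeft, Equiv.piCongrLeft_apply_apply, Equiv.symm_apply_apply]

end Ladder

/-! ### Momenta and energies along a history -/

section Momenta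

variable {d n : ℕ}

lemma filter_castSucc_le (l : Fin n) :
    Finset.univ.filter (fun i : Fin n => (l.castSucc : ℕ) ≤ (i : ℕ)) =
      insert l (Finset.univ.filter fun i : Fin n => (l.succ : ℕ) ≤ (i : ℕ)) := by
  ext i
  simp only [Finset.mem_filter, Finset.mem_univ, true_and, Finset.mem_insert, Fin.ext_iff,
    Fin.val_castSucc, Fin.val_succ]
  omega

lemma electronMom_castSucc (p : Mom d) (k : Fin n → Mom d) (l : Fin n) :
    electronMom p k l.castSucc = k l + electronMom p k l.succ := by
  rw [electronMom, filter_castSucc_le, Finset.sum_insert (by simp), electronMom]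
  abel

lemma phononEnergy_castSucc (ω : Mom d → ℝ) (k : Fin n → Mom d) (σ : Fin n → ℤˣ) (l : Fin n) :
    phononEnergy ω k σ l.castSucc = sgn (σ l) * ω (k l) + phononEnergy ω k σ l.succ := by
  rw [phononEnergy, filter_castSucc_le, Finset.sum_insert (by simp), phononEnergy]

lemma electronMom_last (p : Mom d) (k : Fin n → Mom d) : electronMom p k (Fin.last n) = p := by
  rw [electronMom, Finset.filter_false_of_mem (fun i _ => by simp), Finset.sum_empty, add_zero]

lemma phononEnergy_last (ω : Mom d → ℝ) (k : Fin n → Mom d) (σ : Fin n → ℤˣ) :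
    phononEnergy ω k σ (Fin.last n) = 0 := by
  rw [phononEnergy, Finset.filter_false_of_mem (fun i _ => by simp), Finset.sum_empty]

lemma electronMom_congr (p : Mom d) {k k' : Fin n → Mom d} (j : Fin (n + 1))
    (h : ∀ l : Fin n, (j : ℕ) ≤ (l : ℕ) → k l = k' l) : electronMom p k j = electronMom p k' j := by
  unfold electronMom
  congr 1
  exact Finset.sum_congr rfl fun l hl => h l (Finset.mem_filter.1 hl).2

lemma phononEnergy_congr (ω : Mom d → ℝ) {k k' : Fin n → Mom d} {σ σ' : Fin n → ℤˣ}
    (j : Fin (n + 1)) (h : ∀ l : Fin n, (j : ℕ) ≤ (l : ℕ) → k l = k' l)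
    (h' : ∀ l : Fin n, (j : ℕ) ≤ (l : ℕ) → σ l = σ' l) :
    phononEnergy ω k σ j = phononEnergy ω k' σ' j := by
  unfold phononEnergy
  refine Finset.sum_congr rfl fun l hl => ?_
  have := (Finset.mem_filter.1 hl).2
  rw [h l this, h' l this]

/-- The energy `e(p_j) + Ω_j`. -/
def energy (e ω : Mom d → ℝ) (p : Mom d) (k : Fin n → Mom d) (σ : Fin n → ℤˣ)
    (j : Fin (n + 1)) : ℝ :=
  e (electronMom p k j) + phononEnergy ω k σ j

variable {e ω : Mom d → ℝ}

/-- This form isolates `k l`: everything else depends on momenta of larger index only. Hence the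
bounds in `PropagatorBounds` apply to the integral over `k l`, with the shift of energy absorbed in
`θ`. -/
lemma energy_castSucc (p : Mom d) (k : Fin n → Mom d) (σ : Fin n → ℤˣ) (l : Fin n) :
    energy e ω p k σ l.castSucc =
      Phi e ω (σ l) (electronMom p k l.succ) (k l) + phononEnergy ω k σ l.succ := by
  rw [energy, electronMom_castSucc, phononEnergy_castSucc, Phi]
  ring

lemma energy_last (p : Mom d) (k : Fin n → Mom d) (σ : Fin n → ℤˣ) :
    energy e ω p k σ (Fin.last n) = e p := by
  rw [energy, electronMom_last, phononEnergy_last, add_zero]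

lemma energy_congr (p : Mom d) {k k' : Fin n → Mom d} {σ σ' : Fin n → ℤˣ}
    (j : Fin (n + 1)) (h : ∀ l : Fin n, (j : ℕ) ≤ (l : ℕ) → k l = k' l)
    (h' : ∀ l : Fin n, (j : ℕ) ≤ (l : ℕ) → σ l = σ' l) :
    energy e ω p k σ j = energy e ω p k' σ' j := by
  rw [energy, energy, electronMom_congr p j h, phononEnergy_congr ω j h h']

lemma continuous_electronMom (j : Fin (n + 1)) :
    Continuous fun x : Mom d × (Fin n → Mom d) => electronMom x.1 x.2 j := by
  unfold electronMom; fun_prop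

lemma continuous_phononEnergy (hω : Continuous ω) (σ : Fin n → ℤˣ) (j : Fin (n + 1)) :
    Continuous fun k : Fin n → Mom d => phononEnergy ω k σ j := by
  unfold phononEnergy; fun_prop

lemma continuous_energy (he : Continuous e) (hω : Continuous ω) (p : Mom d) (σ : Fin n → ℤˣ)
    (j : Fin (n + 1)) : Continuous fun k : Fin n → Mom d => energy e ω p k σ j := by
  have h1 : Continuous fun k : Fin n → Mom d => electronMom p k j :=
    (continuous_electronMom j).comp (by fun_prop : Continuous fun k : Fin n → Mom d => (p, k))
  exact (he.comp h1).add (continuous_phononEnergy hω σ j)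

end Momenta

/-! ### The crossing estimate for fixed energies -/

section Crossing

lemma prod_ite_or {n : ℕ} {a r : Fin n} (har : a ≠ r) (f g : Fin n → ℝ≥0∞) :
    ∏ l, (if l = a ∨ l = r then f l else g l) =
      f a * f r * ∏ l, (if l = a ∨ l = r then 1 else g l) := by
  have h : ∀ l, (if l = a ∨ l = r then f l else g l) =
      (if l = a then f a else 1) * (if l = r then f r else 1) *
        (if l = a ∨ l = r then 1 else g l) := by
    intro l
    by_cases h1 : l = a
    · subst h1; simp [har]
    · by_cases h2 : l = r
      · subst h2; simp [h1]
      · simp [h1, h2]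
  rw [Finset.prod_congr rfl fun l _ => h l, Finset.prod_mul_distrib, Finset.prod_mul_distrib]
  simp

/-- The product of the propagators `R_l`, all squared except for those with index `a` and `r`. -/
def ladderProd {n : ℕ} (a r : Fin n) (R : Fin n → ℝ≥0∞) : ℝ≥0∞ :=
  ∏ l, if l = a ∨ l = r then R l else R l ^ 2

/-- Schwarz inequality decoupling the two histories. -/
lemma prod_mul_prod_le {n : ℕ} {a b r : Fin n} (har : a ≠ r) (hbr : b ≠ r) {R R' : Fin n → ℝ≥0∞}
    {T : ℝ≥0∞} (hR : ∀ l, R l ≤ T) (hR' : ∀ l, R' l ≤ T) :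
    (∏ l, R l) * ∏ l, R' l ≤
      T * (ladderProd a r R * R' r) + T * (ladderProd b r R' * R r) := by
  set x := ∏ l, (if l = a ∨ l = r then 1 else R l) with hx
  set y := ∏ l, (if l = b ∨ l = r then 1 else R' l) with hy
  have h1 : ∏ l, R l = R a * R r * x := by
    rw [hx, ← prod_ite_or har]; simp
  have h2 : ∏ l, R' l = R' b * R' r * y := by
    rw [hy, ← prod_ite_or hbr]; simp
  have h3 : ladderProd a r R = R a * R r * x ^ 2 := by
    rw [ladderProd, prod_ite_or har, hx, ← Finset.prod_pow]
    congr 1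
    exact Finset.prod_congr rfl fun l _ => by split_ifs <;> simp
  have h4 : ladderProd b r R' = R' b * R' r * y ^ 2 := by
    rw [ladderProd, prod_ite_or hbr, hy, ← Finset.prod_pow]
    congr 1
    exact Finset.prod_congr rfl fun l _ => by split_ifs <;> simp
  have h5 : x * y ≤ x ^ 2 + y ^ 2 := by
    rcases le_total x y with h | h
    · exact (mul_le_mul_left h y).trans (by rw [← sq]; exact le_add_self)
    · exact (mul_le_mul_right h x).trans (by rw [← sq]; exact le_self_add)
  calc (∏ l, R l) * ∏ l, R' l = (R a * R r * R' b * R' r) * (x * y) := by rw [h1, h2]; ring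
    _ ≤ (R a * R r * R' b * R' r) * (x ^ 2 + y ^ 2) := by gcongr
    _ = R' b * (R a * R r * x ^ 2 * R' r) + R a * (R' b * R' r * y ^ 2 * R r) := by ring
    _ ≤ T * (R a * R r * x ^ 2 * R' r) + T * (R' b * R' r * y ^ 2 * R r) := by
        gcongr
        · exact hR' b
        · exact hR a
    _ = _ := by rw [h3, h4]

variable {d n : ℕ} {K ρ C₅ B t : ℝ} {e ω : Mom d → ℝ} {M : Mom d → ℤˣ → ℝ}

lemma Regular.isFiniteMeasure_vtx (H : Regular d K ρ C₅ e ω M) (σ : ℤˣ) :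
    IsFiniteMeasure (vtx M σ) :=
  ⟨(H.vtx_univ_le σ).trans_lt ENNReal.ofReal_lt_top⟩

-- Integration in the order `k_0, k_1, …`. Apart from the momenta beyond `r`, the extra propagator
-- contains only `k_a`, so at the step `a` two propagators are integrated together. The resulting
-- singularity in the difference of momenta `k_{a+1} + ⋯ + k_r` is handed on to the next variable.
set_option maxHeartbeats 1000000 in
lemma Regular.lintegral_ladderProd_le (H : Regular d K ρ C₅ e ω M) (ht : 1 ≤ t) (hB : 1 ≤ B)
    (P : PropagatorBounds B t e ω M) (p : Mom d) (σ : Fin n → ℤˣ) (α α' : ℝ) {a r : Fin n}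
    (har : a < r) :
    ∫⁻ k, ladderProd a r (fun l => eres t (α - energy e ω p k σ l.castSucc)) *
        eres t (α' - (Phi e ω (σ a) (electronMom p k r.succ) (k a) + phononEnergy ω k σ r.succ))
        ∂(Measure.pi fun j => vtx M (σ j))
      ≤ ENNReal.ofReal (B ^ n * (t ^ n * t ^ (-(8 / 5) : ℝ)) * lg t ^ 3) := by
  have ht0 : 0 < t := by linarith
  have hlg := one_le_lg ht
  have hfin := H.isFiniteMeasure_vtx
  have hb' : (a : ℕ) + 1 < n := by have := r.2; have : (a : ℕ) < r := har; omega
  set b : Fin n := ⟨a + 1, hb'⟩ with hb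
  have hab : a < b := by rw [hb, Fin.lt_def]; simp
  have hbr : b ≤ r := by rw [hb, Fin.le_def]; exact har
  have hasucc : a.succ = b.castSucc := by ext; simp [hb]
  -- The handing on is done by inserting `W⁻¹` at the index `a` and `W` at `b = a + 1`. For the
  -- integral over `k_a` the factor `W` is a constant and cancels the output of `two_le`; for that
  -- over `k_b` it is the shifted singularity of `sq_sing_le` or `one_sing_le`.
  set W : (Fin n → Mom d) → ℝ≥0∞ := fun k =>
    1 + eres t ‖electronMom p k a.succ - electronMom p k r.succ‖ with hW
  have hW0 : ∀ k, W k ≠ 0 := fun k => by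
    have : (1 : ℝ≥0∞) ≤ W k := le_self_add
    exact (lt_of_lt_of_le one_pos this).ne'
  have hWt : ∀ k, W k ≠ ∞ := fun k => ENNReal.add_ne_top.2 ⟨by simp, ENNReal.ofReal_ne_top⟩
  set R : Fin n → (Fin n → Mom d) → ℝ≥0∞ := fun l k =>
    eres t (α - energy e ω p k σ l.castSucc) with hR
  set Z : (Fin n → Mom d) → ℝ≥0∞ := fun k =>
    eres t (α' - (Phi e ω (σ a) (electronMom p k r.succ) (k a) + phononEnergy ω k σ r.succ)) with hZ
  set G : Fin n → (Fin n → Mom d) → ℝ≥0∞ := fun l k =>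
    (if l = a ∨ l = r then R l k else R l k ^ 2) * (if l = a then Z k * (W k)⁻¹ else 1) *
      (if l = b then W k else 1) with hG
  have hprod : ∀ k, ladderProd a r (fun l => R l k) * Z k = ∏ l, G l k := fun k => by
    simp only [hG]
    rw [Finset.prod_mul_distrib, Finset.prod_mul_distrib, Finset.prod_ite_eq', Finset.prod_ite_eq',
      if_pos (Finset.mem_univ _), if_pos (Finset.mem_univ _), ladderProd, mul_assoc, mul_assoc,
      ENNReal.inv_mul_cancel (hW0 k) (hWt k), mul_one]
  have mmom : ∀ j, Continuous fun k : Fin n → Mom d => electronMom p k j := fun j =>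
    (continuous_electronMom j).comp (by fun_prop : Continuous fun k : Fin n → Mom d => (p, k))
  have men := continuous_phononEnergy (n := n) H.ω_cont σ
  have mR : ∀ l, Measurable (R l) := fun l =>
    (measurable_eres ht0).comp
      (continuous_const.sub (continuous_energy H.e_cont H.ω_cont p σ _)).measurable
  have mW : Measurable W :=
    measurable_const.add ((measurable_eres ht0).comp ((mmom _).sub (mmom _)).norm.measurable)
  have mZ : Measurable Z := by
    refine (measurable_eres ht0).comp (Continuous.measurable ?_)
    have h1 := H.e_cont
    have h2 := H.ω_cont
    have h3 := mmom r.succ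
    have h4 := men r.succ
    unfold Phi
    fun_prop
  have mG : ∀ l, Measurable (G l) := fun l => by
    simp only [hG]
    refine Measurable.mul (Measurable.mul ?_ ?_) ?_
    · split_ifs
      · exact mR l
      · exact (mR l).pow_const 2
    · split_ifs
      · exact mZ.mul mW.inv
      · exact measurable_const
    · split_ifs
      · exact mW
      · exact measurable_const
  -- The budget: `Bt` for a squared propagator, a logarithmic bound at `a`, an extra `t^{2/5}` at
  -- `b`, and `t` replaced by a logarithm at `r`. The factors are multiplicative, so the case `b =
  -- r` needs no separate count: the product is always `t^{n - 2 + 2/5}`.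
  set c : Fin n → ℝ := fun l => B * t * (if l = a then t⁻¹ * lg t ^ 2 else 1) *
    (if l = b then t ^ (2 / 5 : ℝ) else 1) * (if l = r then t⁻¹ * lg t else 1) with hc
  have hc0 : ∀ l, 0 ≤ c l := fun l => by
    simp only [hc]
    refine mul_nonneg (mul_nonneg (by positivity) ?_) ?_ |> fun h => mul_nonneg h ?_ <;>
      split_ifs <;> positivity
  have hcprod : ∏ l, ENNReal.ofReal (c l) =
      ENNReal.ofReal (B ^ n * (t ^ n * t ^ (-(8 / 5) : ℝ)) * lg t ^ 3) := by
    rw [← ENNReal.ofReal_prod_of_nonneg fun l _ => hc0 l]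
    congr 1
    simp only [hc, Finset.prod_mul_distrib, Finset.prod_ite_eq', Finset.mem_univ, if_true,
      Finset.prod_const, Finset.card_univ, Fintype.card_fin]
    have h1 : t⁻¹ * t ^ (2 / 5 : ℝ) * t⁻¹ = t ^ (-(8 / 5) : ℝ) := by
      rw [← Real.rpow_neg_one, ← Real.rpow_add ht0, ← Real.rpow_add ht0]; norm_num
    rw [← h1]; ring
  simp only [hR, hZ] at hprod
  simp only [hprod]
  rw [← hcprod]
  have eupd : ∀ (k : Fin n → Mom d) (l : Fin n) (z : Mom d) (j : Fin (n + 1)), (l : ℕ) < j →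
      electronMom p (Function.update k l z) j = electronMom p k j := fun k l z j hj =>
    electronMom_congr p j fun i hi => Function.update_of_ne
      (by rintro rfl; omega) _ _
  have oupd : ∀ (k : Fin n → Mom d) (l : Fin n) (z : Mom d) (j : Fin (n + 1)), (l : ℕ) < j →
      phononEnergy ω (Function.update k l z) σ j = phononEnergy ω k σ j := fun k l z j hj =>
    phononEnergy_congr ω j (fun i hi => Function.update_of_ne
      (by rintro rfl; omega) _ _) fun _ _ => rfl
  have hsucc : ∀ l : Fin n, (l : ℕ) < (l.succ : Fin (n + 1)) := fun l => by simp
  have har' : (a : ℕ) < (r.succ : Fin (n + 1)) := by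
    have : (a : ℕ) < r := har
    simp; omega
  have hbr' : (b : ℕ) < (r.succ : Fin (n + 1)) := by
    have : (b : ℕ) ≤ r := hbr
    simp; omega
  have Rupd : ∀ k (l : Fin n) z, R l (Function.update k l z) =
      eres t ((α - phononEnergy ω k σ l.succ) -
        Phi e ω (σ l) (electronMom p k l.succ) z) := fun k l z => by
    simp only [hR]
    rw [energy_castSucc, eupd _ _ _ _ (hsucc l), oupd _ _ _ _ (hsucc l), Function.update_self]
    congr 1; ring
  refine lintegral_pi_prod_le _ G _ mG (fun l x y hxy => ?_) fun l k => ?_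
  · have hRl : R l x = R l y := by
      simp only [hR]
      rw [energy_congr p l.castSucc (fun i hi => hxy i hi) fun _ _ => rfl]
    simp only [hG, hRl]
    by_cases hla : l = a
    · subst hla
      have hlb : l ≠ b := hab.ne
      have hZ' : Z x = Z y := by
        simp only [hZ]
        rw [electronMom_congr p r.succ (fun i hi => hxy i (by rw [Fin.le_def]; omega)),
          phononEnergy_congr ω r.succ (fun i hi => hxy i (by rw [Fin.le_def]; omega))
            (fun _ _ => rfl), hxy l le_rfl]
      have hW' : W x = W y := by
        simp only [hW]
        rw [electronMom_congr p r.succ (fun i hi => hxy i (by rw [Fin.le_def]; omega)),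
          electronMom_congr p l.succ (fun i hi => hxy i (by
            rw [Fin.le_def]; have := hsucc l; omega))]
      simp only [hlb, hZ', hW', if_true, if_false]
    · by_cases hlb : l = b
      · have hW' : W x = W y := by
          simp only [hW]
          rw [electronMom_congr p r.succ (fun i hi => hxy i (by rw [Fin.le_def, hlb]; omega)),
            electronMom_congr p a.succ (fun i hi => hxy i (by
              rw [Fin.le_def, hlb, hb]; simpa using hi))]
        rw [if_neg hla, if_neg hla, hW']
      · simp [hla, hlb]
  · simp only [hG, Rupd]
    by_cases hla : l = a
    · subst hla
      have hlb : l ≠ b := hab.ne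
      have hlr : l ≠ r := har.ne
      simp only [hc, if_true, true_or, hlb, hlr, if_false, mul_one]
      have hZ' : ∀ z, Z (Function.update k l z) = eres t ((α' - phononEnergy ω k σ r.succ) -
          Phi e ω (σ l) (electronMom p k r.succ) z) := fun z => by
        simp only [hZ]
        rw [eupd _ _ _ _ har', oupd _ _ _ _ har', Function.update_self]
        congr 1; ring
      have hW' : ∀ z, W (Function.update k l z) = W k := fun z => by
        simp only [hW]
        rw [eupd _ _ _ _ har', eupd _ _ _ _ (hsucc l)]
      simp only [hZ', hW', ← mul_assoc]
      rw [lintegral_mul_const (f := fun z => eres t (α - phononEnergy ω k σ l.succ -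
          Phi e ω (σ l) (electronMom p k l.succ) z) * eres t (α' - phononEnergy ω k σ r.succ -
          Phi e ω (σ l) (electronMom p k r.succ) z)) _ (((measurable_eres ht0).comp (H.measurable_arg _ _ _)).mul
        ((measurable_eres ht0).comp (H.measurable_arg _ _ _)))]
      calc _ ≤ ENNReal.ofReal (B * lg t ^ 2) * W k * (W k)⁻¹ := by
            gcongr
            exact P.two_le _ _ _ _ _
        _ = ENNReal.ofReal (B * lg t ^ 2) := by
            rw [mul_assoc, ENNReal.mul_inv_cancel (hW0 k) (hWt k), mul_one]
        _ = _ := by congr 1; field_simp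
    · by_cases hlb : l = b
      · subst hlb
        have hW' : ∀ z, W (Function.update k b z) =
            1 + eres t ‖z + (electronMom p k b.succ - electronMom p k r.succ)‖ := fun z => by
          simp only [hW]
          rw [hasucc, electronMom_castSucc, eupd _ _ _ _ hbr', eupd _ _ _ _ (hsucc b),
            Function.update_self, add_sub_assoc]
        by_cases hlr : b = r
        · simp only [hc, hla, ← hlr, if_true, or_true, if_false, mul_one, hW']
          refine (P.one_sing_le _ _ _ _).trans (le_of_eq ?_)
          congr 1; field_simp
        · simp only [hc, hla, hlr, if_true, or_self, if_false, mul_one, hW']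
          refine (P.sq_sing_le _ _ _ _).trans (le_of_eq ?_)
          have h1 : t * t ^ (2 / 5 : ℝ) = t ^ (7 / 5 : ℝ) := by
            rw [← Real.rpow_one_add' ht0.le (by norm_num)]; norm_num
          rw [← h1]
          congr 1; ring
      · by_cases hlr : l = r
        · simp only [hc, hlr, if_true, or_true]
          rw [← hlr]
          simp only [hla, hlb, if_false, mul_one]
          refine (P.one_le _ _ _).trans (le_of_eq ?_)
          congr 1; field_simp
        · simp only [hc, hla, hlb, hlr, or_self, if_false, mul_one]
          exact P.sq_le _ _ _

end Crossing

end PhononBoltzmann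

end

/-! ### The crossing estimate for a permutation different from the identity -/

noncomputable section

namespace PhononBoltzmann

section Crossing

variable {d n : ℕ} {K ρ C₅ B t : ℝ} {e ω : Mom d → ℝ} {M : Mom d → ℤˣ → ℝ}

/-- The largest element of the support. Its image and preimage are moved too, hence smaller; larger
indices are fixed, so that both histories agree beyond `r`. -/
lemma exists_max_nonfixed {π : Equiv.Perm (Fin n)} (hπ : π ≠ 1) :
    ∃ r : Fin n, π.symm r < r ∧ π r < r ∧ ∀ l, r < l → π.symm l = l := by
  have hne : π.support.Nonempty :=
    Finset.nonempty_iff_ne_empty.2 fun h => hπ (Equiv.Perm.support_eq_empty_iff.1 h)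
  set r := π.support.max' hne with hr
  have hrm : π r ≠ r := Equiv.Perm.mem_support.1 (Finset.max'_mem _ hne)
  have hle : ∀ l, π l ≠ l → l ≤ r := fun l hl =>
    Finset.le_max' _ _ (Equiv.Perm.mem_support.2 hl)
  refine ⟨r, lt_of_le_of_ne (hle _ ?_) ?_, lt_of_le_of_ne (hle _ ?_) hrm, fun l hl => ?_⟩
  · rw [Equiv.apply_symm_apply]
    exact fun h => hrm (by conv_lhs => rw [h]; simp)
  · exact fun h => hrm (by conv_lhs => rw [← h]; simp)
  · exact fun h => hrm (π.injective h)
  · by_contra h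
    refine absurd (hle l fun h' => h ?_) (not_le.2 hl)
    conv_lhs => rw [← h']
    simp

lemma Regular.continuous_energy' (H : Regular d K ρ C₅ e ω M) (p : Mom d) (σ : Fin n → ℤˣ)
    (j : Fin (n + 1)) : Continuous fun k : Fin n → Mom d => energy e ω p k σ j :=
  continuous_energy H.e_cont H.ω_cont p σ j

/-- The Schwarz step spends one factor `t` and gives two ladders, with distinguished indices `π⁻¹ r`
and `π r`. Since the momenta beyond `r` coincide, the surviving `r`-th propagator of either history
takes the form required in `lintegral_ladderProd_le` for the other. -/
lemma Regular.lintegral_crossing_le (H : Regular d K ρ C₅ e ω M) (ht : 1 ≤ t) (hB : 1 ≤ B)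
    (P : PropagatorBounds B t e ω M) (p : Mom d) (σ : Fin n → ℤˣ) (α α' : ℝ)
    {π : Equiv.Perm (Fin n)} (hπ : π ≠ 1) :
    ∫⁻ k, (∏ l : Fin n, eres t (α - energy e ω p k σ l.castSucc)) *
        ∏ l : Fin n, eres t (α' - energy e ω p (fun j => k (π.symm j))
          (fun j => σ (π.symm j)) l.castSucc)
        ∂(Measure.pi fun j => vtx M (σ j))
      ≤ 2 * ENNReal.ofReal (t * (B ^ n * (t ^ n * t ^ (-(8 / 5) : ℝ)) * lg t ^ 3)) := by
  have ht0 : 0 < t := by linarith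
  have hfin := H.isFiniteMeasure_vtx
  obtain ⟨r, ha, hb, hfix⟩ := exists_max_nonfixed hπ
  set σ' : Fin n → ℤˣ := fun j => σ (π.symm j) with hσ'
  have hmom : ∀ k : Fin n → Mom d,
      electronMom p (fun j => k (π.symm j)) r.succ = electronMom p k r.succ := fun k =>
    electronMom_congr p _ fun l hl => by
      rw [hfix l (by rw [Fin.lt_def]; simp at hl; omega)]
  have hpho : ∀ k : Fin n → Mom d,
      phononEnergy ω (fun j => k (π.symm j)) σ' r.succ = phononEnergy ω k σ r.succ := fun k =>
    phononEnergy_congr ω _ (fun l hl => by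
      rw [hfix l (by rw [Fin.lt_def]; simp at hl; omega)]) fun l hl => by
      rw [hσ']; simp only; rw [hfix l (by rw [Fin.lt_def]; simp at hl; omega)]
  set F : ℝ → ℝ → (Fin n → ℤˣ) → Fin n → (Fin n → Mom d) → ℝ≥0∞ := fun α α' σ a k =>
    ladderProd a r (fun l => eres t (α - energy e ω p k σ l.castSucc)) *
        eres t (α' - (Phi e ω (σ a) (electronMom p k r.succ) (k a) + phononEnergy ω k σ r.succ))
    with hF
  have h1 : ∀ k : Fin n → Mom d, (∏ l : Fin n, eres t (α - energy e ω p k σ l.castSucc)) *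
        ∏ l : Fin n, eres t (α' - energy e ω p (fun j => k (π.symm j)) σ' l.castSucc) ≤
      ENNReal.ofReal t * F α α' σ (π.symm r) k +
        ENNReal.ofReal t * F α' α σ' (π r) (fun j => k (π.symm j)) := fun k => by
    refine (prod_mul_prod_le ha.ne hb.ne (fun l => eres_le ht0 _) fun l => eres_le ht0 _).trans
      (le_of_eq ?_)
    simp only [hF, hmom, hpho]
    rw [energy_castSucc p (fun j => k (π.symm j)), energy_castSucc p k, hmom, hpho]
    simp [hσ']
  have mF : ∀ α α' σ a, Measurable (F α α' σ a) := fun α α' σ a => by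
    refine Measurable.mul ?_ ((measurable_eres ht0).comp (Continuous.measurable ?_))
    · refine Finset.measurable_prod _ fun l _ => ?_
      have := (measurable_eres ht0).comp
        (continuous_const.sub (H.continuous_energy' p σ l.castSucc) :
          Continuous fun k : Fin n → Mom d => α - energy e ω p k σ l.castSucc).measurable
      split_ifs
      · exact this
      · exact this.pow_const 2
    · have h1 := H.e_cont
      have h2 := H.ω_cont
      have h3 : Continuous fun k : Fin n → Mom d => electronMom p k r.succ :=
        (continuous_electronMom _).comp (by fun_prop : Continuous fun k : Fin n → Mom d => (p, k))
      have h4 := continuous_phononEnergy (n := n) H.ω_cont σ r.succ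
      unfold Phi
      fun_prop
  have mperm : Measurable fun k : Fin n → Mom d => fun j => k (π.symm j) := by fun_prop
  have hT := ENNReal.ofReal_mul (p := t) ht0.le
    (q := B ^ n * (t ^ n * t ^ (-(8 / 5) : ℝ)) * lg t ^ 3)
  calc _ ≤ _ := lintegral_mono h1
    _ = ENNReal.ofReal t * (∫⁻ k, F α α' σ (π.symm r) k ∂(Measure.pi fun j => vtx M (σ j))) +
        ENNReal.ofReal t * ∫⁻ k, F α' α σ' (π r) k ∂(Measure.pi fun j => vtx M (σ' j)) := by
      rw [lintegral_add_left ((mF α α' σ _).const_mul _), lintegral_const_mul _ (mF α α' σ _),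
        lintegral_const_mul (f := fun k : Fin n → Mom d => F α' α σ' (π r) fun j => k (π.symm j)) _
          ((mF α' α σ' _).comp mperm),
        lintegral_pi_perm (fun j => vtx M (σ j)) π (F α' α σ' (π r))]
    _ ≤ _ := by
      rw [hT, two_mul]
      exact add_le_add
        (mul_le_mul_right (H.lintegral_ladderProd_le ht hB P p σ α α' ha) _)
        (mul_le_mul_right (H.lintegral_ladderProd_le ht hB P p σ' α' α hb) _)

end Crossing

/-! ### Integration over the energies -/

section Energies

variable {t T : ℝ}

/-- The primitive of the propagator is `arsinh (t(α - c))`, which grows logarithmically. -/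
lemma lintegral_Icc_eres_le (ht : 1 ≤ t) (hT : 1 ≤ T) (c : ℝ) :
    ∫⁻ α in Set.Icc (c - T) (c + T), eres t (α - c) ≤
      ENNReal.ofReal (4 + 2 * Real.log (T * t)) := by
  have ht0 : 0 < t := by linarith
  have hcont : Continuous fun α => res t (α - c) := (continuous_res ht0).comp (by fun_prop)
  have hder : ∀ α, HasDerivAt (fun α => Real.arsinh (t * (α - c))) (res t (α - c)) α := fun α => by
    have h1 : HasDerivAt (fun α => t * (α - c)) t α := by
      simpa using ((hasDerivAt_id α).sub_const c).const_mul t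
    convert h1.arsinh using 1
    rw [res, smul_eq_mul]
    have h2 : (α - c) ^ 2 + t⁻¹ ^ 2 = (1 + (t * (α - c)) ^ 2) / t ^ 2 := by field_simp; ring
    rw [h2, Real.sqrt_div' _ (by positivity), Real.sqrt_sq ht0.le]
    field_simp
  have hint : ∫ α in Set.Icc (c - T) (c + T), res t (α - c) = 2 * Real.arsinh (t * T) := by
    rw [integral_Icc_eq_integral_Ioc, ← intervalIntegral.integral_of_le (by linarith),
      intervalIntegral.integral_eq_sub_of_hasDerivAt (fun α _ => hder α)
        (hcont.intervalIntegrable _ _)]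
    rw [show t * (c + T - c) = t * T by ring, show t * (c - T - c) = -(t * T) by ring,
      Real.arsinh_neg]
    ring
  unfold eres
  rw [← ofReal_integral_eq_lintegral_ofReal
    (hcont.integrableOn_Icc) (ae_of_all _ fun α => (res_pos ht0 _).le), hint]
  refine ENNReal.ofReal_le_ofReal ?_
  have htT : 1 ≤ t * T := by nlinarith
  have h3 : Real.sqrt (1 + (t * T) ^ 2) ≤ 2 * (t * T) := by
    rw [Real.sqrt_le_left (by positivity)]; nlinarith
  have h4 : Real.arsinh (t * T) ≤ Real.log (3 * (t * T)) :=
    Real.log_le_log (by positivity) (by linarith)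
  rw [Real.log_mul (by norm_num) (by positivity), mul_comm t T] at h4
  have h5 : Real.log 3 ≤ 2 := by
    have := Real.log_le_sub_one_of_pos (show (0 : ℝ) < 3 by norm_num); linarith
  rw [mul_comm t T]
  linarith

/-- If `|x| ≤ 2H` the bound `res ≤ t` is enough; otherwise `|y| ≥ |x|/2`. Two propagators thus
provide the quadratic decay that makes the energy integral converge at infinity. -/
lemma res_mul_res_le (ht : 1 ≤ t) {x y H : ℝ} (hH : 1 ≤ H) (hxy : |x - y| ≤ H) (hx : 0 < |x|) :
    res t x * res t y ≤ 4 * H * t / x ^ 2 := by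
  have ht0 : 0 < t := by linarith
  have h1 : res t x ≤ |x|⁻¹ := res_le_inv hx
  have h2 : res t y ≤ 4 * H * t / |x| := by
    rw [le_div_iff₀ hx]
    by_cases h : |x| ≤ 2 * H
    · calc res t y * |x| ≤ t * (2 * H) :=
          mul_le_mul (res_le ht0 y) h (abs_nonneg x) ht0.le
        _ ≤ _ := by nlinarith
    · have hy : |x| / 2 ≤ |y| := by
        have := abs_sub_abs_le_abs_sub x y
        linarith
      have hy0 : 0 < |y| := by linarith
      calc res t y * |x| ≤ |y|⁻¹ * (2 * |y|) :=
          mul_le_mul (res_le_inv hy0) (by linarith) (abs_nonneg x) (by positivity)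
        _ = 2 := by field_simp
        _ ≤ _ := by nlinarith
  calc res t x * res t y ≤ |x|⁻¹ * (4 * H * t / |x|) :=
      mul_le_mul h1 h2 (res_pos ht0 y).le (by positivity)
    _ = _ := by rw [← sq_abs x]; field_simp

/-- For `|x| > T` one has `x⁻² ≤ 2/(T² + x²)`, a multiple of the Cauchy density of width `T`, whose
total integral is of order `1/T`. -/
lemma lintegral_tail_le (ht : 1 ≤ t) (hT : 1 ≤ T) {H : ℝ} (hH : 1 ≤ H) {c c' : ℝ}
    (hc : |c - c'| ≤ H) :
    ∫⁻ α in (Set.Icc (c - T) (c + T))ᶜ, eres t (α - c) * eres t (α - c') ≤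
      ENNReal.ofReal (32 * H * t / T) := by
  have ht0 : 0 < t := by linarith
  have hT0 : 0 < T := by linarith
  set f : ℝ → ℝ := fun x => 8 * H * t / T ^ 2 * (1 + (x / T) ^ 2)⁻¹ with hf
  have hint : Integrable f := (integrable_inv_one_add_sq.comp_div hT0.ne').const_mul _
  have hval : ∫ x, f x = 8 * H * t * Real.pi / T := by
    rw [hf, integral_const_mul, Measure.integral_comp_div (fun x : ℝ => (1 + x ^ 2)⁻¹),
      integral_univ_inv_one_add_sq, abs_of_pos hT0, smul_eq_mul]
    field_simp
  calc ∫⁻ α in (Set.Icc (c - T) (c + T))ᶜ, eres t (α - c) * eres t (α - c')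
      ≤ ∫⁻ α in (Set.Icc (c - T) (c + T))ᶜ, ENNReal.ofReal (f (α - c)) := by
        refine setLIntegral_mono' measurableSet_Icc.compl fun α hα => ?_
        have hx : T < |α - c| := by
          by_contra h
          rw [not_lt, abs_le] at h
          exact hα ⟨by linarith, by linarith⟩
        unfold eres
        rw [← ENNReal.ofReal_mul (res_pos ht0 _).le]
        refine ENNReal.ofReal_le_ofReal ?_
        refine (res_mul_res_le ht hH (by rw [show α - c - (α - c') = -(c - c') by ring, abs_neg]; exact hc)
          (hT0.trans hx)).trans ?_
        have h1 : T ^ 2 ≤ (α - c) ^ 2 := by rw [← sq_abs (α - c)]; gcongr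
        have h2 : 0 < (α - c) ^ 2 := lt_of_lt_of_le (by positivity) h1
        rw [hf]
        simp only
        rw [div_eq_mul_inv, show 8 * H * t / T ^ 2 * (1 + ((α - c) / T) ^ 2)⁻¹ =
          4 * H * t * (2 * (T ^ 2 + (α - c) ^ 2)⁻¹) by field_simp; ring]
        gcongr
        rw [inv_eq_one_div, ← div_eq_mul_inv, div_le_div_iff₀ h2 (by positivity)]
        linarith
    _ ≤ ∫⁻ α, ENNReal.ofReal (f (α - c)) := setLIntegral_le_lintegral _ _
    _ = ∫⁻ α, ENNReal.ofReal (f α) :=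
        lintegral_sub_right_eq_self (fun x => ENNReal.ofReal (f x)) c
    _ = ENNReal.ofReal (8 * H * t * Real.pi / T) := by
        rw [← ofReal_integral_eq_lintegral_ofReal hint (ae_of_all _ fun x => by
          rw [hf]; positivity), hval]
    _ ≤ _ := by
        refine ENNReal.ofReal_le_ofReal ?_
        have := Real.pi_le_four
        have h3 : 0 ≤ H * t := by positivity
        exact div_le_div_of_nonneg_right (by nlinarith) hT0.le

/-- The resolvent integral of a history with `n` collisions. -/
def resolventIntegral {n : ℕ} (t : ℝ) (E : Fin (n + 1) → ℝ) : ℝ≥0∞ :=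
  ∫⁻ α, ∏ j, eres t (α - E j)

/-- The part of the resolvent integral with energy close to the energy of the last propagator. -/
def resolventIntegralNear {n : ℕ} (t T : ℝ) (E : Fin (n + 1) → ℝ) : ℝ≥0∞ :=
  ∫⁻ α in Set.Icc (E (Fin.last n) - T) (E (Fin.last n) + T), ∏ j, eres t (α - E j)

variable {n : ℕ}

lemma prod_eres_le (ht : 0 < t) {ι : Type*} (s : Finset ι) (E : ι → ℝ) :
    ∏ j ∈ s, eres t (E j) ≤ ENNReal.ofReal (t ^ s.card) := by
  rw [ENNReal.ofReal_pow ht.le, ← Finset.prod_const]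
  exact Finset.prod_le_prod' fun j _ => eres_le ht _

lemma measurable_eres_sub (ht : 0 < t) (c : ℝ) : Measurable fun α => eres t (α - c) :=
  (measurable_eres ht).comp (measurable_id.sub_const c)

lemma resolventIntegralNear_le (ht : 1 ≤ t) (hT : 1 ≤ T) (E : Fin (n + 1) → ℝ) :
    resolventIntegralNear t T E ≤ ENNReal.ofReal (t ^ n * (4 + 2 * Real.log (T * t))) := by
  have ht0 : 0 < t := by linarith
  rw [ENNReal.ofReal_mul (by positivity)]
  calc _ ≤ ∫⁻ α in Set.Icc (E (Fin.last n) - T) (E (Fin.last n) + T),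
        ENNReal.ofReal (t ^ n) * eres t (α - E (Fin.last n)) := by
        refine lintegral_mono fun α => ?_
        simp only
        rw [Fin.prod_univ_castSucc]
        gcongr
        simpa using prod_eres_le ht0 Finset.univ fun l : Fin n => α - E l.castSucc
    _ ≤ _ := by
        rw [lintegral_const_mul _ (measurable_eres_sub ht0 _)]
        gcongr
        exact lintegral_Icc_eres_le ht hT _

/-- In the tail the last two propagators give the decay and the remaining `n` are bounded by `t`.
The last two energies differ by the effect of a single momentum, so `H` is polynomial in the
brackets of two momenta (`Regular.abs_energy_sub_le`). -/
lemma resolventIntegral_le (ht : 1 ≤ t) (hT : 1 ≤ T) (E : Fin (n + 1 + 1) → ℝ) {H : ℝ} (hH : 1 ≤ H)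
    (hE : |E (Fin.last (n + 1)) - E (Fin.last n).castSucc| ≤ H) :
    resolventIntegral t E ≤
      resolventIntegralNear t T E + ENNReal.ofReal (32 * H * t ^ (n + 1) / T) := by
  have ht0 : 0 < t := by linarith
  rw [resolventIntegral, ← lintegral_add_compl _ (measurableSet_Icc
    (a := E (Fin.last (n + 1)) - T) (b := E (Fin.last (n + 1)) + T))]
  refine add_le_add le_rfl ?_
  rw [show 32 * H * t ^ (n + 1) / T = t ^ n * (32 * H * t / T) by ring,
    ENNReal.ofReal_mul (by positivity)]
  calc _ ≤ ∫⁻ α in (Set.Icc (E (Fin.last (n + 1)) - T) (E (Fin.last (n + 1)) + T))ᶜ,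
        ENNReal.ofReal (t ^ n) * (eres t (α - E (Fin.last (n + 1))) *
          eres t (α - E (Fin.last n).castSucc)) := by
        refine lintegral_mono fun α => ?_
        simp only
        rw [Fin.prod_univ_castSucc, Fin.prod_univ_castSucc, mul_assoc,
          mul_comm (eres t (α - E (Fin.last (n + 1))))]
        gcongr
        simpa using prod_eres_le ht0 Finset.univ fun l : Fin n => α - E l.castSucc.castSucc
    _ ≤ _ := by
        rw [lintegral_const_mul (f := fun α => eres t (α - E (Fin.last (n + 1))) *
          eres t (α - E (Fin.last n).castSucc)) _
          ((measurable_eres_sub ht0 _).mul (measurable_eres_sub ht0 _))]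
        gcongr
        exact lintegral_tail_le ht hT hH hE

end Energies

/-! ### Momentum and energy integrals combined -/

section Crossing

variable {d n : ℕ} {K ρ C₅ B t T : ℝ} {e ω : Mom d → ℝ} {M : Mom d → ℤˣ → ℝ}

lemma Regular.measurable_eres_energy (H : Regular d K ρ C₅ e ω M) (ht : 0 < t) (p : Mom d)
    (σ : Fin n → ℤˣ) (j : Fin (n + 1)) :
    Measurable fun x : (Fin n → Mom d) × ℝ => eres t (x.2 - energy e ω p x.1 σ j) :=
  (measurable_eres ht).comp (continuous_snd.sub
    ((H.continuous_energy' p σ j).comp continuous_fst)).measurable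

/-- Tonelli: the energies of the two histories are independent, so the momenta can be integrated
first at fixed `α`, `α'`, which is how the crossing estimate is stated. -/
lemma lintegral_lintegral_mul_lintegral_le {X : Type*} [MeasurableSpace X] (ν : Measure X)
    [SFinite ν] (S : Measure ℝ) [SFinite S] {f f' : X × ℝ → ℝ≥0∞} (mf : Measurable f)
    (mf' : Measurable f') {g : ℝ → ℝ≥0∞} (mg : Measurable g) {D : ℝ≥0∞} (hD : D ≠ ∞)
    (h : ∀ α α', ∫⁻ k, f (k, α) * f' (k, α') ∂ν ≤ D * (g α * g α')) :
    ∫⁻ k, (∫⁻ α, f (k, α) ∂S) * (∫⁻ α, f' (k, α) ∂S) ∂ν ≤ D * (∫⁻ α, g α ∂S) ^ 2 := by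
  have h1 : ∀ k, (∫⁻ α, f (k, α) ∂S) * (∫⁻ α, f' (k, α) ∂S) =
      ∫⁻ z, f (k, z.1) * f' (k, z.2) ∂(S.prod S) := fun k =>
    (lintegral_prod_mul (f := fun α => f (k, α)) (g := fun α => f' (k, α))
      (mf.comp measurable_prodMk_left).aemeasurable
      (mf'.comp measurable_prodMk_left).aemeasurable).symm
  simp only [h1]
  rw [lintegral_lintegral_swap (f := fun k (z : ℝ × ℝ) => f (k, z.1) * f' (k, z.2))
    (Measurable.aemeasurable
    ((mf.comp (by fun_prop : Measurable fun x : X × (ℝ × ℝ) => (x.1, x.2.1))).mul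
     (mf'.comp (by fun_prop : Measurable fun x : X × (ℝ × ℝ) => (x.1, x.2.2)))))]
  calc _ ≤ ∫⁻ z, D * (g z.1 * g z.2) ∂(S.prod S) := lintegral_mono fun z => h z.1 z.2
    _ = _ := by
      rw [lintegral_const_mul' _ _ hD, lintegral_prod_mul mg.aemeasurable mg.aemeasurable, sq]

lemma Regular.lintegral_near_mul_near_le (H : Regular d K ρ C₅ e ω M) (ht : 1 ≤ t) (hT : 1 ≤ T)
    (hB : 1 ≤ B) (P : PropagatorBounds B t e ω M) (p : Mom d) (σ : Fin n → ℤˣ)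
    {π : Equiv.Perm (Fin n)} (hπ : π ≠ 1) :
    ∫⁻ k, resolventIntegralNear t T (energy e ω p k σ) *
        resolventIntegralNear t T (energy e ω p (fun j => k (π.symm j)) fun j => σ (π.symm j))
        ∂(Measure.pi fun j => vtx M (σ j))
      ≤ 2 * ENNReal.ofReal (t * (B ^ n * (t ^ n * t ^ (-(8 / 5) : ℝ)) * lg t ^ 3)) *
        ENNReal.ofReal ((4 + 2 * Real.log (T * t)) ^ 2) := by
  have ht0 : 0 < t := by linarith
  have hfin := H.isFiniteMeasure_vtx
  have hlog : 0 ≤ 4 + 2 * Real.log (T * t) := by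
    have := Real.log_nonneg (show 1 ≤ T * t by nlinarith)
    linarith
  have mf : ∀ σ, Measurable fun x : (Fin n → Mom d) × ℝ =>
      ∏ j, eres t (x.2 - energy e ω p x.1 σ j) := fun σ =>
    Finset.measurable_prod _ fun j _ => H.measurable_eres_energy ht0 p σ j
  have mperm : Measurable fun x : (Fin n → Mom d) × ℝ => ((fun j => x.1 (π.symm j)), x.2) := by
    fun_prop
  have key := lintegral_lintegral_mul_lintegral_le (Measure.pi fun j => vtx M (σ j))
    (volume.restrict (Set.Icc (e p - T) (e p + T))) (mf σ) ((mf fun j => σ (π.symm j)).comp mperm)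
    (measurable_eres_sub ht0 (e p))
    (D := 2 * ENNReal.ofReal (t * (B ^ n * (t ^ n * t ^ (-(8 / 5) : ℝ)) * lg t ^ 3)))
    (ENNReal.mul_ne_top (by simp) ENNReal.ofReal_ne_top) (fun α α' => ?_)
  · simp only [resolventIntegralNear, energy_last]
    refine key.trans ?_
    rw [ENNReal.ofReal_pow hlog]
    gcongr
    exact lintegral_Icc_eres_le ht hT _
  · refine le_trans ?_ (mul_le_mul_left (H.lintegral_crossing_le ht hB P p σ α α' hπ) _)
    rw [← lintegral_mul_const' (eres t (α - e p) * eres t (α' - e p)) _ (ENNReal.mul_ne_top ENNReal.ofReal_ne_top ENNReal.ofReal_ne_top)]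
    refine lintegral_mono fun k => le_of_eq ?_
    simp only [Fin.prod_univ_castSucc, energy_last, Function.comp_apply]
    ring

lemma bracket_add_sq_le (p k : Mom d) : bracket (k + p) ^ 2 ≤ 4 * (bracket p ^ 2 * bracket k ^ 2) := by
  have h1 : bracket (k + p) ≤ 2 * (bracket p * bracket k) := by
    have h2 := bracket_le_add (k + p) k
    have h3 := norm_le_bracket p
    have h4 := one_le_bracket p
    have h5 := one_le_bracket k
    rw [add_sub_cancel_left] at h2
    nlinarith
  calc bracket (k + p) ^ 2 ≤ (2 * (bracket p * bracket k)) ^ 2 := by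
        gcongr; exact (bracket_pos _).le
    _ = _ := by ring

lemma Regular.abs_energy_sub_le (H : Regular d K ρ C₅ e ω M) (p : Mom d)
    (k : Fin (n + 1) → Mom d) (σ : Fin (n + 1) → ℤˣ) :
    |energy e ω p k σ (Fin.last (n + 1)) - energy e ω p k σ (Fin.last n).castSucc| ≤
      6 * K * (bracket p ^ 2 * bracket (k (Fin.last n)) ^ 2) := by
  have hK := H.one_le
  set q := k (Fin.last n) with hq
  rw [energy_castSucc, energy_last, Fin.succ_last, electronMom_last, phononEnergy_last, Phi,
    add_zero, ← hq]
  have h1 := H.e_le p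
  have h2 := H.e_le (q + p)
  have h3 : |sgn (σ (Fin.last n)) * ω q| ≤ K * bracket q ^ 2 := by
    rw [abs_mul, abs_sgn, one_mul]; exact H.ω_le q
  have h4 := bracket_add_sq_le p q
  have h5 : 1 ≤ bracket p ^ 2 := one_le_pow₀ (one_le_bracket p)
  have h6 : 1 ≤ bracket q ^ 2 := one_le_pow₀ (one_le_bracket q)
  have h7 : bracket p ^ 2 + bracket (q + p) ^ 2 + bracket q ^ 2 ≤
      6 * (bracket p ^ 2 * bracket q ^ 2) := by nlinarith
  have h8 := mul_le_mul_of_nonneg_left h7 (by linarith : (0 : ℝ) ≤ K)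
  calc |e p - (e (q + p) + sgn (σ (Fin.last n)) * ω q)|
      ≤ |e p| + (|e (q + p)| + |sgn (σ (Fin.last n)) * ω q|) :=
        (abs_sub _ _).trans (by gcongr; exact abs_add_le _ _)
    _ ≤ _ := by linarith

/-- Three logarithms come from the ladder and two from the energy integrals. The constant arises
from `log t ≤ 50 t^{1/50}`. -/
lemma lg_pow_le (ht : 1 ≤ t) : lg t ^ 5 ≤ 51 ^ 5 * t ^ (1 / 10 : ℝ) := by
  have ht0 : 0 ≤ t := by linarith
  have h1 := Real.log_le_rpow_div ht0 (show (0 : ℝ) < 1 / 50 by norm_num)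
  have h2 : (1 : ℝ) ≤ t ^ (1 / 50 : ℝ) := Real.one_le_rpow ht (by norm_num)
  have h3 : lg t ≤ 51 * t ^ (1 / 50 : ℝ) := by unfold lg; linarith
  have h4 := one_le_lg ht
  calc lg t ^ 5 ≤ (51 * t ^ (1 / 50 : ℝ)) ^ 5 := by gcongr
    _ = _ := by
      rw [mul_pow, ← Real.rpow_natCast (t ^ (1 / 50 : ℝ)), ← Real.rpow_mul ht0]; norm_num

/-- The window of energies is a power of `t` with exponent linear in `n`, so its logarithm contains
a factor `n`. Bounding this by `2^{n+1}` lets the final constant absorb it as `C^N`. -/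
lemma add_two_le_three_mul_two_pow (n : ℕ) : ((n + 1 : ℕ) : ℝ) + 2 ≤ 3 * 2 ^ (n + 1) := by
  have : n + 1 < 2 ^ (n + 1) := Nat.lt_two_pow_self
  have h : ((n + 1 : ℕ) : ℝ) ≤ 2 ^ (n + 1) := by exact_mod_cast this.le
  have h2 : (1 : ℝ) ≤ 2 ^ (n + 1) := one_le_pow₀ (by norm_num)
  linarith

/-- A product with at least one tail needs no cancellation: the tail is `O(h/t)` and the other
factor at most `t^{n+1} L`, so a full power of `t` is gained. Here `1088 = 2 · 32 + 32²`. -/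
lemma resolvent_far_le (ht : 1 ≤ t) (n : ℕ) {h L : ℝ} (hh : 1 ≤ h) (hL : 1 ≤ L)
    {x x' : ℝ≥0∞} (hx : x ≤ ENNReal.ofReal (t ^ (n + 1) * L))
    (hx' : x' ≤ ENNReal.ofReal (t ^ (n + 1) * L)) :
    (x + ENNReal.ofReal (32 * h / t)) * (x' + ENNReal.ofReal (32 * h / t)) ≤
      x * x' + ENNReal.ofReal (1088 * L * t ^ n) * ENNReal.ofReal (h ^ 2) := by
  have ht0 : 0 < t := by linarith
  set y := ENNReal.ofReal (32 * h / t) with hy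
  set X := ENNReal.ofReal (t ^ (n + 1) * L) with hX
  have h1 : X * y + X * y + y * y ≤
      ENNReal.ofReal (1088 * L * t ^ n) * ENNReal.ofReal (h ^ 2) := by
    rw [hX, hy, ← ENNReal.ofReal_mul (by positivity), ← ENNReal.ofReal_mul (by positivity),
      ← ENNReal.ofReal_mul (by positivity), ← ENNReal.ofReal_add (by positivity) (by positivity),
      ← ENNReal.ofReal_add (by positivity) (by positivity)]
    refine ENNReal.ofReal_le_ofReal ?_
    have h2 : t ^ (n + 1) * L * (32 * h / t) = 32 * (L * t ^ n * h) := by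
      field_simp
      ring
    have h3 : 32 * h / t * (32 * h / t) ≤ 1024 * (L * t ^ n * h ^ 2) := by
      have h4 : 32 * h / t ≤ 32 * h := div_le_self (by positivity) ht
      have h5 : 1 ≤ L * t ^ n := one_le_mul_of_one_le_of_one_le hL (one_le_pow₀ ht)
      calc 32 * h / t * (32 * h / t) ≤ 32 * h * (32 * h) := by gcongr
        _ = 1024 * (1 * h ^ 2) := by ring
        _ ≤ _ := by gcongr
    have h6 : L * t ^ n * h ≤ L * t ^ n * h ^ 2 := by
      gcongr; nlinarith
    rw [h2]
    linarith
  calc (x + y) * (x' + y) = x * x' + (x * y + x' * y + y * y) := by ring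
    _ ≤ x * x' + (X * y + X * y + y * y) := by gcongr
    _ ≤ _ := by gcongr

-- The near parts obey the crossing estimate. The tails are integrated trivially against the
-- weights; their `h²` is a product of fourth powers of brackets, finite by the decay of `M`.
set_option maxHeartbeats 1000000 in
lemma Regular.lintegral_resolventIntegral_le (H : Regular d K ρ C₅ e ω M) (ht : 1 ≤ t)
    (hB : 1 ≤ B) (P : PropagatorBounds B t e ω M) (p : Mom d) (σ : Fin (n + 1) → ℤˣ)
    {π : Equiv.Perm (Fin (n + 1))} (hπ : π ≠ 1) :
    ∫⁻ k, resolventIntegral t (energy e ω p k σ) *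
        resolventIntegral t (energy e ω p (fun j => k (π.symm j)) fun j => σ (π.symm j))
        ∂(Measure.pi fun j => vtx M (σ j))
      ≤ ENNReal.ofReal ((40000 * K ^ 2 * 36 * 51 ^ 5) * (4 * B) ^ (n + 1) * bracket p ^ 4 *
          (t ^ (n + 1) * t ^ (-(1 / 2) : ℝ))) := by
  have ht0 : 0 < t := by linarith
  have hK := H.one_le
  have hfin := H.isFiniteMeasure_vtx
  have hlg := one_le_lg ht
  -- With this width the tail bound `32 H t^{n+1}/T` becomes `32 H/t`.
  set T : ℝ := t ^ (n + 2) with hTdef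
  have hT : 1 ≤ T := one_le_pow₀ ht
  set L : ℝ := 6 * 2 ^ (n + 1) * lg t with hL
  have hL1 : 1 ≤ L := by
    have h2 : (1 : ℝ) ≤ 2 ^ (n + 1) := one_le_pow₀ (by norm_num)
    have h3 := one_le_mul_of_one_le_of_one_le h2 hlg
    rw [hL]; nlinarith
  have hlogL : 4 + 2 * Real.log (T * t) ≤ L := by
    have h1 : Real.log (T * t) = (((n + 1 : ℕ) : ℝ) + 2) * Real.log t := by
      rw [hTdef, ← pow_succ, Real.log_pow]; push_cast; ring
    have h2 := add_two_le_three_mul_two_pow n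
    have h3 := Real.log_nonneg ht
    have h4 : (2 : ℝ) ≤ ((n + 1 : ℕ) : ℝ) + 2 := by
      have : (0 : ℝ) ≤ ((n + 1 : ℕ) : ℝ) := Nat.cast_nonneg _
      linarith
    rw [h1, hL, lg]
    nlinarith
  have hlog0 : 0 ≤ 4 + 2 * Real.log (T * t) := by
    have := Real.log_nonneg (show 1 ≤ T * t by nlinarith)
    linarith
  set h : (Fin (n + 1) → Mom d) → ℝ := fun k => 6 * K * bracket p ^ 2 * ∏ j, bracket (k j) ^ 2
    with hh
  have hone : ∀ (x : Mom d), 1 ≤ bracket x ^ 2 := fun x => one_le_pow₀ (one_le_bracket x)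
  have h1p : ∀ (s : Finset (Fin (n + 1))) (k : Fin (n + 1) → Mom d),
      1 ≤ ∏ j ∈ s, bracket (k j) ^ 2 := fun s k =>
    Finset.prod_induction _ (fun x : ℝ => 1 ≤ x) (fun _ _ => one_le_mul_of_one_le_of_one_le) le_rfl
      fun j _ => hone _
  have hsingle : ∀ (k : Fin (n + 1) → Mom d) i, bracket (k i) ^ 2 ≤ ∏ j, bracket (k j) ^ 2 :=
    fun k i => by
      rw [← Finset.mul_prod_erase _ _ (Finset.mem_univ i)]
      exact le_mul_of_one_le_right (by positivity)
        (h1p _ k)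
  have hh1 : ∀ k, 1 ≤ h k := fun k => by
    have h1 : 1 ≤ bracket p ^ 2 * ∏ j, bracket (k j) ^ 2 :=
      one_le_mul_of_one_le_of_one_le (hone p) (h1p _ k)
    have h2 : 1 ≤ K * (bracket p ^ 2 * ∏ j, bracket (k j) ^ 2) :=
      one_le_mul_of_one_le_of_one_le hK h1
    simp only [hh]; nlinarith
  have hres : ∀ (k : Fin (n + 1) → Mom d) (k' : Fin (n + 1) → Mom d) σ',
      (∀ i, ∃ i', k' i = k i') → resolventIntegral t (energy e ω p k' σ') ≤
      resolventIntegralNear t T (energy e ω p k' σ') + ENNReal.ofReal (32 * h k / t) :=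
    fun k k' σ' hkk => by
      refine (resolventIntegral_le ht hT _ (hh1 k) ((H.abs_energy_sub_le p k' σ').trans ?_)).trans
        (le_of_eq ?_)
      · obtain ⟨i', hi'⟩ := hkk (Fin.last n)
        rw [hi', ← mul_assoc]
        exact mul_le_mul_of_nonneg_left (hsingle k i') (by positivity)
      · congr 2
        rw [hTdef]; field_simp; ring
  have hnear : ∀ (k' : Fin (n + 1) → Mom d) σ', resolventIntegralNear t T (energy e ω p k' σ') ≤
      ENNReal.ofReal (t ^ (n + 1) * L) := fun k' σ' =>
    (resolventIntegralNear_le ht hT _).trans (ENNReal.ofReal_le_ofReal (by gcongr))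
  have hcont : Continuous h := by
    have := continuous_bracket (d := d)
    simp only [hh]; fun_prop
  have hb4 : ∫⁻ k, ENNReal.ofReal (h k ^ 2) ∂(Measure.pi fun j => vtx M (σ j)) ≤
      ENNReal.ofReal (36 * K ^ 2 * bracket p ^ 4 * B ^ (n + 1)) := by
    have h1 : ∀ k, ENNReal.ofReal (h k ^ 2) = ENNReal.ofReal (36 * K ^ 2 * bracket p ^ 4) *
        ∏ j, ENNReal.ofReal (bracket (k j) ^ 4) := fun k => by
      rw [← ENNReal.ofReal_prod_of_nonneg fun j _ => by positivity,
        ← ENNReal.ofReal_mul (by positivity)]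
      congr 1
      simp only [hh, mul_pow, ← Finset.prod_pow, ← pow_mul]
      ring
    simp only [h1]
    rw [lintegral_const_mul' _ _ ENNReal.ofReal_ne_top,
      lintegral_pi_prod_eq (fun j => vtx M (σ j)) (fun _ x => ENNReal.ofReal (bracket x ^ 4))
        (fun _ => (continuous_bracket.pow 4).measurable.ennreal_ofReal),
      ENNReal.ofReal_mul (p := 36 * K ^ 2 * bracket p ^ 4) (by positivity)]
    gcongr
    refine (Finset.prod_le_prod' fun j _ => P.bracket_le (σ j)).trans (le_of_eq ?_)
    rw [Finset.prod_const, Finset.card_univ, Fintype.card_fin, ENNReal.ofReal_pow (by linarith)]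
  calc ∫⁻ k, resolventIntegral t (energy e ω p k σ) *
        resolventIntegral t (energy e ω p (fun j => k (π.symm j)) fun j => σ (π.symm j))
        ∂(Measure.pi fun j => vtx M (σ j))
      ≤ ∫⁻ k, (resolventIntegralNear t T (energy e ω p k σ) *
        resolventIntegralNear t T (energy e ω p (fun j => k (π.symm j)) fun j => σ (π.symm j)) +
        ENNReal.ofReal (1088 * L * t ^ n) * ENNReal.ofReal (h k ^ 2))
        ∂(Measure.pi fun j => vtx M (σ j)) := by
        refine lintegral_mono fun k => ?_
        exact (mul_le_mul' (hres k k σ fun i => ⟨i, rfl⟩)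
          (hres k _ _ fun i => ⟨π.symm i, rfl⟩)).trans
          (resolvent_far_le ht n (hh1 k) hL1 (hnear _ _) (hnear _ _))
    _ ≤ 2 * ENNReal.ofReal (t * (B ^ (n + 1) * (t ^ (n + 1) * t ^ (-(8 / 5) : ℝ)) * lg t ^ 3)) *
        ENNReal.ofReal (L ^ 2) + ENNReal.ofReal (1088 * L * t ^ n) *
          ENNReal.ofReal (36 * K ^ 2 * bracket p ^ 4 * B ^ (n + 1)) := by
        rw [lintegral_add_right _ (by
          exact ((hcont.pow 2).measurable.ennreal_ofReal).const_mul _),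
          lintegral_const_mul' _ _ ENNReal.ofReal_ne_top]
        gcongr
        refine (H.lintegral_near_mul_near_le ht hT hB P p σ hπ).trans ?_
        gcongr
    _ ≤ _ := by
        rw [show (2 : ℝ≥0∞) = ENNReal.ofReal 2 by simp, ← ENNReal.ofReal_mul (by norm_num),
          ← ENNReal.ofReal_mul (by positivity), ← ENNReal.ofReal_mul (by positivity),
          ← ENNReal.ofReal_add (by positivity) (by positivity)]
        refine ENNReal.ofReal_le_ofReal ?_
        -- The Schwarz factor `t` turns `-8/5` into `-3/5`; the tail contribution `t^n` is smaller;
        -- the logarithms use up `1/10`, and `-3/5 + 1/10 = -1/2`.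
        have e1 : t * (t ^ (n + 1) * t ^ (-(8 / 5) : ℝ)) = t ^ (n + 1) * t ^ (-(3 / 5) : ℝ) := by
          have : t ^ (-(3 / 5) : ℝ) = t * t ^ (-(8 / 5) : ℝ) := by
            rw [← Real.rpow_one_add' ht0.le (by norm_num)]; norm_num
          rw [this]; ring
        have e2 : t ^ n ≤ t ^ (n + 1) * t ^ (-(3 / 5) : ℝ) := by
          rw [pow_succ, mul_assoc, ← Real.rpow_one_add' ht0.le (by norm_num)]
          exact le_mul_of_one_le_right (by positivity) (Real.one_le_rpow ht (by norm_num))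
        have e3 : t ^ (-(3 / 5) : ℝ) * t ^ (1 / 10 : ℝ) = t ^ (-(1 / 2) : ℝ) := by
          rw [← Real.rpow_add ht0]; norm_num
        have e4 : (1 : ℝ) ≤ K ^ 2 * bracket p ^ 4 :=
          one_le_mul_of_one_le_of_one_le (one_le_pow₀ hK) (one_le_pow₀ (one_le_bracket p))
        have e5 : L ≤ lg t ^ 3 * L ^ 2 := by
          have : 1 ≤ lg t ^ 3 * L := one_le_mul_of_one_le_of_one_le (one_le_pow₀ hlg) hL1
          nlinarith
        have e6 : lg t ^ 3 * L ^ 2 = 36 * 4 ^ (n + 1) * lg t ^ 5 := by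
          rw [hL, show (4 : ℝ) = 2 ^ 2 by norm_num, ← pow_mul, mul_comm 2 (n + 1), pow_mul]; ring
        have e7 := lg_pow_le ht
        calc 2 * (t * (B ^ (n + 1) * (t ^ (n + 1) * t ^ (-(8 / 5) : ℝ)) * lg t ^ 3)) * L ^ 2 +
              1088 * L * t ^ n * (36 * K ^ 2 * bracket p ^ 4 * B ^ (n + 1))
            = 2 * B ^ (n + 1) * (t * (t ^ (n + 1) * t ^ (-(8 / 5) : ℝ))) * (lg t ^ 3 * L ^ 2) * 1 +
              39168 * (K ^ 2 * bracket p ^ 4) * B ^ (n + 1) * L * t ^ n := by ring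
          _ ≤ 2 * B ^ (n + 1) * (t ^ (n + 1) * t ^ (-(3 / 5) : ℝ)) * (lg t ^ 3 * L ^ 2) *
                (K ^ 2 * bracket p ^ 4) +
              39168 * (K ^ 2 * bracket p ^ 4) * B ^ (n + 1) * (lg t ^ 3 * L ^ 2) *
                (t ^ (n + 1) * t ^ (-(3 / 5) : ℝ)) := by
              rw [e1]; gcongr
          _ = 39170 * (K ^ 2 * bracket p ^ 4) * B ^ (n + 1) * (36 * 4 ^ (n + 1) * lg t ^ 5) *
                (t ^ (n + 1) * t ^ (-(3 / 5) : ℝ)) := by rw [e6]; ring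
          _ ≤ 40000 * (K ^ 2 * bracket p ^ 4) * B ^ (n + 1) *
                (36 * 4 ^ (n + 1) * (51 ^ 5 * t ^ (1 / 10 : ℝ))) *
                (t ^ (n + 1) * t ^ (-(3 / 5) : ℝ)) := by
              gcongr
              norm_num
          _ = _ := by rw [← e3, mul_pow]; ring

end Crossing

end PhononBoltzmann

end

noncomputable section

namespace PhononBoltzmann

/-! ### Time integrals as convolutions -/

section Convolution

variable {N : ℕ}

/-- The integrand of an `(N+1)`-fold convolution. -/
def convIntegrand (G : Fin (N + 1) → ℝ → ℂ) (s : Fin N → ℝ) (τ : ℝ) : ℂ :=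
  G 0 (τ - ∑ i, s i) * ∏ i : Fin N, G i.succ (s i)

/-- The `(N+1)`-fold convolution. -/
def convProd (G : Fin (N + 1) → ℝ → ℂ) (τ : ℝ) : ℂ := ∫ s, convIntegrand G s τ

lemma measurable_convIntegrand {G : Fin (N + 1) → ℝ → ℂ} (hm : ∀ b, Measurable (G b)) :
    Measurable fun x : (Fin N → ℝ) × ℝ => convIntegrand G x.1 x.2 := by
  unfold convIntegrand
  refine ((hm 0).comp (by fun_prop)).mul (Finset.measurable_prod _ fun i _ => ?_)
  exact (hm i.succ).comp (by fun_prop)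

lemma integrable_convIntegrand {G : Fin (N + 1) → ℝ → ℂ} (hm : ∀ b, Measurable (G b))
    (hi : ∀ b, Integrable (G b)) :
    Integrable (fun x : (Fin N → ℝ) × ℝ => convIntegrand G x.1 x.2) (volume.prod volume) := by
  rw [integrable_prod_iff (measurable_convIntegrand hm).aestronglyMeasurable]
  refine ⟨ae_of_all _ fun s => ?_, ?_⟩
  · have h := ((hi 0).comp_sub_right (∑ i, s i)).mul_const (∏ i : Fin N, G i.succ (s i))
    exact h
  have h : ∀ s : Fin N → ℝ, ∫ τ, ‖convIntegrand G s τ‖ =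
      (∫ τ, ‖G 0 τ‖) * ∏ i : Fin N, ‖G i.succ (s i)‖ := fun s => by
    simp only [convIntegrand, norm_mul, norm_prod]
    rw [integral_mul_const, integral_sub_right_eq_self (fun τ => ‖G 0 τ‖)]
  simp only [h]
  exact (Integrable.fintype_prod (f := fun (i : Fin N) x => ‖G i.succ x‖)
    fun i => (hi i.succ).norm).const_mul _

lemma integrable_convProd {G : Fin (N + 1) → ℝ → ℂ} (hm : ∀ b, Measurable (G b))
    (hi : ∀ b, Integrable (G b)) : Integrable (convProd G) :=
  (integrable_convIntegrand hm hi).integral_prod_right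

lemma integral_convProd {G : Fin (N + 1) → ℝ → ℂ} (hm : ∀ b, Measurable (G b))
    (hi : ∀ b, Integrable (G b)) : ∫ τ, convProd G τ = ∏ b, ∫ s, G b s := by
  unfold convProd
  rw [integral_integral_swap (f := fun τ s => convIntegrand G s τ)
    (integrable_convIntegrand hm hi).swap]
  have h : ∀ s : Fin N → ℝ, ∫ τ, convIntegrand G s τ =
      (∫ τ, G 0 τ) * ∏ i : Fin N, G i.succ (s i) := fun s => by
    simp only [convIntegrand]
    rw [integral_mul_const, integral_sub_right_eq_self (G 0)]
  simp only [h]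
  rw [integral_const_mul, integral_fintype_prod_volume_eq_prod (fun (i : Fin N) => G i.succ),
    Fin.prod_univ_succ]

/-- A character distributes over `τ = (τ - ∑ s) + ∑ s`, so multiplying a convolution by it amounts
to multiplying each factor, and the integral of a convolution is the product of the integrals. -/
lemma fourier_convProd {G : Fin (N + 1) → ℝ → ℂ} (hm : ∀ b, Measurable (G b))
    (hi : ∀ b, Integrable (G b)) (ξ : ℝ) :
    FourierTransform.fourier (convProd G) ξ = ∏ b, FourierTransform.fourier (G b) ξ := by
  set E : ℝ → ℂ := fun τ => Complex.exp (((-2 * Real.pi * τ * ξ : ℝ) : ℂ) * Complex.I) with hE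
  have cE : Continuous E := by rw [hE]; fun_prop
  have nE : ∀ τ, ‖E τ‖ = 1 := fun τ => Complex.norm_exp_ofReal_mul_I _
  set G' : Fin (N + 1) → ℝ → ℂ := fun b τ => E τ * G b τ with hG'
  have h1 : ∀ f : ℝ → ℂ, FourierTransform.fourier f ξ = ∫ τ, E τ * f τ := fun f => by
    rw [Real.fourier_real_eq_integral_exp_smul]; rfl
  have h2 : ∀ τ, E τ * convProd G τ = convProd G' τ := fun τ => by
    unfold convProd
    rw [← integral_const_mul]
    congr 1
    funext s
    have h3 : E τ = E (τ - ∑ i, s i) * ∏ i, E (s i) := by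
      simp only [hE]
      rw [← Complex.exp_sum, ← Complex.exp_add]
      congr 1
      rw [← Finset.sum_mul, ← add_mul]
      congr 1
      push_cast
      rw [← Finset.sum_mul, ← Finset.mul_sum]
      ring
    simp only [convIntegrand, hG', Finset.prod_mul_distrib]
    rw [h3]; ring
  simp only [h1, h2]
  exact integral_convProd (fun b => cE.measurable.mul (hm b)) fun b =>
    (hi b).bdd_mul cE.aestronglyMeasurable (ae_of_all _ fun τ => (nE τ).le)

lemma volume_sum_eq_zero (hN : 1 ≤ N) (t : ℝ) : ∀ᵐ s : Fin N → ℝ, ∑ i, s i ≠ t := by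
  let L : (Fin N → ℝ) →ₗ[ℝ] ℝ := ∑ i, LinearMap.proj i
  have hL : ∀ s, L s = ∑ i, s i := fun s => by simp [L]
  have hs : Function.Surjective L := fun x =>
    ⟨Pi.single ⟨0, hN⟩ x, by rw [hL]; simp⟩
  have h := (ae_comp_linearMap_mem_iff (L := L) volume volume hs
    (measurableSet_singleton t).compl).2 (by
      simpa using (Set.countable_singleton t).ae_notMem volume)
  filter_upwards [h] with s hs'
  rw [← hL]
  exact hs'

/-- The damped factors jump at time `0`. With at least one integration variable the jump of `G 0` is
met only on a null hyperplane, so the convolution is continuous and can be evaluated at the single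
time `t` by Fourier inversion. -/
lemma continuousAt_convProd (hN : 1 ≤ N) {G : Fin (N + 1) → ℝ → ℂ} (hm : ∀ b, Measurable (G b))
    (hi : ∀ b, Integrable (G b)) {K : ℝ} (hK : ∀ τ, ‖G 0 τ‖ ≤ K)
    (hc : ∀ τ, τ ≠ 0 → ContinuousAt (G 0) τ) (t : ℝ) : ContinuousAt (convProd G) t := by
  refine continuousAt_of_dominated (bound := fun s => K * ∏ i : Fin N, ‖G i.succ (s i)‖)
    (Eventually.of_forall fun τ =>
      ((measurable_convIntegrand hm).comp measurable_prodMk_right).aestronglyMeasurable)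
    (Eventually.of_forall fun τ => ae_of_all _ fun s => ?_) ?_ ?_
  · simp only [convIntegrand, norm_mul, norm_prod]
    gcongr
    exact hK _
  · exact (Integrable.fintype_prod (f := fun (i : Fin N) x => ‖G i.succ x‖)
      fun i => (hi i.succ).norm).const_mul _
  · filter_upwards [volume_sum_eq_zero hN t] with s hs
    have h1 : ContinuousAt (fun τ => G 0 (τ - ∑ i, s i)) t :=
      ContinuousAt.comp (g := G 0) (hc _ (sub_ne_zero.2 (Ne.symm hs))) (by fun_prop)
    exact h1.mul continuousAt_const

lemma enorm_convProd_le (hN : 1 ≤ N) {G : Fin (N + 1) → ℝ → ℂ} (hm : ∀ b, Measurable (G b))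
    (hi : ∀ b, Integrable (G b)) {K : ℝ} (hK : ∀ τ, ‖G 0 τ‖ ≤ K)
    (hc : ∀ τ, τ ≠ 0 → ContinuousAt (G 0) τ) (t : ℝ) :
    ‖convProd G t‖ₑ ≤ ∫⁻ ξ, ∏ b, ‖FourierTransform.fourier (G b) ξ‖ₑ := by
  have hf := integrable_convProd hm hi
  have h1 : ∀ ξ, ∏ b, ‖FourierTransform.fourier (G b) ξ‖ₑ =
      ‖FourierTransform.fourier (convProd G) ξ‖ₑ := fun ξ => by
    rw [fourier_convProd hm hi]
    simp only [enorm_eq_nnnorm, nnnorm_prod, ENNReal.ofNNReal_finsetProd]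
  simp only [h1]
  -- An infinite right-hand side leaves nothing to prove; a finite one says precisely that the
  -- transform is integrable, as inversion demands.
  by_cases htop : ∫⁻ ξ, ‖FourierTransform.fourier (convProd G) ξ‖ₑ = ∞
  · rw [htop]; exact le_top
  have hcont : Continuous (FourierTransform.fourier (convProd G)) :=
    VectorFourier.fourierIntegral_continuous Real.continuous_fourierChar (by fun_prop) hf
  have hF : Integrable (FourierTransform.fourier (convProd G)) :=
    ⟨hcont.aestronglyMeasurable, lt_top_iff_ne_top.2 htop⟩
  rw [← hf.fourierInv_fourier_eq hF (continuousAt_convProd hN hm hi hK hc t), Real.fourierInv_eq']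
  refine (enorm_integral_le_lintegral_enorm _).trans (lintegral_mono fun ξ => ?_)
  rw [enorm_smul, ← ofReal_norm, Complex.norm_exp_ofReal_mul_I, ENNReal.ofReal_one, one_mul]

/-- The simplex over which the time integral extends. -/
def simplex (N : ℕ) (t : ℝ) : Set (Fin N → ℝ) := {s | (∀ i, 0 ≤ s i) ∧ ∑ i, s i ≤ t}

lemma measurableSet_simplex (t : ℝ) : MeasurableSet (simplex N t) := by
  have h1 : simplex N t = (⋂ i, {s | 0 ≤ s i}) ∩ {s | ∑ i, s i ≤ t} := by
    ext s; simp [simplex]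
  rw [h1]
  exact (MeasurableSet.iInter fun i => measurableSet_le measurable_const
    (measurable_pi_apply i)).inter (measurableSet_le (by fun_prop) measurable_const)

/-- The damped causal function `1_{s ≥ 0} e^{-s/t} g(s)`. -/
def damped (t : ℝ) (g : ℝ → ℂ) (s : ℝ) : ℂ :=
  (Set.Ici (0 : ℝ)).indicator (fun s => ((Real.exp (-(t⁻¹ * s)) : ℝ) : ℂ) * g s) s

/-- Since the times sum to `t`, the damping factors `e^{-s_b/t}` multiply to `e⁻¹`. Damping
therefore costs only a constant, and it makes every factor integrable and regularizes its propagator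
by `i/t`. -/
lemma timeIntegral_eq_convProd (t : ℝ) (g : Fin (N + 1) → ℝ → ℂ) :
    ((Real.exp (-(t⁻¹ * t)) : ℝ) : ℂ) * timeIntegral N t (fun s => ∏ b, g b (s b)) =
      convProd (fun b => damped t (g b)) t := by
  have h0 : timeIntegral N t (fun s => ∏ b, g b (s b)) = ∫ s in simplex N t,
      ∏ b, g b ((Fin.cons (t - ∑ i, s i) s : Fin (N + 1) → ℝ) b) := rfl
  rw [h0, convProd, ← integral_const_mul, ← integral_indicator (measurableSet_simplex t)]
  congr 1
  funext s
  by_cases hs : s ∈ simplex N t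
  · rw [Set.indicator_of_mem hs, Fin.prod_univ_succ, convIntegrand]
    simp only [Fin.cons_zero, Fin.cons_succ, damped]
    rw [Set.indicator_of_mem (by simpa using hs.2)]
    have h1 : ∀ i : Fin N, (Set.Ici (0 : ℝ)).indicator
        (fun s => ((Real.exp (-(t⁻¹ * s)) : ℝ) : ℂ) * g i.succ s) (s i) =
        ((Real.exp (-(t⁻¹ * s i)) : ℝ) : ℂ) * g i.succ (s i) := fun i =>
      Set.indicator_of_mem (hs.1 i) _
    simp only [h1, Finset.prod_mul_distrib]
    have h2 : Real.exp (-(t⁻¹ * t)) =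
        Real.exp (-(t⁻¹ * (t - ∑ i, s i))) * ∏ i, Real.exp (-(t⁻¹ * s i)) := by
      rw [← Real.exp_sum, ← Real.exp_add]
      congr 1
      rw [Finset.sum_neg_distrib, ← Finset.mul_sum]
      ring
    rw [h2]
    push_cast
    ring
  · rw [Set.indicator_of_notMem hs, convIntegrand]
    rw [simplex, Set.mem_ofPred_eq, not_and_or, not_forall] at hs
    rcases hs with ⟨i, hi⟩ | hs
    · rw [Finset.prod_eq_zero (Finset.mem_univ i), mul_zero]
      exact Set.indicator_of_notMem hi _
    · simp only [damped]
      rw [Set.indicator_of_notMem (by simpa using hs), zero_mul]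

lemma measurable_damped (t : ℝ) {g : ℝ → ℂ} (hg : Continuous g) : Measurable (damped t g) :=
  Measurable.indicator (by
    have : Continuous fun s : ℝ => ((Real.exp (-(t⁻¹ * s)) : ℝ) : ℂ) * g s := by fun_prop
    exact this.measurable) measurableSet_Ici

lemma norm_damped_le {t : ℝ} {g : ℝ → ℂ} {K : ℝ} (hK : ∀ s, 0 ≤ s → ‖g s‖ ≤ K)
    (s : ℝ) : ‖damped t g s‖ ≤ (Set.Ici (0 : ℝ)).indicator (fun s => Real.exp (-t⁻¹ * s) * K) s := by
  unfold damped
  by_cases hs : s ∈ Set.Ici (0 : ℝ)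
  · rw [Set.indicator_of_mem hs, Set.indicator_of_mem hs, norm_mul, Complex.norm_real,
      Real.norm_eq_abs, abs_of_pos (Real.exp_pos _), neg_mul]
    gcongr
    exact hK s hs
  · rw [Set.indicator_of_notMem hs, Set.indicator_of_notMem hs, norm_zero]

lemma integrable_damped {t : ℝ} (ht : 0 < t) {g : ℝ → ℂ} (hg : Continuous g) {K : ℝ}
    (hK : ∀ s, 0 ≤ s → ‖g s‖ ≤ K) : Integrable (damped t g) := by
  refine Integrable.mono' (g := (Set.Ici (0 : ℝ)).indicator fun s => Real.exp (-t⁻¹ * s) * K) ?_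
    (measurable_damped t hg).aestronglyMeasurable (ae_of_all _ (norm_damped_le hK))
  rw [integrable_indicator_iff measurableSet_Ici, integrableOn_Ici_iff_integrableOn_Ioi]
  exact (integrableOn_exp_mul_Ioi (by simpa using ht) 0).mul_const K

lemma continuousAt_damped (t : ℝ) {g : ℝ → ℂ} (hg : Continuous g) {τ : ℝ} (hτ : τ ≠ 0) :
    ContinuousAt (damped t g) τ := by
  have hc : Continuous fun s : ℝ => ((Real.exp (-(t⁻¹ * s)) : ℝ) : ℂ) * g s := by fun_prop
  rcases lt_or_gt_of_ne hτ with h | h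
  · refine (continuousAt_const (y := (0 : ℂ))).congr ?_
    filter_upwards [Iio_mem_nhds h] with s hs
    unfold damped
    rw [Set.indicator_of_notMem (by simpa using hs)]
  · refine hc.continuousAt.congr ?_
    filter_upwards [Ioi_mem_nhds h] with s hs
    unfold damped
    rw [Set.indicator_of_mem (show s ∈ Set.Ici (0 : ℝ) from (Set.mem_Ioi.1 hs).le)]

/-- The time integral of a product is bounded by an energy integral of bounds for the transforms
of the damped factors. -/
lemma enorm_timeIntegral_le (hN : 1 ≤ N) {t : ℝ} (ht : 0 < t) {g : Fin (N + 1) → ℝ → ℂ}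
    (hg : ∀ b, Continuous (g b)) {K : ℝ} (hK : ∀ b s, 0 ≤ s → ‖g b s‖ ≤ K)
    {F : Fin (N + 1) → ℝ → ℝ≥0∞}
    (hF : ∀ b ξ, ‖FourierTransform.fourier (damped t (g b)) ξ‖ₑ ≤ F b (-(2 * Real.pi) * ξ)) :
    ‖timeIntegral N t (fun s => ∏ b, g b (s b))‖ₑ ≤
      ENNReal.ofReal (Real.exp 1) * ∫⁻ α, ∏ b, F b α := by
  have h1 := timeIntegral_eq_convProd t g
  have h2 := enorm_convProd_le hN (fun b => measurable_damped t (hg b))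
    (fun b => integrable_damped ht (hg b) (hK b)) (K := K) (fun τ => by
      refine (norm_damped_le (hK 0) τ).trans ?_
      have hK0 : 0 ≤ K := (norm_nonneg _).trans (hK 0 0 le_rfl)
      refine Set.indicator_apply_le' (fun hτ => ?_) fun _ => hK0
      refine mul_le_of_le_one_left hK0 (Real.exp_le_one_iff.2 ?_)
      have : 0 ≤ t⁻¹ * τ := mul_nonneg (by positivity) hτ
      linarith) (fun τ hτ => continuousAt_damped t (hg 0) hτ) t
  have h3 : timeIntegral N t (fun s => ∏ b, g b (s b)) =
      ((Real.exp 1 : ℝ) : ℂ) * convProd (fun b => damped t (g b)) t := by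
    rw [← h1, ← mul_assoc, ← Complex.ofReal_mul, ← Real.exp_add, inv_mul_cancel₀ ht.ne']
    simp
  have h4 : ∫⁻ ξ, ∏ b, F b (-(2 * Real.pi) * ξ) ≤ ∫⁻ α, ∏ b, F b α := by
    -- Substitution `α = -2πξ` from frequency to energy; the Jacobian `1/(2π)` is at most `1` and is
    -- dropped.
    have hπ : -(2 * Real.pi) ≠ 0 := by have := Real.pi_pos; linarith
    let φ : ℝ ≃ᵐ ℝ := (Homeomorph.mulLeft₀ (-(2 * Real.pi)) hπ).toMeasurableEquiv
    have h5 : ∫⁻ ξ, ∏ b, F b (-(2 * Real.pi) * ξ) =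
        ∫⁻ α, ∏ b, F b α ∂(Measure.map (fun x => -(2 * Real.pi) * x) volume) :=
      (lintegral_map_equiv (fun α => ∏ b, F b α) φ).symm
    rw [h5, Real.map_volume_mul_left hπ, lintegral_smul_measure, smul_eq_mul]
    refine mul_le_of_le_one_left' (ENNReal.ofReal_le_one.2 ?_)
    rw [abs_inv, abs_neg, abs_of_pos (by positivity)]
    refine inv_le_one_of_one_le₀ ?_
    have := Real.pi_gt_three
    linarith
  rw [h3, enorm_mul]
  gcongr
  · rw [← ofReal_norm, Complex.norm_real, Real.norm_eq_abs, abs_of_pos (Real.exp_pos _)]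
  · refine h2.trans (le_trans (lintegral_mono fun ξ => ?_) h4)
    exact Finset.prod_le_prod' fun b _ => hF b ξ

lemma enorm_fourier_damped_phase_le {t : ℝ} (ht : 0 < t) (E ξ : ℝ) :
    ‖FourierTransform.fourier (damped t fun s => Complex.exp (-Complex.I * ((s * E : ℝ) : ℂ))) ξ‖ₑ ≤
      eres t (-(2 * Real.pi) * ξ - E) := by
  set a : ℂ := -(t⁻¹ : ℝ) + ((-(2 * Real.pi) * ξ - E : ℝ) : ℂ) * Complex.I with ha
  have hare : a.re = -t⁻¹ := by simp [ha]
  have haim : a.im = -(2 * Real.pi) * ξ - E := by simp [ha]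
  have h1 : FourierTransform.fourier
      (damped t fun s => Complex.exp (-Complex.I * ((s * E : ℝ) : ℂ))) ξ =
      ∫ s in Set.Ioi (0 : ℝ), Complex.exp (a * s) := by
    rw [Real.fourier_real_eq_integral_exp_smul, ← integral_Ici_eq_integral_Ioi,
      ← integral_indicator measurableSet_Ici]
    congr 1
    funext s
    unfold damped
    by_cases hs : s ∈ Set.Ici (0 : ℝ)
    · rw [Set.indicator_of_mem hs, Set.indicator_of_mem hs, smul_eq_mul, Complex.ofReal_exp,
        ← Complex.exp_add, ← Complex.exp_add, ha]
      congr 1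
      push_cast
      ring
    · rw [Set.indicator_of_notMem hs, Set.indicator_of_notMem hs, smul_zero]
  rw [h1, integral_exp_mul_complex_Ioi (by rw [hare]; simpa using ht)]
  rw [← ofReal_norm]
  refine ENNReal.ofReal_le_ofReal (le_of_eq ?_)
  rw [norm_div, norm_neg]
  simp only [Complex.ofReal_zero, mul_zero, Complex.exp_zero, norm_one]
  rw [one_div, res, Complex.norm_eq_sqrt_sq_add_sq, hare, haim]
  congr 2
  ring

/-- The supremum of a transform is at most the `L¹` norm. This is why a recollision contributes only
a constant, uniformly in `t` and in the energy. -/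
lemma enorm_fourier_damped_le {t : ℝ} (ht : 0 < t) {g : ℝ → ℂ} {C : ℝ}
    (hg : ∀ s, 0 ≤ s → ‖g s‖ ≤ C * (1 + s) ^ (-(5 / 4) : ℝ)) (ξ : ℝ) :
    ‖FourierTransform.fourier (damped t g) ξ‖ₑ ≤ ENNReal.ofReal (C * decayMass) := by
  rw [Real.fourier_real_eq_integral_exp_smul, ← ofReal_norm]
  refine ENNReal.ofReal_le_ofReal ?_
  have h1 : C * decayMass = ∫ s, (Set.Ici (0 : ℝ)).indicator
      (fun s => C * (1 + s) ^ (-(5 / 4) : ℝ)) s := by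
    rw [integral_indicator measurableSet_Ici, integral_Ici_eq_integral_Ioi, integral_const_mul,
      decayMass]
  rw [h1]
  refine norm_integral_le_of_norm_le ?_ (ae_of_all _ fun s => ?_)
  · rw [integrable_indicator_iff measurableSet_Ici, integrableOn_Ici_iff_integrableOn_Ioi]
    exact integrableOn_decay.const_mul C
  · rw [norm_smul, Complex.norm_exp_ofReal_mul_I, one_mul]
    unfold damped
    by_cases hs : s ∈ Set.Ici (0 : ℝ)
    · rw [Set.indicator_of_mem hs, Set.indicator_of_mem hs, norm_mul, Complex.norm_real,
        Real.norm_eq_abs, abs_of_pos (Real.exp_pos _)]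
      refine (mul_le_of_le_one_left (norm_nonneg _) (Real.exp_le_one_iff.2 ?_)).trans (hg s hs)
      have : 0 ≤ t⁻¹ * s := mul_nonneg (by positivity) hs
      linarith
    · rw [Set.indicator_of_notMem hs, Set.indicator_of_notMem hs, norm_zero]

end Convolution

end PhononBoltzmann

end

noncomputable section

namespace PhononBoltzmann

/-! ### Combinatorics of collision patterns -/

section Patterns

variable {n N : ℕ} {m : Fin (n + 1) → ℕ}

lemma mem_outerSet {j : Fin (n + 1)} {b : Fin (N + 1)} :
    b ∈ outerSet N m j ↔ ∃ r, r < m j + 1 ∧ extIndex m j + 2 * r = b := by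
  simp [outerSet]

lemma mem_innerSet {j : Fin (n + 1)} {b : Fin (N + 1)} :
    b ∈ innerSet N m j ↔ ∃ r, r < m j ∧ extIndex m j + (2 * r + 1) = b := by
  simp [innerSet]

lemma extIndex_add_lt {j j' : Fin (n + 1)} (h : j < j') :
    extIndex m j + 2 * m j < extIndex m j' := by
  have h1 : m j + ∑ i ∈ Finset.univ.filter (fun i => i < j), m i ≤
      ∑ i ∈ Finset.univ.filter (fun i => i < j'), m i := by
    rw [← Finset.sum_insert (by simp : j ∉ Finset.univ.filter (fun i => i < j))]
    refine Finset.sum_le_sum_of_subset fun i hi => ?_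
    simp only [Finset.mem_insert, Finset.mem_filter, Finset.mem_univ, true_and] at hi ⊢
    rcases hi with rfl | hi
    · exact h
    · exact hi.trans h
  have h2 : (j : ℕ) < j' := h
  unfold extIndex
  omega

lemma extIndex_add_le (hm : m ∈ patterns n N) (j : Fin (n + 1)) :
    extIndex m j + 2 * m j ≤ N := by
  have h1 : m j + ∑ i ∈ Finset.univ.filter (fun i => i < j), m i ≤ ∑ i, m i := by
    rw [← Finset.sum_insert (by simp : j ∉ Finset.univ.filter (fun i => i < j))]
    exact Finset.sum_le_sum_of_subset (Finset.subset_univ _)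
  have h2 : (j : ℕ) < n + 1 := j.2
  have h3 : n + 2 * ∑ j, m j = N := hm
  unfold extIndex
  omega

lemma card_outerSet (hm : m ∈ patterns n N) (j : Fin (n + 1)) :
    (outerSet N m j).card = m j + 1 := by
  have hle := extIndex_add_le hm j
  rw [← Finset.card_range (m j + 1)]
  symm
  refine Finset.card_bij (fun r hr => ⟨extIndex m j + 2 * r, by
    have := Finset.mem_range.1 hr; omega⟩) (fun r hr => ?_) (fun r _ r' _ h => ?_) fun b hb => ?_
  · exact mem_outerSet.2 ⟨r, Finset.mem_range.1 hr, rfl⟩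
  · simpa [Fin.ext_iff] using h
  · obtain ⟨r, hr, h⟩ := mem_outerSet.1 hb
    exact ⟨r, Finset.mem_range.2 hr, Fin.ext h⟩

lemma card_innerSet (hm : m ∈ patterns n N) (j : Fin (n + 1)) :
    (innerSet N m j).card = m j := by
  have hle := extIndex_add_le hm j
  rw [← Finset.card_range (m j)]
  symm
  refine Finset.card_bij (fun r hr => ⟨extIndex m j + (2 * r + 1), by
    have := Finset.mem_range.1 hr; omega⟩) (fun r hr => ?_) (fun r _ r' _ h => ?_) fun b hb => ?_
  · exact mem_innerSet.2 ⟨r, Finset.mem_range.1 hr, rfl⟩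
  · simpa [Fin.ext_iff] using h
  · obtain ⟨r, hr, h⟩ := mem_innerSet.1 hb
    exact ⟨r, Finset.mem_range.2 hr, Fin.ext h⟩

lemma mem_block {j : Fin (n + 1)} {b : Fin (N + 1)} (h : b ∈ outerSet N m j ∪ innerSet N m j) :
    extIndex m j ≤ b ∧ b ≤ extIndex m j + 2 * m j := by
  rcases Finset.mem_union.1 h with h | h
  · obtain ⟨r, hr, h⟩ := mem_outerSet.1 h; omega
  · obtain ⟨r, hr, h⟩ := mem_innerSet.1 h; omega

lemma block_unique {j j' : Fin (n + 1)} {b : Fin (N + 1)}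
    (h : b ∈ outerSet N m j ∪ innerSet N m j) (h' : b ∈ outerSet N m j' ∪ innerSet N m j') :
    j = j' := by
  have h1 := mem_block h
  have h2 := mem_block h'
  rcases lt_trichotomy j j' with hj | hj | hj
  · have := extIndex_add_lt (m := m) hj; omega
  · exact hj
  · have := extIndex_add_lt (m := m) hj; omega

lemma disjoint_outerSet_innerSet (j : Fin (n + 1)) :
    Disjoint (outerSet N m j) (innerSet N m j) :=
  Finset.disjoint_left.2 fun b hb hb' => by
    obtain ⟨r, _, h⟩ := mem_outerSet.1 hb
    obtain ⟨r', _, h'⟩ := mem_innerSet.1 hb'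
    omega

/-- By counting: the blocks are disjoint and have `2 m_j + 1` elements each, which adds up to `N +
1`. -/
lemma exists_mem_block (hm : m ∈ patterns n N) (b : Fin (N + 1)) :
    ∃ j, b ∈ outerSet N m j ∪ innerSet N m j := by
  have h1 : (Finset.univ.biUnion fun j : Fin (n + 1) => outerSet N m j ∪ innerSet N m j) =
      Finset.univ := by
    rw [← Finset.card_eq_iff_eq_univ, Finset.card_biUnion]
    · have h2 : ∀ j, (outerSet N m j ∪ innerSet N m j).card = 1 + 2 * m j := fun j => by
        rw [Finset.card_union_of_disjoint (disjoint_outerSet_innerSet j), card_outerSet hm,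
          card_innerSet hm]
        omega
      have h3 : n + 2 * ∑ j, m j = N := hm
      simp only [h2, Finset.sum_add_distrib, ← Finset.mul_sum, Finset.sum_const, Finset.card_univ,
        Fintype.card_fin, smul_eq_mul]
      omega
    · exact fun j _ j' _ hj => Finset.disjoint_left.2 fun b hb hb' => hj (block_unique hb hb')
  have h2 : b ∈ Finset.univ.biUnion fun j : Fin (n + 1) => outerSet N m j ∪ innerSet N m j := by
    rw [h1]; exact Finset.mem_univ b
  obtain ⟨j, _, hj⟩ := Finset.mem_biUnion.1 h2
  exact ⟨j, hj⟩

variable {A : Type*} [CommMonoid A]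

/-- The factor carrying the time index `b` in a product over the collision pattern. -/
def blockFactor (N : ℕ) (m : Fin (n + 1) → ℕ) (X Y : Fin (n + 1) → A) (b : Fin (N + 1)) : A :=
  ∏ j, (if b ∈ outerSet N m j then X j else 1) * (if b ∈ innerSet N m j then Y j else 1)

/-- The value monoid is quantified inside, so that one and the same `j` serves for the complex
factor and for its bound in `ℝ≥0∞`. -/
lemma blockFactor_cases (hm : m ∈ patterns n N) (b : Fin (N + 1)) :
    (∃ j, b ∈ outerSet N m j ∧ ∀ {A : Type} [CommMonoid A] (X Y : Fin (n + 1) → A),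
      blockFactor N m X Y b = X j) ∨
    ∃ j, b ∈ innerSet N m j ∧ ∀ {A : Type} [CommMonoid A] (X Y : Fin (n + 1) → A),
      blockFactor N m X Y b = Y j := by
  obtain ⟨j, hj⟩ := exists_mem_block hm b
  have h1 : ∀ {A : Type} [CommMonoid A] (X Y : Fin (n + 1) → A), blockFactor N m X Y b =
      (if b ∈ outerSet N m j then X j else 1) * (if b ∈ innerSet N m j then Y j else 1) :=
    fun X Y => Finset.prod_eq_single j (fun j' _ hj' => by
      rw [if_neg fun h => hj' (block_unique (Finset.mem_union_left _ h) hj),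
        if_neg fun h => hj' (block_unique (Finset.mem_union_right _ h) hj), mul_one])
      fun h => absurd (Finset.mem_univ _) h
  have hd : b ∈ outerSet N m j → b ∉ innerSet N m j := fun h =>
    Finset.disjoint_left.1 (disjoint_outerSet_innerSet j) h
  rcases Finset.mem_union.1 hj with h | h
  · exact Or.inl ⟨j, h, fun X Y => by rw [h1, if_pos h, if_neg (hd h), mul_one]⟩
  · exact Or.inr ⟨j, h, fun X Y => by rw [h1, if_pos h, if_neg fun h' => hd h' h, one_mul]⟩

lemma prod_blockFactor (X Y : Fin (N + 1) → Fin (n + 1) → A) :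
    ∏ b, blockFactor N m (X b) (Y b) b =
      ∏ j, ((∏ b ∈ outerSet N m j, X b j) * ∏ b ∈ innerSet N m j, Y b j) := by
  unfold blockFactor
  rw [Finset.prod_comm]
  refine Finset.prod_congr rfl fun j _ => ?_
  rw [Finset.prod_mul_distrib, Finset.prod_ite_mem, Finset.prod_ite_mem, Finset.univ_inter,
    Finset.univ_inter]

end Patterns

/-! ### Bounds for a single collision history -/

section History

variable {d n N : ℕ} {K ρ C₅ t : ℝ} {e ω : Mom d → ℝ} {M : Mom d → ℤˣ → ℝ} {m : Fin (n + 1) → ℕ}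

/-- A collision history with a general recollision function `θ`. -/
def historyWith (θ : ℝ → Mom d → ℝ → ℂ) (e ω : Mom d → ℝ) (N : ℕ) (m : Fin (n + 1) → ℕ) (t : ℝ)
    (p : Mom d) (k : Fin n → Mom d) (σ : Fin n → ℤˣ) : ℂ :=
  timeIntegral N t (fun s => ∏ j : Fin (n + 1),
    ((∏ b ∈ outerSet N m j, Complex.exp (-Complex.I * ((s b * energy e ω p k σ j : ℝ) : ℂ))) *
      ∏ b ∈ innerSet N m j, θ (s b) (electronMom p k j) (phononEnergy ω k σ j)))

lemma history_eq (e ω Q : Mom d → ℝ) (β μ L : ℝ) (p : Mom d) (k : Fin n → Mom d)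
    (σ : Fin n → ℤˣ) :
    history e ω Q β μ L N m t p k σ = historyWith (Theta e ω Q β μ L) e ω N m t p k σ := rfl

lemma norm_phase (x : ℝ) : ‖Complex.exp (-Complex.I * (x : ℂ))‖ = 1 := by
  rw [show -Complex.I * (x : ℂ) = ((-x : ℝ) : ℂ) * Complex.I by push_cast; ring]
  exact Complex.norm_exp_ofReal_mul_I _

lemma norm_historyWith_integrand_le (hm : m ∈ patterns n N) (θ : ℝ → Mom d → ℝ → ℂ) {C : ℝ}
    (hC : 1 ≤ C) {s : Fin (N + 1) → ℝ} (hθ : ∀ b p Ω, ‖θ (s b) p Ω‖ ≤ C) (p : Mom d)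
    (k : Fin n → Mom d) (σ : Fin n → ℤˣ) :
    ‖∏ j : Fin (n + 1), ((∏ b ∈ outerSet N m j,
        Complex.exp (-Complex.I * ((s b * energy e ω p k σ j : ℝ) : ℂ))) *
      ∏ b ∈ innerSet N m j, θ (s b) (electronMom p k j) (phononEnergy ω k σ j))‖ ≤ C ^ N := by
  calc _ ≤ ∏ j : Fin (n + 1), C ^ m j := by
        rw [norm_prod]
        refine Finset.prod_le_prod (fun _ _ => norm_nonneg _) fun j _ => ?_
        rw [norm_mul, norm_prod, norm_prod, ← card_innerSet hm j, ← Finset.prod_const]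
        simp only [norm_phase, Finset.prod_const_one, one_mul]
        exact Finset.prod_le_prod (fun _ _ => norm_nonneg _) fun b _ => hθ _ _ _
    _ = C ^ ∑ j, m j := Finset.prod_pow_eq_pow_sum _ _ _
    _ ≤ C ^ N := by
        refine pow_le_pow_right₀ hC ?_
        have : n + 2 * ∑ j, m j = N := hm
        omega

lemma cons_nonneg {s : Fin N → ℝ} (hs : (∀ i, 0 ≤ s i) ∧ ∑ i, s i ≤ t) (b : Fin (N + 1)) :
    0 ≤ (Fin.cons (t - ∑ i, s i) s : Fin (N + 1) → ℝ) b := by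
  refine Fin.cases ?_ (fun i => ?_) b
  · simpa using hs.2
  · simpa using hs.1 i

lemma cons_le {s : Fin N → ℝ} (hs : (∀ i, 0 ≤ s i) ∧ ∑ i, s i ≤ t) (b : Fin (N + 1)) :
    (Fin.cons (t - ∑ i, s i) s : Fin (N + 1) → ℝ) b ≤ t := by
  refine Fin.cases ?_ (fun i => ?_) b
  · simpa using Finset.sum_nonneg fun i _ => hs.1 i
  · simpa using (Finset.single_le_sum (fun i _ => hs.1 i) (Finset.mem_univ i)).trans hs.2

lemma volume_simplex_le (ht : 0 ≤ t) : volume (simplex N t) ≤ ENNReal.ofReal (t ^ N) := by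
  have h1 : simplex N t ⊆ Set.univ.pi fun _ : Fin N => Set.Icc 0 t := fun s hs i _ =>
    ⟨hs.1 i, (Finset.single_le_sum (fun i _ => hs.1 i) (Finset.mem_univ i)).trans hs.2⟩
  refine (measure_mono h1).trans (le_of_eq ?_)
  rw [volume_pi_pi]
  simp [ENNReal.ofReal_pow ht]

lemma norm_timeIntegral_le (ht : 0 ≤ t) {F : (Fin (N + 1) → ℝ) → ℂ} {C : ℝ}
    (hF : ∀ s : Fin (N + 1) → ℝ, (∀ b, 0 ≤ s b) → (∀ b, s b ≤ t) → ‖F s‖ ≤ C) :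
    ‖timeIntegral N t F‖ ≤ C * t ^ N := by
  have hvol := volume_simplex_le (N := N) ht
  have h1 := norm_setIntegral_le_of_norm_le_const (μ := volume) (s := simplex N t)
    (f := fun s => F (Fin.cons (t - ∑ i, s i) s : Fin (N + 1) → ℝ)) (C := C)
    (hvol.trans_lt ENNReal.ofReal_lt_top) fun s hs => hF _ (cons_nonneg hs) (cons_le hs)
  refine h1.trans ?_
  have hC : 0 ≤ C := (norm_nonneg _).trans (hF (fun _ => 0) (fun _ => le_rfl) fun _ => ht)
  gcongr
  exact ENNReal.toReal_le_of_le_ofReal (by positivity) hvol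

lemma norm_historyWith_le (hm : m ∈ patterns n N) (ht : 0 ≤ t) {θ : ℝ → Mom d → ℝ → ℂ} {C : ℝ}
    (hC : 1 ≤ C) (hθ : ∀ s, 0 ≤ s → ∀ p Ω, ‖θ s p Ω‖ ≤ C) (p : Mom d) (k : Fin n → Mom d)
    (σ : Fin n → ℤˣ) : ‖historyWith θ e ω N m t p k σ‖ ≤ C ^ N * t ^ N :=
  norm_timeIntegral_le ht fun _ hs _ =>
    norm_historyWith_integrand_le hm θ hC (fun b => hθ _ (hs b)) p k σ

/-- The recollision function in infinite volume. -/
def thetaLim (e ω : Mom d → ℝ) (M : Mom d → ℤˣ → ℝ) (s : ℝ) (p : Mom d) (Ω : ℝ) : ℂ :=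
  ∑ σ : ℤˣ, ((Real.sqrt (2 * Real.pi) : ℝ) : ℂ)⁻¹ ^ d * ∫ k : Mom d,
    Complex.exp (-Complex.I * ((s * (Phi e ω σ p k + Ω) : ℝ) : ℂ)) * (M k σ : ℂ)

lemma one_le_sqrt_two_pi : 1 ≤ Real.sqrt (2 * Real.pi) := by
  rw [Real.one_le_sqrt]; have := Real.pi_gt_three; linarith

lemma norm_sqrt_two_pi_inv_pow_le (d : ℕ) :
    ‖((Real.sqrt (2 * Real.pi) : ℝ) : ℂ)⁻¹ ^ d‖ ≤ 1 := by
  rw [norm_pow, norm_inv, Complex.norm_real, Real.norm_eq_abs, abs_of_nonneg (Real.sqrt_nonneg _)]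
  exact pow_le_one₀ (by positivity) (inv_le_one_of_one_le₀ one_le_sqrt_two_pi)

lemma Regular.norm_thetaLim_le (H : Regular d K ρ C₅ e ω M) {s : ℝ} (hs : 0 ≤ s) (p : Mom d)
    (Ω : ℝ) : ‖thetaLim e ω M s p Ω‖ ≤ 2 * K * (1 + s) ^ (-(5 / 4) : ℝ) := by
  have h1 : ∀ σ, ‖((Real.sqrt (2 * Real.pi) : ℝ) : ℂ)⁻¹ ^ d * ∫ k : Mom d,
      Complex.exp (-Complex.I * ((s * (Phi e ω σ p k + Ω) : ℝ) : ℂ)) * (M k σ : ℂ)‖ ≤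
      K * (1 + s) ^ (-(5 / 4) : ℝ) := fun σ => by
    have h2 : ∀ k, Complex.exp (-Complex.I * ((s * (Phi e ω σ p k + Ω) : ℝ) : ℂ)) * (M k σ : ℂ) =
        Complex.exp (-Complex.I * ((s * Ω : ℝ) : ℂ)) *
          (Complex.exp (-Complex.I * ((s * Phi e ω σ p k : ℝ) : ℂ)) * (M k σ : ℂ)) := fun k => by
      rw [← mul_assoc, ← Complex.exp_add]
      congr 2
      push_cast
      ring
    simp only [h2]
    rw [integral_const_mul, norm_mul, norm_mul, norm_phase, one_mul]
    exact (mul_le_of_le_one_left (norm_nonneg _) (norm_sqrt_two_pi_inv_pow_le d)).trans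
      (H.decay σ p s hs)
  refine (norm_sum_le _ _).trans ((Finset.sum_le_sum fun σ _ => h1 σ).trans (le_of_eq ?_))
  rw [Finset.sum_const, Finset.card_univ, Fintype.card_units_int]
  ring

lemma Regular.norm_phase_mul_le (H : Regular d K ρ C₅ e ω M) (x : ℝ) (k : Mom d) (σ : ℤˣ) :
    ‖Complex.exp (-Complex.I * (x : ℂ)) * (M k σ : ℂ)‖ ≤ M k σ := by
  rw [norm_mul, norm_phase, one_mul, Complex.norm_real, Real.norm_eq_abs,
    abs_of_nonneg (H.M_nonneg k σ)]

lemma Regular.continuous_thetaLim (H : Regular d K ρ C₅ e ω M) :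
    Continuous fun x : ℝ × Mom d × ℝ => thetaLim e ω M x.1 x.2.1 x.2.2 := by
  have he := H.e_cont
  have hω := H.ω_cont
  unfold thetaLim
  refine continuous_finsetSum _ fun σ _ => continuous_const.mul ?_
  have hM := H.M_cont σ
  refine continuous_of_dominated (bound := fun k => M k σ) (fun x => ?_)
    (fun x => ae_of_all _ fun k => H.norm_phase_mul_le _ k σ) (H.integrable_M σ)
    (ae_of_all _ fun k => ?_)
  · refine Continuous.aestronglyMeasurable ?_
    unfold Phi
    fun_prop
  · unfold Phi
    fun_prop

lemma Regular.continuous_thetaLim_time (H : Regular d K ρ C₅ e ω M) (p : Mom d) (Ω : ℝ) :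
    Continuous fun s : ℝ => thetaLim e ω M s p Ω := by
  have hc : Continuous fun s : ℝ => (s, p, Ω) := by fun_prop
  have h := H.continuous_thetaLim.comp hc
  simpa only [Function.comp_def] using h

/-- Block `j` yields `m_j + 1` equal propagators and `m_j` recollision factors. One propagator is
kept for the resolvent integral; the other `m_j` are bounded by `t` and the recollisions by `C`. The
constant `3` bounds the factor `e` from the damping. -/
lemma Regular.enorm_historyWith_le (H : Regular d K ρ C₅ e ω M) (hm : m ∈ patterns n N)
    (hN : 1 ≤ N) (ht : 1 ≤ t) {C : ℝ} (hC : 1 ≤ C) (hKC : 2 * K * decayMass ≤ C) (p : Mom d)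
    (k : Fin n → Mom d) (σ : Fin n → ℤˣ) :
    ‖historyWith (thetaLim e ω M) e ω N m t p k σ‖ₑ ≤
      ENNReal.ofReal (3 * (C * t) ^ ∑ j, m j) * resolventIntegral t (energy e ω p k σ) := by
  have ht0 : 0 < t := by linarith
  have hK := H.one_le
  obtain ⟨X, hX⟩ : ∃ X : ℝ → Fin (n + 1) → ℂ, X = fun s j =>
    Complex.exp (-Complex.I * ((s * energy e ω p k σ j : ℝ) : ℂ)) := ⟨_, rfl⟩
  obtain ⟨Y, hY⟩ : ∃ Y : ℝ → Fin (n + 1) → ℂ, Y = fun s j =>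
    thetaLim e ω M s (electronMom p k j) (phononEnergy ω k σ j) := ⟨_, rfl⟩
  obtain ⟨g, hg⟩ : ∃ g : Fin (N + 1) → ℝ → ℂ, g = fun b s => blockFactor N m (X s) (Y s) b :=
    ⟨_, rfl⟩
  obtain ⟨F, hF⟩ : ∃ F : Fin (N + 1) → ℝ → ℝ≥0∞, F = fun b α =>
    blockFactor N m (fun j => eres t (α - energy e ω p k σ j)) (fun _ => ENNReal.ofReal C) b :=
    ⟨_, rfl⟩
  have h1 : historyWith (thetaLim e ω M) e ω N m t p k σ =
      timeIntegral N t (fun s => ∏ b, g b (s b)) := by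
    unfold historyWith
    congr 1
    funext s
    have := (prod_blockFactor (N := N) (m := m) (fun b => X (s b)) fun b => Y (s b)).symm
    simpa only [hg, hX, hY] using this
  have hXc : ∀ j, Continuous fun s => X s j := fun j => by simp only [hX]; fun_prop
  have hYc : ∀ j, Continuous fun s => Y s j := fun j => by
    simp only [hY]
    exact H.continuous_thetaLim_time _ _
  have hdecay : ∀ s : ℝ, 0 ≤ s → (1 + s) ^ (-(5 / 4) : ℝ) ≤ 1 := fun s hs =>
    Real.rpow_le_one_of_one_le_of_nonpos (by linarith) (by norm_num)
  have h2 := enorm_timeIntegral_le hN ht0 (g := g) (K := 2 * K) (F := F) (fun b => ?_)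
    (fun b s hs => ?_) fun b ξ => ?_
  · rw [h1]
    refine h2.trans ?_
    have h3 : ∀ α, ∏ b, F b α ≤
        ENNReal.ofReal ((C * t) ^ ∑ j, m j) * ∏ j, eres t (α - energy e ω p k σ j) := fun α => by
      simp only [hF]
      rw [prod_blockFactor (fun _ j => eres t (α - energy e ω p k σ j))
        fun _ _ => ENNReal.ofReal C]
      simp only [Finset.prod_const, card_outerSet hm, card_innerSet hm]
      rw [ENNReal.ofReal_pow (by positivity), ← Finset.prod_pow_eq_pow_sum,
        ← Finset.prod_mul_distrib]
      refine Finset.prod_le_prod' fun j _ => ?_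
      rw [ENNReal.ofReal_mul (by linarith), mul_pow, pow_succ]
      calc eres t (α - energy e ω p k σ j) ^ m j * eres t (α - energy e ω p k σ j) *
            ENNReal.ofReal C ^ m j
          ≤ ENNReal.ofReal t ^ m j * eres t (α - energy e ω p k σ j) *
            ENNReal.ofReal C ^ m j := by
            gcongr
            exact eres_le ht0 _
        _ = _ := by ring
    calc _ ≤ ENNReal.ofReal 3 * ∫⁻ α, ENNReal.ofReal ((C * t) ^ ∑ j, m j) *
          ∏ j, eres t (α - energy e ω p k σ j) := by
          gcongr
          · exact Real.exp_one_lt_three.le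
          · exact h3 _
      _ = _ := by
          rw [lintegral_const_mul' _ _ ENNReal.ofReal_ne_top, ← mul_assoc,
            ← ENNReal.ofReal_mul (by norm_num), resolventIntegral]
  · rcases blockFactor_cases hm b with ⟨j, _, h⟩ | ⟨j, _, h⟩
    · simp only [hg, h]; exact hXc j
    · simp only [hg, h]; exact hYc j
  · rcases blockFactor_cases hm b with ⟨j, _, h⟩ | ⟨j, _, h⟩
    · simp only [hg, h, hX, norm_phase]; linarith
    · simp only [hg, h, hY]
      refine (H.norm_thetaLim_le hs _ _).trans ?_
      exact mul_le_of_le_one_right (by linarith) (hdecay s hs)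
  · rcases blockFactor_cases hm b with ⟨j, _, h⟩ | ⟨j, _, h⟩
    · have h5 : (fun s => g b s) = fun s : ℝ =>
          Complex.exp (-Complex.I * ((s * energy e ω p k σ j : ℝ) : ℂ)) := by
        funext s; simp only [hg, h, hX]
      have h6 : F b (-(2 * Real.pi) * ξ) = eres t (-(2 * Real.pi) * ξ - energy e ω p k σ j) := by
        simp only [hF, h]
      rw [show g b = _ from h5, h6]
      exact enorm_fourier_damped_phase_le ht0 _ ξ
    · have h5 : ∀ s : ℝ, 0 ≤ s → ‖g b s‖ ≤ 2 * K * (1 + s) ^ (-(5 / 4) : ℝ) := fun s hs => by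
        simp only [hg, h, hY]
        exact H.norm_thetaLim_le hs _ _
      have h6 : F b (-(2 * Real.pi) * ξ) = ENNReal.ofReal C := by
        simp only [hF, h]
      rw [h6]
      exact (enorm_fourier_damped_le ht0 h5 ξ).trans (ENNReal.ofReal_le_ofReal hKC)

end History

end PhononBoltzmann

end

noncomputable section

namespace PhononBoltzmann

/-! ### The amplitude in infinite volume -/

section Amplitude

variable {d n N : ℕ} {K ρ C₅ t B : ℝ} {e ω : Mom d → ℝ} {M : Mom d → ℤˣ → ℝ}
  {m m' : Fin (n + 1) → ℕ} {π : Equiv.Perm (Fin n)}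

/-- The weighted product of two histories, summed over the signs. -/
def graphDensity (θ : ℝ → Mom d → ℝ → ℂ) (e ω : Mom d → ℝ) (M : Mom d → ℤˣ → ℝ) (N : ℕ)
    (m m' : Fin (n + 1) → ℕ) (π : Equiv.Perm (Fin n)) (t : ℝ) (p : Mom d)
    (k : Fin n → Mom d) : ℂ :=
  ∑ σ : Fin n → ℤˣ, (∏ j, (M (k j) (σ j) : ℂ)) * (historyWith θ e ω N m t p k σ *
    conj (historyWith θ e ω N m' t p (fun j => k (π.symm j)) fun j => σ (π.symm j)))

/-- The amplitude of a graph with incoming momentum `p` in infinite volume. -/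
def graphLim (e ω : Mom d → ℝ) (M : Mom d → ℤˣ → ℝ) (N : ℕ)
    (m m' : Fin (n + 1) → ℕ) (π : Equiv.Perm (Fin n)) (t : ℝ) (p : Mom d) : ℂ :=
  (((Real.sqrt (2 * Real.pi) : ℝ) : ℂ)⁻¹ ^ d) ^ n *
    ∫ k, graphDensity (thetaLim e ω M) e ω M N m m' π t p k

/-- Translates the product of vertex measures, for which the crossing estimate is proved, into the
weighted Lebesgue integral that occurs in the amplitude. -/
lemma Regular.lintegral_pi_vtx (H : Regular d K ρ C₅ e ω M) (σ : Fin n → ℤˣ)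
    {G : (Fin n → Mom d) → ℝ≥0∞} (hG : Measurable G) :
    ∫⁻ k, G k ∂(Measure.pi fun j => vtx M (σ j)) =
      ∫⁻ k : Fin n → Mom d, (∏ j, ENNReal.ofReal (M (k j) (σ j))) * G k := by
  have hfin := H.isFiniteMeasure_vtx
  have hM : ∀ j, Measurable fun k : Mom d => ENNReal.ofReal (M k (σ j)) := fun j =>
    (H.M_cont (σ j)).measurable.ennreal_ofReal
  have h1 : (Measure.pi fun j => vtx M (σ j)) = (volume : Measure (Fin n → Mom d)).withDensity
      fun k => ∏ j, ENNReal.ofReal (M (k j) (σ j)) :=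
    have : ∀ j : Fin n, SigmaFinite ((volume : Measure (Mom d)).withDensity
        ((fun j k => ENNReal.ofReal (M k (σ j))) j)) := fun j => by
      have := hfin (σ j); exact inferInstanceAs (SigmaFinite (vtx M (σ j)))
    pi_withDensity (fun _ : Fin n => (volume : Measure (Mom d)))
      (fun j k => ENNReal.ofReal (M k (σ j))) hM
  have h2 : Measurable fun k : Fin n → Mom d => ∏ j, ENNReal.ofReal (M (k j) (σ j)) :=
    Finset.measurable_prod _ fun j _ => (hM j).comp (measurable_pi_apply j)
  rw [h1, lintegral_withDensity_eq_lintegral_mul _ h2 hG]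
  rfl

lemma enorm_ofReal_of_nonneg {x : ℝ} (hx : 0 ≤ x) : ‖(x : ℂ)‖ₑ = ENNReal.ofReal x := by
  rw [← ofReal_norm, Complex.norm_real, Real.norm_eq_abs, abs_of_nonneg hx]

lemma enorm_prod {ι : Type*} (s : Finset ι) (f : ι → ℂ) : ‖∏ i ∈ s, f i‖ₑ = ∏ i ∈ s, ‖f i‖ₑ := by
  simp only [enorm_eq_nnnorm, nnnorm_prod, ENNReal.ofNNReal_finsetProd]

lemma enorm_conj (z : ℂ) : ‖conj z‖ₑ = ‖z‖ₑ := by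
  rw [← ofReal_norm, ← ofReal_norm, Complex.norm_conj]

lemma Regular.enorm_graphLim_le (H : Regular d K ρ C₅ e ω M) (p : Mom d) {A : ℝ}
    {G : (Fin n → ℤˣ) → (Fin n → Mom d) → ℝ≥0∞} (hG : ∀ σ, Measurable (G σ))
    (hle : ∀ σ k, ‖historyWith (thetaLim e ω M) e ω N m t p k σ‖ₑ *
      ‖historyWith (thetaLim e ω M) e ω N m' t p (fun j => k (π.symm j))
        (fun j => σ (π.symm j))‖ₑ ≤ G σ k)
    (hA : ∀ σ, ∫⁻ k, G σ k ∂(Measure.pi fun j => vtx M (σ j)) ≤ ENNReal.ofReal A) :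
    ‖graphLim e ω M N m m' π t p‖ₑ ≤ ENNReal.ofReal (2 ^ n * A) := by
  have hM : ∀ (σ : ℤˣ), Measurable fun k : Mom d => ENNReal.ofReal (M k σ) := fun σ =>
    (H.M_cont σ).measurable.ennreal_ofReal
  have h1 : ‖(((Real.sqrt (2 * Real.pi) : ℝ) : ℂ)⁻¹ ^ d) ^ n‖ₑ ≤ 1 := by
    rw [← ofReal_norm, norm_pow]
    exact ENNReal.ofReal_le_one.2 (pow_le_one₀ (norm_nonneg _) (norm_sqrt_two_pi_inv_pow_le d))
  have h2 : ∀ k, ‖graphDensity (thetaLim e ω M) e ω M N m m' π t p k‖ₑ ≤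
      ∑ σ : Fin n → ℤˣ, (∏ j, ENNReal.ofReal (M (k j) (σ j))) * G σ k := fun k => by
    refine (enorm_sum_le _ _).trans (Finset.sum_le_sum fun σ _ => ?_)
    rw [enorm_mul, enorm_mul, enorm_conj, enorm_prod]
    simp only [enorm_ofReal_of_nonneg (H.M_nonneg _ _)]
    gcongr
    exact hle σ k
  calc ‖graphLim e ω M N m m' π t p‖ₑ
      ≤ 1 * ∫⁻ k, ‖graphDensity (thetaLim e ω M) e ω M N m m' π t p k‖ₑ := by
        rw [graphLim, enorm_mul]
        gcongr
        exact enorm_integral_le_lintegral_enorm _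
    _ ≤ ∫⁻ k : Fin n → Mom d,
          ∑ σ : Fin n → ℤˣ, (∏ j, ENNReal.ofReal (M (k j) (σ j))) * G σ k := by
        rw [one_mul]; exact lintegral_mono h2
    _ = ∑ σ : Fin n → ℤˣ, ∫⁻ k, G σ k ∂(Measure.pi fun j => vtx M (σ j)) := by
        have h3 : ∀ σ : Fin n → ℤˣ, Measurable fun k : Fin n → Mom d =>
            (∏ j, ENNReal.ofReal (M (k j) (σ j))) * G σ k := fun σ =>
          (Finset.measurable_prod _ fun j _ =>
            (hM (σ j)).comp (measurable_pi_apply j)).mul (hG σ)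
        rw [lintegral_finsetSum _ fun σ _ => h3 σ]
        exact Finset.sum_congr rfl fun σ _ => (H.lintegral_pi_vtx σ (hG σ)).symm
    _ ≤ ∑ _σ : Fin n → ℤˣ, ENNReal.ofReal A := Finset.sum_le_sum fun σ _ => hA σ
    _ = _ := by
        rw [Finset.sum_const, Finset.card_univ, Fintype.card_fun, Fintype.card_units_int,
          Fintype.card_fin, nsmul_eq_mul, ENNReal.ofReal_mul (by positivity),
          ENNReal.ofReal_pow (by norm_num)]
        simp

lemma Regular.measurable_resolventIntegral (H : Regular d K ρ C₅ e ω M) (ht : 0 < t) (p : Mom d)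
    (σ : Fin n → ℤˣ) :
    Measurable fun k : Fin n → Mom d => resolventIntegral t (energy e ω p k σ) := by
  have h : Measurable fun x : (Fin n → Mom d) × ℝ =>
      ∏ j, eres t (x.2 - energy e ω p x.1 σ j) :=
    Finset.measurable_prod _ fun j _ => H.measurable_eres_energy ht p σ j
  exact h.lintegral_prod_right'

/-- The number of recollisions in the two histories together: the power of `t` they cost complements
the `t^n` of the exchanged momenta to `t^N`. -/
lemma sum_pattern_add (hm : m ∈ patterns n N) (hm' : m' ∈ patterns n N) :
    ∑ j, m j + ∑ j, m' j = N - n := by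
  have h1 : n + 2 * ∑ j, m j = N := hm
  have h2 : n + 2 * ∑ j, m' j = N := hm'
  omega

end Amplitude

/-! ### Crossing graphs in infinite volume, for long and for short times -/

section Bound

variable {d n N : ℕ} {K ρ C₅ t B : ℝ} {e ω : Mom d → ℝ} {M : Mom d → ℤˣ → ℝ}
  {m m' : Fin (n + 1 + 1) → ℕ} {π : Equiv.Perm (Fin (n + 1))}

/-- Here `9 = 3 · 3` comes from the two histories and `8B = 2 · 4B` from the sum over `2^{n+1}`
signs. As `N ≥ n + 1 ≥ 1` and all constants are at least `1`, each may be raised to the power `N`.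
-/
lemma Regular.enorm_graphLim_le_of_one_le (H : Regular d K ρ C₅ e ω M) (ht : 1 ≤ t)
    (hB : 1 ≤ B) (P : PropagatorBounds B t e ω M) {C : ℝ} (hC : 1 ≤ C)
    (hKC : 2 * K * decayMass ≤ C) (hm : m ∈ patterns (n + 1) N) (hm' : m' ∈ patterns (n + 1) N)
    (hπ : π ≠ 1) (p : Mom d) :
    ‖graphLim e ω M N m m' π t p‖ₑ ≤
      ENNReal.ofReal (((9 * (40000 * K ^ 2 * 36 * 51 ^ 5)) * C * (8 * B)) ^ N * bracket p ^ 4 *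
        (t ^ N * t ^ (-(1 / 2) : ℝ))) := by
  have ht0 : 0 < t := by linarith
  have hK := H.one_le
  have hnN : n + 1 ≤ N := by
    have h1 : n + 1 + 2 * ∑ j, m j = N := hm
    omega
  have hN : 1 ≤ N := by omega
  have mres := fun σ : Fin (n + 1) → ℤˣ => H.measurable_resolventIntegral ht0 p σ
  have hperm : Measurable fun k : Fin (n + 1) → Mom d => fun j => k (π.symm j) := by fun_prop
  have mres' : ∀ σ : Fin (n + 1) → ℤˣ, Measurable fun k : Fin (n + 1) → Mom d =>
      resolventIntegral t (energy e ω p (fun j => k (π.symm j)) fun j => σ (π.symm j)) :=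
    fun σ => by
      have h := (mres fun j => σ (π.symm j)).comp hperm
      simpa only [Function.comp_def] using h
  set D := 40000 * K ^ 2 * 36 * 51 ^ 5 with hD
  have hD1 : 1 ≤ D := by rw [hD]; nlinarith
  refine (H.enorm_graphLim_le p (A := 9 * (C * t) ^ (N - (n + 1)) *
      (D * (4 * B) ^ (n + 1) * bracket p ^ 4 * (t ^ (n + 1) * t ^ (-(1 / 2) : ℝ))))
    (G := fun σ k => ENNReal.ofReal (9 * (C * t) ^ (N - (n + 1))) *
      (resolventIntegral t (energy e ω p k σ) *
        resolventIntegral t (energy e ω p (fun j => k (π.symm j)) fun j => σ (π.symm j))))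
    (fun σ => ((mres σ).mul (mres' σ)).const_mul _) (fun σ k => ?_) fun σ => ?_).trans
    (ENNReal.ofReal_le_ofReal ?_)
  · refine (mul_le_mul' (H.enorm_historyWith_le hm hN ht hC hKC p k σ)
      (H.enorm_historyWith_le hm' hN ht hC hKC p _ _)).trans (le_of_eq ?_)
    rw [← sum_pattern_add hm hm', pow_add, show 9 * ((C * t) ^ (∑ j, m j) * (C * t) ^ (∑ j, m' j)) =
      (3 * (C * t) ^ (∑ j, m j)) * (3 * (C * t) ^ (∑ j, m' j)) by ring,
      ENNReal.ofReal_mul (p := 3 * (C * t) ^ (∑ j, m j)) (by positivity)]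
    ring
  · rw [lintegral_const_mul' _ _ ENNReal.ofReal_ne_top, ENNReal.ofReal_mul (p := 9 * (C * t) ^ (N - (n + 1))) (by positivity)]
    gcongr
    exact H.lintegral_resolventIntegral_le ht hB P p σ hπ
  · obtain ⟨l, rfl⟩ : ∃ l, N = n + 1 + l := ⟨N - (n + 1), by omega⟩
    rw [Nat.add_sub_cancel_left]
    have h1 : 9 * D ≤ (9 * D) ^ (n + 1 + l) := le_self_pow₀ (by linarith) (by omega)
    have h2 : C ^ l ≤ C ^ (n + 1 + l) := pow_le_pow_right₀ hC (by omega)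
    have h3 : (8 * B) ^ (n + 1) ≤ (8 * B) ^ (n + 1 + l) :=
      pow_le_pow_right₀ (by linarith) (by omega)
    calc 2 ^ (n + 1) * (9 * (C * t) ^ l *
          (D * (4 * B) ^ (n + 1) * bracket p ^ 4 * (t ^ (n + 1) * t ^ (-(1 / 2) : ℝ))))
        = 9 * D * C ^ l * (8 * B) ^ (n + 1) * bracket p ^ 4 *
            (t ^ (n + 1 + l) * t ^ (-(1 / 2) : ℝ)) := by
          rw [show (8 : ℝ) * B = 2 * (4 * B) by ring, mul_pow 2, mul_pow C, pow_add t]; ring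
      _ ≤ (9 * D) ^ (n + 1 + l) * C ^ (n + 1 + l) * (8 * B) ^ (n + 1 + l) * bracket p ^ 4 *
            (t ^ (n + 1 + l) * t ^ (-(1 / 2) : ℝ)) := by
          have := bracket_pos p
          gcongr
      _ = _ := by rw [mul_pow (9 * D * C), mul_pow (9 * D)]

/-- No oscillation is needed: the two simplices have volume at most `t^N` each, and `t^{2N} ≤ t^N
t^{-1/2}`. -/
lemma Regular.enorm_graphLim_le_of_le_one (H : Regular d K ρ C₅ e ω M) (ht : 0 < t) (ht1 : t ≤ 1)
    (hB : 1 ≤ B) (hvtx : ∀ σ, vtx M σ Set.univ ≤ ENNReal.ofReal B)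
    (hm : m ∈ patterns (n + 1) N) (hm' : m' ∈ patterns (n + 1) N) (p : Mom d) :
    ‖graphLim e ω M N m m' π t p‖ₑ ≤
      ENNReal.ofReal ((2 * B * (4 * K ^ 2)) ^ N * (t ^ N * t ^ (-(1 / 2) : ℝ))) := by
  have hK := H.one_le
  have hfin := H.isFiniteMeasure_vtx
  have hnN : n + 1 ≤ N := by
    have h1 : n + 1 + 2 * ∑ j, m j = N := hm
    omega
  have hθ : ∀ s, 0 ≤ s → ∀ p Ω, ‖thetaLim e ω M s p Ω‖ ≤ 2 * K := fun s hs p Ω =>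
    (H.norm_thetaLim_le hs p Ω).trans (mul_le_of_le_one_right (by linarith)
      (Real.rpow_le_one_of_one_le_of_nonpos (by linarith) (by norm_num)))
  have hh : ∀ {m : Fin (n + 1 + 1) → ℕ}, m ∈ patterns (n + 1) N → ∀ k σ,
      ‖historyWith (thetaLim e ω M) e ω N m t p k σ‖ₑ ≤
        ENNReal.ofReal ((2 * K) ^ N * t ^ N) := fun hm k σ => by
    rw [← ofReal_norm]
    exact ENNReal.ofReal_le_ofReal (norm_historyWith_le hm ht.le (by linarith) hθ p k σ)
  refine (H.enorm_graphLim_le p (A := ((2 * K) ^ N * t ^ N) ^ 2 * B ^ (n + 1))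
    (G := fun _ _ => ENNReal.ofReal (((2 * K) ^ N * t ^ N) ^ 2))
    (fun σ => measurable_const) (fun σ k => ?_) fun σ => ?_).trans
    (ENNReal.ofReal_le_ofReal ?_)
  · rw [ENNReal.ofReal_pow (by positivity), sq]
    exact mul_le_mul' (hh hm _ _) (hh hm' _ _)
  · rw [lintegral_const, Measure.pi_univ, ENNReal.ofReal_mul (by positivity),
      ENNReal.ofReal_pow (by linarith) (n + 1)]
    gcongr
    refine (Finset.prod_le_prod' fun j _ => hvtx (σ j)).trans (le_of_eq ?_)
    rw [Finset.prod_const, Finset.card_univ, Fintype.card_fin]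
  · have h1 : t ^ N * t ^ N ≤ t ^ N * t ^ (-(1 / 2) : ℝ) := by
      gcongr
      exact (pow_le_one₀ ht.le ht1).trans
        (Real.one_le_rpow_of_pos_of_le_one_of_nonpos ht ht1 (by norm_num))
    have h2 : (2 * B) ^ (n + 1) ≤ (2 * B) ^ N := pow_le_pow_right₀ (by linarith) hnN
    calc 2 ^ (n + 1) * (((2 * K) ^ N * t ^ N) ^ 2 * B ^ (n + 1))
        = (2 * B) ^ (n + 1) * (4 * K ^ 2) ^ N * (t ^ N * t ^ N) := by
          rw [show 4 * K ^ 2 = (2 * K) ^ 2 by ring, mul_pow 2 B, ← pow_mul, mul_comm 2 N, pow_mul]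
          ring
      _ ≤ (2 * B) ^ N * (4 * K ^ 2) ^ N * (t ^ N * t ^ (-(1 / 2) : ℝ)) := by gcongr
      _ = _ := by rw [mul_pow (2 * B)]

/-- The bound on crossing graphs in infinite volume. -/
lemma exists_graphLim_bound (hd : 3 ≤ d) (hρ : 0 < ρ) (hC₅ : 0 < C₅) (K : ℝ) :
    ∃ C : ℝ, 1 ≤ C ∧ ∀ (e ω : Mom d → ℝ) (M : Mom d → ℤˣ → ℝ), Regular d K ρ C₅ e ω M →
      ∀ t, 0 < t → ∀ (n N : ℕ) (m m' : Fin (n + 1) → ℕ), m ∈ patterns n N → m' ∈ patterns n N →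
      ∀ π : Equiv.Perm (Fin n), π ≠ 1 → ∀ p,
        ‖graphLim e ω M N m m' π t p‖ₑ ≤
          ENNReal.ofReal (C ^ N * bracket p ^ 4 * (t ^ N * t ^ (-(1 / 2) : ℝ))) := by
  obtain ⟨B, hB, hP⟩ := exists_propagatorBounds (d := d) hd hρ hC₅ K
  by_cases hK : 1 ≤ K
  swap
  · exact ⟨1, le_rfl, fun e ω M H => absurd H.one_le hK⟩
  set C₀ := max 1 (2 * K * decayMass) with hC₀
  set B' := max 1 (K * wtMass d) with hB'
  have hC₀1 : 1 ≤ C₀ := le_max_left _ _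
  have hB'1 : 1 ≤ B' := le_max_left _ _
  set D₁ := (9 * (40000 * K ^ 2 * 36 * 51 ^ 5)) * C₀ * (8 * B) with hD₁
  set D₂ := 2 * B' * (4 * K ^ 2) with hD₂
  have hD₁0 : 0 ≤ D₁ := by positivity
  have hD₂0 : 0 ≤ D₂ := by positivity
  refine ⟨max 1 (max D₁ D₂), le_max_left _ _, fun e ω M H t ht n N m m' hm hm' π hπ p => ?_⟩
  -- The empty set has no permutation other than the identity, so `n ≥ 1`.
  obtain _ | n := n
  · exact absurd (Subsingleton.elim _ _) hπ
  have hb := bracket_pos p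
  rcases le_total 1 t with h | h
  · refine (H.enorm_graphLim_le_of_one_le h hB (hP e ω M H t h) hC₀1 (le_max_right _ _) hm hm'
      hπ p).trans (ENNReal.ofReal_le_ofReal ?_)
    gcongr
    exact (le_max_left _ _).trans (le_max_right _ _)
  · refine (H.enorm_graphLim_le_of_le_one ht h hB'1 (fun σ => (H.vtx_univ_le σ).trans
      (ENNReal.ofReal_le_ofReal (le_max_right _ _))) hm hm' p).trans (ENNReal.ofReal_le_ofReal ?_)
    have h1 : (1 : ℝ) ≤ bracket p ^ 4 := one_le_pow₀ (one_le_bracket p)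
    calc D₂ ^ N * (t ^ N * t ^ (-(1 / 2) : ℝ))
        ≤ D₂ ^ N * bracket p ^ 4 * (t ^ N * t ^ (-(1 / 2) : ℝ)) := by
          gcongr
          exact le_mul_of_one_le_right (by positivity) h1
      _ ≤ _ := by
          gcongr
          exact (le_max_right _ _).trans (le_max_right _ _)

end Bound

end PhononBoltzmann

end

noncomputable section

namespace PhononBoltzmann

/-! ### Lattice sums as integrals -/

section Lattice

variable {d n : ℕ} {L : ℝ}

/-- The spacing `√(2π) / L` of the dual lattice. -/
def spacing (L : ℝ) : ℝ := Real.sqrt (2 * Real.pi) / L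

lemma spacing_pos (hL : 0 < L) : 0 < spacing L := by unfold spacing; positivity

/-- The lower corner of the lattice cell containing `k`. -/
def cell (L : ℝ) (k : Mom d) : Fin d → ℤ := fun i => ⌊k i / spacing L⌋

lemma measurable_cell (L : ℝ) : Measurable (cell (d := d) L) :=
  measurable_pi_lambda _ fun i => Int.measurable_floor.comp
    ((by fun_prop : Continuous fun k : Mom d => k i / spacing L).measurable)

lemma cell_eq_iff (hL : 0 < L) (k : Mom d) (z : Fin d → ℤ) :
    cell L k = z ↔ ∀ i, k i ∈ Set.Ico (spacing L * z i) (spacing L * (z i + 1)) := by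
  have h := spacing_pos hL
  rw [funext_iff]
  refine forall_congr' fun i => ?_
  rw [cell, Int.floor_eq_iff, le_div_iff₀ h, div_lt_iff₀ h, Set.mem_Ico, mul_comm (spacing L),
    mul_comm (spacing L)]

lemma volume_preimage_cell (hL : 0 < L) (z : Fin d → ℤ) :
    volume (cell (d := d) L ⁻¹' {z}) = ENNReal.ofReal (spacing L ^ d) := by
  have h := spacing_pos hL
  have h1 : cell (d := d) L ⁻¹' {z} = (WithLp.ofLp : Mom d → Fin d → ℝ) ⁻¹'
      Set.univ.pi fun i => Set.Ico (spacing L * z i) (spacing L * (z i + 1)) := by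
    ext k
    simp only [Set.mem_preimage, Set.mem_singleton_iff, cell_eq_iff hL, Set.mem_pi, Set.mem_univ,
      true_imp_iff]
  rw [h1, (PiLp.volume_preserving_ofLp (Fin d)).measure_preimage
    (MeasurableSet.univ_pi fun i => measurableSet_Ico).nullMeasurableSet, volume_pi_pi]
  have h2 : ∀ i, volume (Set.Ico (spacing L * (z i : ℝ)) (spacing L * (z i + 1))) =
      ENNReal.ofReal (spacing L) := fun i => by
    rw [Real.volume_Ico]; congr 1; ring
  rw [Finset.prod_congr rfl fun i _ => h2 i, Finset.prod_const, Finset.card_univ,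
    Fintype.card_fin, ENNReal.ofReal_pow h.le]

/-- All cells have the same volume, so lattice sums are integrals of functions that are constant on
cells, and limits of sums fall under dominated convergence. -/
lemma map_cell (hL : 0 < L) : Measure.map (cell (d := d) L) volume =
    ENNReal.ofReal (spacing L ^ d) • Measure.count :=
  Measure.ext_of_singleton fun z => by
    rw [Measure.map_apply (measurable_cell L) (measurableSet_singleton z),
      volume_preimage_cell hL, Measure.smul_apply, Measure.count_singleton, smul_eq_mul, mul_one]

/-- The lattice cells of several momenta. -/
def cells (L : ℝ) (k : Fin n → Mom d) : Fin n → Fin d → ℤ := fun j => cell L (k j)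

lemma measurable_cells (L : ℝ) : Measurable (cells (d := d) (n := n) L) :=
  measurable_pi_lambda _ fun j => (measurable_cell L).comp (measurable_pi_apply j)

lemma map_cells (hL : 0 < L) : Measure.map (cells (d := d) (n := n) L) volume =
    ENNReal.ofReal ((spacing L ^ d) ^ n) • Measure.count :=
  Measure.ext_of_singleton fun z => by
    have h := spacing_pos hL
    have h1 : cells (d := d) (n := n) L ⁻¹' {z} =
        Set.univ.pi fun j => cell (d := d) L ⁻¹' {z j} := by
      ext k; simp [cells, funext_iff]
    rw [Measure.map_apply (measurable_cells L) (measurableSet_singleton z), h1, volume_pi_pi,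
      Measure.smul_apply, Measure.count_singleton, smul_eq_mul, mul_one,
      ENNReal.ofReal_pow (by positivity)]
    simp [volume_preimage_cell hL]

/-! ### Sums and integrals under a map that pushes a measure to a multiple of the counting measure
-/

section Transfer

variable {X Z : Type*} [MeasurableSpace X] {μ : Measure X} [MeasurableSpace Z] [Countable Z]
  [MeasurableSingletonClass Z] {g : X → Z} {c : ℝ}

lemma summable_of_integrable_comp (hg : Measurable g) (hc : 0 < c)
    (hmap : Measure.map g μ = ENNReal.ofReal c • Measure.count) {f : Z → ℂ}
    (hf : Integrable (fun x => f (g x)) μ) : Summable f := by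
  have h1 : Integrable f (Measure.map g μ) :=
    (integrable_map_measure (Measurable.of_discrete).aestronglyMeasurable hg.aemeasurable).2 hf
  rw [hmap, integrable_smul_measure (by simpa using hc) ENNReal.ofReal_ne_top,
    integrable_count_iff] at h1
  exact h1.of_norm

lemma tsum_eq_integral_comp (hg : Measurable g) (hc : 0 < c)
    (hmap : Measure.map g μ = ENNReal.ofReal c • Measure.count) {f : Z → ℂ}
    (hf : Integrable (fun x => f (g x)) μ) : (c : ℂ) * ∑' z, f z = ∫ x, f (g x) ∂μ := by
  have h0 : Integrable f (Measure.map g μ) :=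
    (integrable_map_measure (Measurable.of_discrete).aestronglyMeasurable hg.aemeasurable).2 hf
  have h1 : ∫ x, f (g x) ∂μ = ∫ z, f z ∂(Measure.map g μ) :=
    (integral_map hg.aemeasurable (Measurable.of_discrete).aestronglyMeasurable).symm
  rw [h1, integral_countable h0, ← tsum_mul_left]
  refine tsum_congr fun z => ?_
  rw [Measure.real, hmap, Measure.smul_apply, Measure.count_singleton, smul_eq_mul, mul_one,
    ENNReal.toReal_ofReal hc.le, Complex.real_smul]

end Transfer

/-- The lattice point of the cell containing `k`. -/
def snap (L : ℝ) (k : Mom d) : Mom d := latticePt L (cell L k)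

lemma norm_snap_sub_le (hL : 0 < L) (k : Mom d) : ‖snap L k - k‖ ≤ Real.sqrt d * spacing L := by
  have h := spacing_pos hL
  rw [EuclideanSpace.norm_eq]
  have h1 : ∀ i, ‖(snap L k - k).ofLp i‖ ^ 2 ≤ spacing L ^ 2 := fun i => by
    have h2 := (cell_eq_iff hL k (cell L k)).1 rfl i
    have h3 : (snap L k - k).ofLp i = spacing L * cell L k i - k i := rfl
    rw [h3, Real.norm_eq_abs]
    have h4 : |spacing L * (cell L k i : ℝ) - k i| ≤ spacing L := by
      rw [abs_le]
      constructor <;> linarith [h2.1, h2.2]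
    gcongr
  calc Real.sqrt (∑ i, ‖(snap L k - k).ofLp i‖ ^ 2) ≤ Real.sqrt (∑ _i : Fin d, spacing L ^ 2) :=
        Real.sqrt_le_sqrt (Finset.sum_le_sum fun i _ => h1 i)
    _ = _ := by
      rw [Finset.sum_const, Finset.card_univ, Fintype.card_fin, nsmul_eq_mul,
        Real.sqrt_mul (Nat.cast_nonneg d), Real.sqrt_sq h.le]

lemma tendsto_spacing : Tendsto spacing atTop (𝓝 0) :=
  tendsto_const_nhds.div_atTop tendsto_id

lemma tendsto_snap (k : Mom d) : Tendsto (fun L => snap L k) atTop (𝓝 k) := by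
  rw [tendsto_iff_norm_sub_tendsto_zero]
  have h1 : Tendsto (fun L => Real.sqrt d * spacing L) atTop (𝓝 0) := by
    simpa using tendsto_spacing.const_mul (Real.sqrt d)
  refine squeeze_zero' (Eventually.of_forall fun L => norm_nonneg _) ?_ h1
  filter_upwards [eventually_gt_atTop 0] with L hL
  exact norm_snap_sub_le hL k

/-- The loss incurred when a weight is moved to a lattice point. -/
def snapConst (d : ℕ) (L : ℝ) : ℝ := (1 + Real.sqrt d * spacing L) ^ (d + 5)

lemma snapConst_pos (hL : 0 < L) : 0 < snapConst d L := by
  have := spacing_pos hL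
  unfold snapConst; positivity

lemma wt_snap_le (hL : 0 < L) (k : Mom d) :
    wt (d + 5) (snap L k) ≤ snapConst d L * wt (d + 5) k := by
  refine (wt_le_of_dist _ _ k).trans ?_
  have := wt_pos (d + 5) k
  unfold snapConst
  gcongr
  exact norm_snap_sub_le hL k

lemma snapConst_le (hL : 1 ≤ L) : snapConst d L ≤ snapConst d 1 := by
  unfold snapConst spacing
  gcongr

end Lattice

/-! ### The recollision function in a finite box -/

section Theta

variable {d n N : ℕ} {K ρ C₅ t L : ℝ} {e ω Q : Mom d → ℝ} {β μ : ℝ}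

local notation "Mv" => vertexWeight ω Q β μ

lemma Regular.vertex_snap_le (H : Regular d K ρ C₅ e ω Mv) (hL : 0 < L) (k : Mom d) (σ : ℤˣ) :
    Mv (snap L k) σ ≤ K * snapConst d L * wt (d + 5) k := by
  refine (H.M_le _ σ).trans ?_
  rw [mul_assoc]
  have := H.one_le
  exact mul_le_mul_of_nonneg_left (wt_snap_le hL k) (by linarith)

lemma integrable_wt_add_five : Integrable (wt (d := d) (d + 5)) := integrable_wt' (by omega)

lemma Regular.norm_phase_snap_le (H : Regular d K ρ C₅ e ω Mv) (hL : 0 < L) (x : ℝ) (k : Mom d)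
    (σ : ℤˣ) : ‖Complex.exp (-Complex.I * (x : ℂ)) * (Mv (snap L k) σ : ℂ)‖ ≤
      K * snapConst d L * wt (d + 5) k :=
  (H.norm_phase_mul_le x _ σ).trans (H.vertex_snap_le hL k σ)

/-- No regularity of `f` is needed, because the map factors through the countable discrete lattice.
-/
lemma measurable_comp_snap (L : ℝ) (f : Mom d → ℂ) : Measurable fun k => f (snap L k) := by
  have h : Measurable fun z : Fin d → ℤ => f (latticePt L z) := Measurable.of_discrete
  have h2 := h.comp (measurable_cell (d := d) L)
  exact h2

/-- The normalization `L^{-d}` is `(2π)^{-d/2}` times the volume of a cell; the first factor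
survives in the limit. -/
lemma inv_pow_mul_eq (hL : 0 < L) (d : ℕ) (x : ℂ) : ((L : ℂ) ^ d)⁻¹ * x =
    ((Real.sqrt (2 * Real.pi) : ℝ) : ℂ)⁻¹ ^ d * (((spacing L ^ d : ℝ) : ℂ) * x) := by
  have h1 : ((Real.sqrt (2 * Real.pi) : ℝ) : ℂ) ≠ 0 := by
    rw [Ne, Complex.ofReal_eq_zero]
    have := one_le_sqrt_two_pi
    linarith
  have h2 : (L : ℂ) ≠ 0 := by exact_mod_cast hL.ne'
  have h3 : ((spacing L : ℝ) : ℂ) = ((Real.sqrt (2 * Real.pi) : ℝ) : ℂ) * (L : ℂ)⁻¹ := by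
    rw [spacing, Complex.ofReal_div, div_eq_mul_inv]
  rw [Complex.ofReal_pow, h3, ← mul_assoc, ← mul_pow, inv_mul_cancel_left₀ h1, inv_pow]

lemma Regular.Theta_eq (H : Regular d K ρ C₅ e ω Mv) (hL : 0 < L) (s : ℝ) (p : Mom d) (Ω : ℝ) :
    Theta e ω Q β μ L s p Ω = ∑ σ : ℤˣ, ((Real.sqrt (2 * Real.pi) : ℝ) : ℂ)⁻¹ ^ d * ∫ k : Mom d,
      Complex.exp (-Complex.I * ((s * (Phi e ω σ p (snap L k) + Ω) : ℝ) : ℂ)) *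
        (Mv (snap L k) σ : ℂ) := by
  have h := spacing_pos hL
  refine Finset.sum_congr rfl fun σ _ => ?_
  rw [inv_pow_mul_eq hL]
  congr 1
  refine tsum_eq_integral_comp (measurable_cell L) (by positivity) (map_cell hL)
    (f := fun z => Complex.exp (-Complex.I * ((s * (Phi e ω σ p (latticePt L z) + Ω) : ℝ) : ℂ)) *
      (Mv (latticePt L z) σ : ℂ)) ?_
  exact (integrable_wt_add_five.const_mul (K * snapConst d L)).mono'
    (measurable_comp_snap L fun k => Complex.exp (-Complex.I * ((s * (Phi e ω σ p k + Ω) : ℝ) : ℂ)) *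
      (Mv k σ : ℂ)).aestronglyMeasurable
    (ae_of_all _ fun k => H.norm_phase_snap_le hL _ k σ)

/-- A bound on the recollision function in the box of size `L`. -/
def thetaBound (d : ℕ) (K L : ℝ) : ℝ :=
  max 1 (2 * (K * snapConst d L * ∫ k : Mom d, wt (d + 5) k))

lemma Regular.norm_Theta_le (H : Regular d K ρ C₅ e ω Mv) (hL : 0 < L) (s : ℝ) (p : Mom d)
    (Ω : ℝ) : ‖Theta e ω Q β μ L s p Ω‖ ≤ thetaBound d K L := by
  rw [H.Theta_eq hL]
  refine le_trans ?_ (le_max_right _ _)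
  refine (norm_sum_le _ _).trans ?_
  have h1 : ∀ σ ∈ (Finset.univ : Finset ℤˣ), ‖((Real.sqrt (2 * Real.pi) : ℝ) : ℂ)⁻¹ ^ d *
      ∫ k : Mom d, Complex.exp (-Complex.I * ((s * (Phi e ω σ p (snap L k) + Ω) : ℝ) : ℂ)) *
        (Mv (snap L k) σ : ℂ)‖ ≤ K * snapConst d L * ∫ k : Mom d, wt (d + 5) k := fun σ _ => by
    rw [norm_mul]
    refine (mul_le_of_le_one_left (norm_nonneg _) (norm_sqrt_two_pi_inv_pow_le d)).trans ?_
    rw [← integral_const_mul]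
    exact norm_integral_le_of_norm_le (integrable_wt_add_five.const_mul _)
      (ae_of_all _ fun k => H.norm_phase_snap_le hL _ k σ)
  refine (Finset.sum_le_sum h1).trans (le_of_eq ?_)
  rw [Finset.sum_const, Finset.card_univ, Fintype.card_units_int, nsmul_eq_mul]
  norm_num

lemma Regular.continuous_Theta (H : Regular d K ρ C₅ e ω Mv) (hL : 0 < L) (p : Mom d) (Ω : ℝ) :
    Continuous fun s => Theta e ω Q β μ L s p Ω := by
  simp only [H.Theta_eq hL]
  refine continuous_finsetSum _ fun σ _ => continuous_const.mul ?_
  refine continuous_of_dominated (bound := fun k => K * snapConst d L * wt (d + 5) k)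
    (fun s => (measurable_comp_snap L fun k =>
      Complex.exp (-Complex.I * ((s * (Phi e ω σ p k + Ω) : ℝ) : ℂ)) *
      (Mv k σ : ℂ)).aestronglyMeasurable)
    (fun s => ae_of_all _ fun k => H.norm_phase_snap_le hL _ k σ)
    (integrable_wt_add_five.const_mul _) (ae_of_all _ fun k => ?_)
  fun_prop

lemma thetaBound_le (hK : 0 ≤ K) (hL : 1 ≤ L) : thetaBound d K L ≤ thetaBound d K 1 := by
  unfold thetaBound
  have h1 : 0 ≤ ∫ k : Mom d, wt (d + 5) k := integral_nonneg fun k => (wt_pos _ k).le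
  gcongr
  exact snapConst_le hL

lemma one_le_thetaBound (d : ℕ) (K L : ℝ) : 1 ≤ thetaBound d K L := le_max_left _ _

variable {ι : Type*} {l : Filter ι} {Λ : ι → ℝ}

lemma tendsto_snap_comp (hΛ : Tendsto Λ l atTop) (k : Mom d) :
    Tendsto (fun i => snap (Λ i) k) l (𝓝 k) := (tendsto_snap k).comp hΛ

/-- Momentum and energy may move with the index, since inside a history they are lattice values that
converge together with `L`. The decay in `s` is not claimed for finite boxes; only the limit has to
satisfy it. -/
lemma Regular.tendsto_Theta [l.IsCountablyGenerated] (H : Regular d K ρ C₅ e ω Mv) (hΛ : Tendsto Λ l atTop) (s : ℝ)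
    {p : ι → Mom d} {p₀ : Mom d} (hp : Tendsto p l (𝓝 p₀)) {Ω : ι → ℝ} {Ω₀ : ℝ}
    (hΩ : Tendsto Ω l (𝓝 Ω₀)) :
    Tendsto (fun i => Theta e ω Q β μ (Λ i) s (p i) (Ω i)) l
      (𝓝 (thetaLim e ω Mv s p₀ Ω₀)) := by
  have hK := H.one_le
  have hL : ∀ᶠ i in l, 1 ≤ Λ i := hΛ.eventually (eventually_ge_atTop 1)
  have h1 : Tendsto (fun i => ∑ σ : ℤˣ, ((Real.sqrt (2 * Real.pi) : ℝ) : ℂ)⁻¹ ^ d * ∫ k : Mom d,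
      Complex.exp (-Complex.I * ((s * (Phi e ω σ (p i) (snap (Λ i) k) + Ω i) : ℝ) : ℂ)) *
        (Mv (snap (Λ i) k) σ : ℂ)) l (𝓝 (thetaLim e ω Mv s p₀ Ω₀)) := by
    refine tendsto_finsetSum _ fun σ _ => Tendsto.const_mul _ ?_
    refine tendsto_integral_filter_of_dominated_convergence
      (fun k => K * snapConst d 1 * wt (d + 5) k) (Eventually.of_forall fun i => ?_) ?_
      (integrable_wt_add_five.const_mul _) (ae_of_all _ fun k => ?_)
    · exact (measurable_comp_snap (Λ i) fun k =>
        Complex.exp (-Complex.I * ((s * (Phi e ω σ (p i) k + Ω i) : ℝ) : ℂ)) *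
        (Mv k σ : ℂ)).aestronglyMeasurable
    · filter_upwards [hL] with i hi
      refine ae_of_all _ fun k => (H.norm_phase_snap_le (by linarith) _ k σ).trans ?_
      have := wt_pos (d + 5) k
      gcongr
      exact snapConst_le hi
    · have hk := tendsto_snap_comp hΛ k
      have h2 : Tendsto (fun i => Phi e ω σ (p i) (snap (Λ i) k) + Ω i) l
          (𝓝 (Phi e ω σ p₀ k + Ω₀)) := by
        refine Tendsto.add ?_ hΩ
        exact ((H.e_cont.tendsto _).comp (hk.add hp)).add
          (((H.ω_cont.tendsto _).comp hk).const_mul _)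
      have h3 : Tendsto (fun i => Mv (snap (Λ i) k) σ) l (𝓝 (Mv k σ)) :=
        ((H.M_cont σ).tendsto k).comp hk
      have h4 : Continuous fun x : ℝ × ℝ =>
          Complex.exp (-Complex.I * ((s * x.1 : ℝ) : ℂ)) * (x.2 : ℂ) := by fun_prop
      have h5 := (h4.tendsto (Phi e ω σ p₀ k + Ω₀, Mv k σ)).comp (h2.prodMk_nhds h3)
      simpa only [Function.comp_def] using h5
  refine h1.congr' ?_
  filter_upwards [hL] with i hi
  exact (H.Theta_eq (by linarith) s (p i) (Ω i)).symm

end Theta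

end PhononBoltzmann

end

noncomputable section

namespace PhononBoltzmann

/-! ### The infinite volume limit -/

section Limit

variable {d n N : ℕ} {K ρ C₅ t L : ℝ} {e ω Q : Mom d → ℝ} {β μ : ℝ} {m m' : Fin (n + 1) → ℕ}
  {π : Equiv.Perm (Fin n)}

local notation "Mv" => vertexWeight ω Q β μ
local notation "Th" => Theta e ω Q β μ

variable {ι : Type*} {l : Filter ι} {Λ : ι → ℝ}

lemma continuous_energy_joint (he : Continuous e) (hω : Continuous ω) (σ : Fin n → ℤˣ)
    (j : Fin (n + 1)) :
    Continuous fun x : Mom d × (Fin n → Mom d) => energy e ω x.1 x.2 σ j :=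
  (he.comp (continuous_electronMom j)).add ((continuous_phononEnergy hω σ j).comp continuous_snd)

lemma Regular.tendsto_historyWith [l.IsCountablyGenerated] (H : Regular d K ρ C₅ e ω Mv)
    (hΛ : Tendsto Λ l atTop) (ht : 0 ≤ t) (hm : m ∈ patterns n N) {p : ι → Mom d} {p₀ : Mom d}
    (hp : Tendsto p l (𝓝 p₀)) {k : ι → Fin n → Mom d} {k₀ : Fin n → Mom d}
    (hk : Tendsto k l (𝓝 k₀)) (σ : Fin n → ℤˣ) :
    Tendsto (fun i => historyWith (Th (Λ i)) e ω N m t (p i) (k i) σ) l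
      (𝓝 (historyWith (thetaLim e ω Mv) e ω N m t p₀ k₀ σ)) := by
  have hL : ∀ᶠ i in l, 1 ≤ Λ i := hΛ.eventually (eventually_ge_atTop 1)
  have hpk := hp.prodMk_nhds hk
  have hE : ∀ j, Tendsto (fun i => energy e ω (p i) (k i) σ j) l (𝓝 (energy e ω p₀ k₀ σ j)) :=
    fun j => ((continuous_energy_joint H.e_cont H.ω_cont σ j).tendsto (p₀, k₀)).comp hpk
  have hP : ∀ j, Tendsto (fun i => electronMom (p i) (k i) j) l (𝓝 (electronMom p₀ k₀ j)) :=
    fun j => ((continuous_electronMom j).tendsto (p₀, k₀)).comp hpk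
  have hO : ∀ j, Tendsto (fun i => phononEnergy ω (k i) σ j) l (𝓝 (phononEnergy ω k₀ σ j)) :=
    fun j => ((continuous_phononEnergy H.ω_cont σ j).tendsto k₀).comp hk
  have hfin : IsFiniteMeasure
      (volume.restrict {s : Fin N → ℝ | (∀ i, 0 ≤ s i) ∧ ∑ i, s i ≤ t}) :=
    ⟨by
      rw [Measure.restrict_apply_univ]
      exact (volume_simplex_le ht).trans_lt ENNReal.ofReal_lt_top⟩
  have hcons : ∀ b : Fin (N + 1), Continuous fun s : Fin N → ℝ =>
      (Fin.cons (t - ∑ i, s i) s : Fin (N + 1) → ℝ) b := fun b => by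
    refine Fin.cases ?_ (fun j => ?_) b
    · simp only [Fin.cons_zero]; fun_prop
    · simp only [Fin.cons_succ]; fun_prop
  unfold historyWith timeIntegral
  refine tendsto_integral_filter_of_dominated_convergence
    (fun _ => thetaBound d K 1 ^ N) ?_ ?_ (integrable_const _) (ae_of_all _ fun s => ?_)
  · filter_upwards [hL] with i hi
    refine Continuous.aestronglyMeasurable ?_
    refine continuous_finsetProd _ fun j _ => ?_
    refine (continuous_finsetProd _ fun b _ => ?_).mul (continuous_finsetProd _ fun b _ => ?_)
    · have := hcons b
      fun_prop
    · exact (H.continuous_Theta (by linarith) _ _).comp (hcons b)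
  · filter_upwards [hL] with i hi
    refine ae_of_all _ fun s => ?_
    refine norm_historyWith_integrand_le hm (Th (Λ i)) (one_le_thetaBound d K 1)
      (fun b p Ω => ?_) (p i) (k i) σ
    exact (H.norm_Theta_le (by linarith) _ _ _).trans
      (thetaBound_le (by linarith [H.one_le]) hi)
  · refine tendsto_finsetProd _ fun j _ => ?_
    refine Tendsto.mul (tendsto_finsetProd _ fun b _ => ?_) (tendsto_finsetProd _ fun b _ => ?_)
    · have h1 : Continuous fun x : ℝ => Complex.exp (-Complex.I *
          (((Fin.cons (t - ∑ i, s i) s : Fin (N + 1) → ℝ) b * x : ℝ) : ℂ)) := by fun_prop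
      exact (h1.tendsto _).comp (hE j)
    · exact H.tendsto_Theta hΛ _ (hP j) (hO j)

lemma Regular.tendsto_graphDensity [l.IsCountablyGenerated] (H : Regular d K ρ C₅ e ω Mv)
    (hΛ : Tendsto Λ l atTop) (ht : 0 ≤ t) (hm : m ∈ patterns n N) (hm' : m' ∈ patterns n N)
    {p : ι → Mom d} {p₀ : Mom d} (hp : Tendsto p l (𝓝 p₀)) {k : ι → Fin n → Mom d}
    {k₀ : Fin n → Mom d} (hk : Tendsto k l (𝓝 k₀)) :
    Tendsto (fun i => graphDensity (Th (Λ i)) e ω Mv N m m' π t (p i) (k i)) l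
      (𝓝 (graphDensity (thetaLim e ω Mv) e ω Mv N m m' π t p₀ k₀)) := by
  have hk' : ∀ j, Tendsto (fun i => k i j) l (𝓝 (k₀ j)) := tendsto_pi_nhds.1 hk
  refine tendsto_finsetSum _ fun σ _ => ?_
  refine Tendsto.mul (tendsto_finsetProd _ fun j _ => ?_) (Tendsto.mul ?_ ?_)
  · exact ((Complex.continuous_ofReal.comp (H.M_cont (σ j))).tendsto _).comp (hk' j)
  · exact H.tendsto_historyWith hΛ ht hm hp hk σ
  · exact (Complex.continuous_conj.tendsto _).comp (H.tendsto_historyWith hΛ ht hm' hp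
      (tendsto_pi_nhds.2 fun j => hk' (π.symm j)) _)

/-- The bound on the density of a graph in a finite box, as a function of the momenta. -/
def densityBound (d n N : ℕ) (K t L : ℝ) (k : Fin n → Mom d) : ℝ :=
  2 ^ n * (thetaBound d K L ^ N * t ^ N) ^ 2 * ∏ j, (K * snapConst d L * wt (d + 5) (k j))

lemma norm_graphDensity_le_prod {θ : ℝ → Mom d → ℝ → ℂ} {M : Mom d → ℤˣ → ℝ} {C : ℝ} (hC : 1 ≤ C)
    (hθ : ∀ s, 0 ≤ s → ∀ p Ω, ‖θ s p Ω‖ ≤ C) (ht : 0 ≤ t) (hm : m ∈ patterns n N)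
    (hm' : m' ∈ patterns n N) (p : Mom d) (k : Fin n → Mom d) {a : Fin n → ℝ}
    (ha : ∀ j σ, |M (k j) σ| ≤ a j) :
    ‖graphDensity θ e ω M N m m' π t p k‖ ≤ 2 ^ n * (C ^ N * t ^ N) ^ 2 * ∏ j, a j := by
  refine (norm_sum_le _ _).trans ?_
  have h1 : ∀ σ ∈ (Finset.univ : Finset (Fin n → ℤˣ)),
      ‖(∏ j, (M (k j) (σ j) : ℂ)) * (historyWith θ e ω N m t p k σ *
        conj (historyWith θ e ω N m' t p (fun j => k (π.symm j)) fun j => σ (π.symm j)))‖ ≤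
      (∏ j, a j) * (C ^ N * t ^ N) ^ 2 := fun σ _ => by
    rw [norm_mul, norm_mul, norm_prod, sq, Complex.norm_conj]
    refine mul_le_mul (Finset.prod_le_prod (fun _ _ => norm_nonneg _) fun j _ => ?_)
      (mul_le_mul (norm_historyWith_le hm ht hC hθ _ _ _) (norm_historyWith_le hm' ht hC hθ _ _ _)
        (norm_nonneg _) (by positivity)) (by positivity)
      (Finset.prod_nonneg fun j _ => (abs_nonneg _).trans (ha j (σ j)))
    rw [Complex.norm_real, Real.norm_eq_abs]
    exact ha j (σ j)
  refine (Finset.sum_le_sum h1).trans (le_of_eq ?_)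
  rw [Finset.sum_const, Finset.card_univ, Fintype.card_fun, Fintype.card_units_int,
    Fintype.card_fin, nsmul_eq_mul]
  push_cast
  ring

lemma Regular.norm_graphDensity_le (H : Regular d K ρ C₅ e ω Mv) (hL : 0 < L) (ht : 0 ≤ t)
    (hm : m ∈ patterns n N) (hm' : m' ∈ patterns n N) (p : Mom d) (k : Fin n → Mom d) :
    ‖graphDensity (Th L) e ω Mv N m m' π t p (fun j => snap L (k j))‖ ≤
      densityBound d n N K t L k :=
  norm_graphDensity_le_prod (one_le_thetaBound d K L) (fun s _ p Ω => H.norm_Theta_le hL s p Ω)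
    ht hm hm' p _ fun j σ => by
      rw [abs_of_nonneg (H.M_nonneg _ _)]
      exact H.vertex_snap_le hL _ _

lemma integrable_densityBound : Integrable (densityBound d n N K t L) :=
  (Integrable.fintype_prod (f := fun (_ : Fin n) (k : Mom d) => K * snapConst d L * wt (d + 5) k)
    fun _ => integrable_wt_add_five.const_mul _).const_mul _

lemma densityBound_le (hK : 0 ≤ K) (ht : 0 ≤ t) (hL : 1 ≤ L) (k : Fin n → Mom d) :
    densityBound d n N K t L k ≤ densityBound d n N K t 1 k := by
  have h0 : 0 ≤ thetaBound d K L := zero_le_one.trans (one_le_thetaBound d K L)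
  have h1 := snapConst_pos (d := d) (show 0 < L by linarith)
  have h2 := thetaBound_le (d := d) hK hL
  have h3 := snapConst_le (d := d) hL
  have h4 := fun k : Mom d => (wt_pos (d + 5) k).le
  unfold densityBound
  gcongr
  all_goals first
    | exact h4 _
    | exact Finset.prod_nonneg fun j _ => mul_nonneg (by positivity) (h4 _)
    | exact fun j _ => mul_nonneg (by positivity) (h4 _)

/-- The amplitude of a graph with incoming momentum `p` in the box of size `L`. -/
def graphBox (e ω Q : Mom d → ℝ) (β μ L : ℝ) (N : ℕ) (m m' : Fin (n + 1) → ℕ)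
    (π : Equiv.Perm (Fin n)) (t : ℝ) (p : Mom d) : ℂ :=
  (((Real.sqrt (2 * Real.pi) : ℝ) : ℂ)⁻¹ ^ d) ^ n *
    ∫ k : Fin n → Mom d, graphDensity (Theta e ω Q β μ L) e ω (vertexWeight ω Q β μ) N m m' π t p
      fun j => snap L (k j)

lemma measurable_graphDensity_snap (L : ℝ) (θ : ℝ → Mom d → ℝ → ℂ) (M : Mom d → ℤˣ → ℝ)
    (p : Mom d) :
    Measurable fun k : Fin n → Mom d =>
      graphDensity θ e ω M N m m' π t p fun j => snap L (k j) := by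
  have h : Measurable fun z : Fin n → Fin d → ℤ =>
      graphDensity θ e ω M N m m' π t p fun j => latticePt L (z j) := Measurable.of_discrete
  exact h.comp (measurable_cells (d := d) (n := n) L)

lemma Regular.integrable_graphDensity_snap (H : Regular d K ρ C₅ e ω Mv) (hL : 0 < L)
    (ht : 0 ≤ t) (hm : m ∈ patterns n N) (hm' : m' ∈ patterns n N) (p : Mom d) :
    Integrable fun k : Fin n → Mom d =>
      graphDensity (Th L) e ω Mv N m m' π t p fun j => snap L (k j) :=
  integrable_densityBound.mono' (measurable_graphDensity_snap L _ _ p).aestronglyMeasurable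
    (ae_of_all _ fun k => H.norm_graphDensity_le hL ht hm hm' p k)

/-- The limit is taken jointly in the size of the box and the incoming momentum, which amounts to
local uniformity in the momentum. -/
lemma Regular.tendsto_graphBox (H : Regular d K ρ C₅ e ω Mv) (ht : 0 ≤ t)
    (hm : m ∈ patterns n N) (hm' : m' ∈ patterns n N) (p₀ : Mom d) :
    Tendsto (fun x : ℝ × Mom d => graphBox e ω Q β μ x.1 N m m' π t x.2) (atTop ×ˢ 𝓝 p₀)
      (𝓝 (graphLim e ω Mv N m m' π t p₀)) := by
  have hΛ : Tendsto (fun x : ℝ × Mom d => x.1) (atTop ×ˢ 𝓝 p₀) atTop := tendsto_fst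
  have hL : ∀ᶠ x : ℝ × Mom d in atTop ×ˢ 𝓝 p₀, 1 ≤ x.1 :=
    hΛ.eventually (eventually_ge_atTop 1)
  refine Tendsto.const_mul _ ?_
  refine tendsto_integral_filter_of_dominated_convergence (densityBound d n N K t 1)
    (Eventually.of_forall fun x => (measurable_graphDensity_snap x.1 _ _ x.2).aestronglyMeasurable)
    ?_ integrable_densityBound (ae_of_all _ fun k => ?_)
  · filter_upwards [hL] with x hx
    exact ae_of_all _ fun k => (H.norm_graphDensity_le (by linarith) ht hm hm' x.2 k).trans
      (densityBound_le (by linarith [H.one_le]) ht hx k)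
  · exact H.tendsto_graphDensity hΛ ht hm hm' tendsto_snd
      (tendsto_pi_nhds.2 fun j => tendsto_snap_comp hΛ (k j))

lemma Regular.norm_graphBox_le (H : Regular d K ρ C₅ e ω Mv) (ht : 0 ≤ t) (hL : 1 ≤ L)
    (hm : m ∈ patterns n N) (hm' : m' ∈ patterns n N) (p : Mom d) :
    ‖graphBox e ω Q β μ L N m m' π t p‖ ≤ ∫ k, densityBound d n N K t 1 k := by
  rw [graphBox, norm_mul, norm_pow]
  refine (mul_le_of_le_one_left (norm_nonneg _)
    (pow_le_one₀ (norm_nonneg _) (norm_sqrt_two_pi_inv_pow_le d))).trans ?_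
  exact norm_integral_le_of_norm_le integrable_densityBound (ae_of_all _ fun k =>
    (H.norm_graphDensity_le (by linarith) ht hm hm' p k).trans
      (densityBound_le (by linarith [H.one_le]) ht hL k))

/-- Uniformity over all momenta comes from two regimes: on a closed ball compactness applies to the
joint limit; outside, the crude bound `A` is beaten by the growth of `b⟨p⟩⁴`. The radius `A/b` is
where this happens, and the factor `2` gives the strict inequality needed for an open condition. -/
lemma Regular.eventually_norm_graphBox_le (H : Regular d K ρ C₅ e ω Mv) (ht : 0 ≤ t)
    (hm : m ∈ patterns n N) (hm' : m' ∈ patterns n N) {b : ℝ} (hb : 0 < b)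
    (hlim : ∀ p, ‖graphLim e ω Mv N m m' π t p‖ ≤ b * bracket p ^ 4) :
    ∀ᶠ L in atTop, ∀ p, ‖graphBox e ω Q β μ L N m m' π t p‖ ≤ 2 * b * bracket p ^ 4 := by
  set A := ∫ k, densityBound d n N K t 1 k with hA
  set S : Set (ℝ × Mom d) := {x | ‖graphBox e ω Q β μ x.1 N m m' π t x.2‖ < 2 * b * bracket x.2 ^ 4}
    with hS
  have h1 : ∀ p₀ ∈ Metric.closedBall (0 : Mom d) (A / b), S ∈ atTop ×ˢ 𝓝 p₀ := fun p₀ _ => by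
    have h2 := (H.tendsto_graphBox (π := π) ht hm hm' p₀).norm
    have h3 : Tendsto (fun x : ℝ × Mom d => 2 * b * bracket x.2 ^ 4) (atTop ×ˢ 𝓝 p₀)
        (𝓝 (2 * b * bracket p₀ ^ 4)) :=
      ((((continuous_bracket (d := d)).pow 4).const_mul (2 * b)).tendsto p₀).comp tendsto_snd
    refine h2.eventually_lt h3 ((hlim p₀).trans_lt ?_)
    have := bracket_pos p₀
    have h4 : 0 < b * bracket p₀ ^ 4 := by positivity
    linarith
  have h2 := (isCompact_closedBall (0 : Mom d) (A / b)).mem_prod_nhdsSet_of_forall h1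
  have h3 : ∀ᶠ x in atTop ×ˢ 𝓝ˢ (Metric.closedBall (0 : Mom d) (A / b)), x ∈ S := h2
  filter_upwards [h3.curry, eventually_ge_atTop 1] with L hL hL1 p
  by_cases hp : p ∈ Metric.closedBall (0 : Mom d) (A / b)
  · exact (hL.self_of_nhdsSet p hp).le
  · refine (H.norm_graphBox_le ht hL1 hm hm' p).trans ?_
    have hp' : A / b < ‖p‖ := by simpa using hp
    have h4 := norm_le_bracket p
    have h5 : bracket p ≤ bracket p ^ 4 := le_self_pow₀ (one_le_bracket p) (by norm_num)
    rw [div_lt_iff₀ hb] at hp'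
    have h6 : ‖p‖ * b ≤ bracket p ^ 4 * b := by gcongr; exact h4.trans h5
    have h7 : 0 < bracket p ^ 4 * b := by have := bracket_pos p; positivity
    linarith

end Limit

/-! ### Finite boxes -/

section Box

variable {d n N : ℕ} {K ρ C₅ t L : ℝ} {e ω Q : Mom d → ℝ} {β μ : ℝ} {m m' : Fin (n + 1) → ℕ}
  {π : Equiv.Perm (Fin n)} {γ : ElectronSpace d →L[ℂ] ElectronSpace d}

local notation "Mv" => vertexWeight ω Q β μ
local notation "Th" => Theta e ω Q β μ

/-- The momentum distribution of the electron. -/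
def occupation (γ : ElectronSpace d →L[ℂ] ElectronSpace d) (z : Fin d → ℤ) : ℂ :=
  inner ℂ (planeWave z) (γ (planeWave z))

lemma IsDensityMatrix.occupation_eq (hγ : IsDensityMatrix γ) (z : Fin d → ℤ) :
    0 ≤ (occupation γ z).re ∧ ((occupation γ z).re : ℂ) = occupation γ z := by
  have h := hγ.positive.inner_nonneg_right (planeWave z)
  obtain ⟨h1, h2⟩ := Complex.nonneg_iff.1 h
  exact ⟨h1, Complex.ext (by simp [occupation]) (by simpa [occupation] using h2)⟩

lemma IsDensityMatrix.enorm_occupation (hγ : IsDensityMatrix γ) (z : Fin d → ℤ) :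
    ‖occupation γ z‖ₑ = ENNReal.ofReal (occupation γ z).re := by
  rw [← (hγ.occupation_eq z).2, enorm_ofReal_of_nonneg (hγ.occupation_eq z).1, Complex.ofReal_re]

lemma momKernel_eq (L : ℝ) (z : Fin d → ℤ) : momKernel L γ z z = (L : ℂ) ^ d * occupation γ z := rfl

lemma graphSummand_eq (x : (Fin n → Fin d → ℤ) × (Fin d → ℤ)) :
    graphSummand e ω Q β μ L γ N m m' π t x =
      (L : ℂ) ^ d * occupation γ x.2 *
        graphDensity (Th L) e ω Mv N m m' π t (latticePt L x.2) (fun j => latticePt L (x.1 j)) := by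
  rw [graphSummand, graphDensity, Finset.mul_sum]
  refine Finset.sum_congr rfl fun σ _ => ?_
  rw [graphAmplitude, history_eq, history_eq, momKernel_eq]
  ring

lemma Regular.tsum_graphDensity (H : Regular d K ρ C₅ e ω Mv) (hL : 0 < L)
    (ht : 0 ≤ t) (hm : m ∈ patterns n N) (hm' : m' ∈ patterns n N) (p : Mom d) :
    (((spacing L ^ d) ^ n : ℝ) : ℂ) * ∑' z : Fin n → Fin d → ℤ,
      graphDensity (Th L) e ω Mv N m m' π t p (fun j => latticePt L (z j)) =
      ∫ k : Fin n → Mom d, graphDensity (Th L) e ω Mv N m m' π t p fun j => snap L (k j) := by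
  have h := spacing_pos hL
  exact tsum_eq_integral_comp (measurable_cells L) (by positivity) (map_cells hL)
    (f := fun z => graphDensity (Th L) e ω Mv N m m' π t p (fun j => latticePt L (z j)))
    (H.integrable_graphDensity_snap hL ht hm hm' p)

lemma summable_wt_latticePt (hL : 0 < L) :
    Summable fun z : Fin n → Fin d → ℤ => ∏ j, wt (d + 5) (latticePt L (z j)) := by
  have h := spacing_pos hL
  have h1 : Summable fun z : Fin n → Fin d → ℤ =>
      ((∏ j, wt (d + 5) (latticePt L (z j)) : ℝ) : ℂ) := by
    refine summable_of_integrable_comp (measurable_cells L) (by positivity) (map_cells hL) ?_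
    have h2 : Measurable fun z : Fin n → Fin d → ℤ =>
      ((∏ j, wt (d + 5) (latticePt L (z j)) : ℝ) : ℂ) := Measurable.of_discrete
    refine ((Integrable.fintype_prod (f := fun (_ : Fin n) (k : Mom d) =>
      snapConst d L * wt (d + 5) k) fun _ => integrable_wt_add_five.const_mul _).mono'
      (h2.comp (measurable_cells L)).aestronglyMeasurable (ae_of_all _ fun k => ?_))
    rw [Complex.norm_real, Real.norm_eq_abs,
      abs_of_nonneg (Finset.prod_nonneg fun j _ => (wt_pos _ _).le)]
    exact Finset.prod_le_prod (fun j _ => (wt_pos _ _).le) fun j _ => wt_snap_le hL (k j)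
  exact_mod_cast h1

lemma Regular.norm_graphDensity_latticePt_le (H : Regular d K ρ C₅ e ω Mv) (hL : 0 < L) (ht : 0 ≤ t)
    (hm : m ∈ patterns n N) (hm' : m' ∈ patterns n N) (p : Mom d) (k : Fin n → Mom d) :
    ‖graphDensity (Th L) e ω Mv N m m' π t p k‖ ≤
      2 ^ n * (thetaBound d K L ^ N * t ^ N) ^ 2 * K ^ n * ∏ j, wt (d + 5) (k j) := by
  refine (norm_graphDensity_le_prod (one_le_thetaBound d K L)
    (fun s _ p Ω => H.norm_Theta_le hL s p Ω) ht hm hm' p k (a := fun j => K * wt (d + 5) (k j))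
    fun j σ => ?_).trans (le_of_eq ?_)
  · rw [abs_of_nonneg (H.M_nonneg _ _)]
    exact H.M_le _ _
  · rw [Finset.prod_mul_distrib, Finset.prod_const, Finset.card_univ, Fintype.card_fin]
    ring

lemma Regular.summable_graphSummand (H : Regular d K ρ C₅ e ω Mv) (hL : 0 < L) (ht : 0 ≤ t)
    (hm : m ∈ patterns n N) (hm' : m' ∈ patterns n N) (hγ : IsDensityMatrix γ) :
    Summable (graphSummand e ω Q β μ L γ N m m' π t) := by
  have h1 : Summable fun z : Fin d → ℤ => ‖occupation γ z‖ := hγ.trace_one.summable.norm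
  have h2 := (summable_wt_latticePt (d := d) (n := n) hL).mul_of_nonneg h1
    (fun z => Finset.prod_nonneg fun j _ => (wt_pos _ _).le) fun z => norm_nonneg _
  refine Summable.of_norm_bounded (h2.mul_left
    (L ^ d * (2 ^ n * (thetaBound d K L ^ N * t ^ N) ^ 2 * K ^ n))) fun x => ?_
  rw [graphSummand_eq, norm_mul, norm_mul, norm_pow, Complex.norm_real, Real.norm_eq_abs,
    abs_of_pos hL]
  calc L ^ d * ‖occupation γ x.2‖ * ‖graphDensity (Th L) e ω Mv N m m' π t (latticePt L x.2)
          fun j => latticePt L (x.1 j)‖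
      ≤ L ^ d * ‖occupation γ x.2‖ * (2 ^ n * (thetaBound d K L ^ N * t ^ N) ^ 2 * K ^ n *
          ∏ j, wt (d + 5) (latticePt L (x.1 j))) := by
        gcongr
        exact H.norm_graphDensity_latticePt_le hL ht hm hm' _ _
    _ = _ := by ring

lemma tsum_prod_swap {A B : Type*} {f : A × B → ℂ} (hf : Summable f) :
    ∑' x, f x = ∑' b, ∑' a, f (a, b) := by
  rw [← (Equiv.prodComm B A).tsum_eq f]
  exact ((Equiv.prodComm B A).summable_iff.2 hf).tsum_prod

/-- Of the `n + 1` factors `L^{-d}`, one cancels the normalization of the momentum kernel, and the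
others turn the sums over the exchanged momenta into integrals. -/
lemma Regular.tsum_graphSummand (H : Regular d K ρ C₅ e ω Mv) (hL : 0 < L) (ht : 0 ≤ t)
    (hm : m ∈ patterns n N) (hm' : m' ∈ patterns n N) (z : Fin d → ℤ) :
    ((L : ℂ) ^ d)⁻¹ ^ (n + 1) * ∑' a, graphSummand e ω Q β μ L γ N m m' π t (a, z) =
      occupation γ z * graphBox e ω Q β μ L N m m' π t (latticePt L z) := by
  have hL0 : (L : ℂ) ^ d ≠ 0 := pow_ne_zero _ (by exact_mod_cast hL.ne')
  simp only [graphSummand_eq]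
  rw [tsum_mul_left, graphBox, ← H.tsum_graphDensity hL ht hm hm']
  have h1 := inv_pow_mul_eq hL d 1
  rw [mul_one, mul_one] at h1
  rw [Complex.ofReal_pow (spacing L ^ d)]
  generalize (∑' z' : Fin n → Fin d → ℤ, graphDensity (Th L) e ω Mv N m m' π t (latticePt L z)
    (fun j => latticePt L (z' j))) = y
  rw [h1, pow_succ, mul_pow, ← h1]
  generalize ((Real.sqrt (2 * Real.pi) : ℝ) : ℂ)⁻¹ ^ d = a
  generalize ((spacing L ^ d : ℝ) : ℂ) = b
  generalize (L : ℂ) ^ d = c at hL0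
  generalize occupation γ z = w
  calc a ^ n * b ^ n * c⁻¹ * (c * w * y) = (c⁻¹ * c) * (w * (a ^ n * (b ^ n * y))) := by ring
    _ = _ := by rw [inv_mul_cancel₀ hL0, one_mul]

lemma Regular.graphValue_eq (H : Regular d K ρ C₅ e ω Mv) (hL : 0 < L) (ht : 0 ≤ t)
    (hm : m ∈ patterns n N) (hm' : m' ∈ patterns n N) (hγ : IsDensityMatrix γ) (lam : ℝ) :
    graphValue e ω Q β μ L γ lam N m m' π t = (lam : ℂ) ^ (2 * N) *
      ∑' z : Fin d → ℤ, occupation γ z * graphBox e ω Q β μ L N m m' π t (latticePt L z) := by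
  rw [graphValue, mul_assoc, tsum_prod_swap (H.summable_graphSummand (π := π) hL ht hm hm' hγ),
    ← tsum_mul_left]
  simp only [H.tsum_graphSummand hL ht hm hm']

/-- By positivity of the density matrix the occupations are nonnegative, so the sum over `p` is a
fourth moment, which is dominated by the assumed moment of order `3d + 12`. -/
lemma Regular.enorm_graphValue_le (H : Regular d K ρ C₅ e ω Mv) (hL : 0 < L) (ht : 0 ≤ t)
    (hm : m ∈ patterns n N) (hm' : m' ∈ patterns n N) (hγ : IsDensityMatrix γ) (lam : ℝ) {b : ℝ}
    (hb : 0 ≤ b)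
    (hbox : ∀ p, ‖graphBox e ω Q β μ L N m m' π t p‖ ≤ b * bracket p ^ 4) :
    ‖graphValue e ω Q β μ L γ lam N m m' π t‖ₑ ≤
      ENNReal.ofReal ((lam ^ 2) ^ N * b) * momentumMoment L γ := by
  have h1 : ‖(lam : ℂ) ^ (2 * N)‖ₑ = ENNReal.ofReal ((lam ^ 2) ^ N) := by
    rw [← ofReal_norm, norm_pow, Complex.norm_real, Real.norm_eq_abs, pow_mul, sq_abs]
  rw [H.graphValue_eq hL ht hm hm' hγ, enorm_mul, h1, ENNReal.ofReal_mul (by positivity), mul_assoc]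
  gcongr
  rw [momentumMoment, ← ENNReal.tsum_mul_left]
  refine enorm_tsum_le_tsum_enorm.trans (ENNReal.tsum_le_tsum fun z => ?_)
  obtain ⟨h2, h3⟩ := hγ.occupation_eq z
  have h4 : (momKernel L γ z z).re = L ^ d * (occupation γ z).re := by
    rw [momKernel_eq, ← h3, ← Complex.ofReal_pow, ← Complex.ofReal_mul, Complex.ofReal_re,
      Complex.ofReal_re]
  rw [enorm_mul, hγ.enorm_occupation, ← ofReal_norm, ← ENNReal.ofReal_mul h2,
    ← ENNReal.ofReal_mul hb]
  refine ENNReal.ofReal_le_ofReal ?_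
  have h5 : bracket (latticePt L z) ^ 4 ≤ bracket (latticePt L z) ^ (3 * d + 12) :=
    pow_le_pow_right₀ (one_le_bracket _) (by omega)
  rw [h4]
  calc (occupation γ z).re * ‖graphBox e ω Q β μ L N m m' π t (latticePt L z)‖
      ≤ (occupation γ z).re * (b * bracket (latticePt L z) ^ (3 * d + 12)) := by
        gcongr
        exact (hbox _).trans (by gcongr)
    _ = _ := by field_simp

end Box

end PhononBoltzmann

end

/-! ### The theorem: choice of the final constant and passage to the limit superior -/

theorem mainTheorem5 (d : ℕ) (hd : 3 ≤ d) (β ρ C₁ C₂ C₃ C₄ C₅ C₆ C₇ C₈ : ℝ)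
    (hβ : 0 < β) (hρ : 0 < ρ) (hC₃ : 0 < C₃) (hC₅ : 0 < C₅) (hC₆ : 0 < C₆) :
    ∃ C : ℝ, 0 < C ∧
      ∀ (e ω Q : PhononBoltzmann.Mom d → ℝ) (μ : ℝ),
        PhononBoltzmann.Admissible d β ρ C₁ C₂ C₃ C₄ C₅ C₆ C₇ e ω Q μ →
      ∀ γ : ℝ → (PhononBoltzmann.ElectronSpace d →L[ℂ] PhononBoltzmann.ElectronSpace d),
        (∀ L : ℝ, 0 < L → PhononBoltzmann.IsDensityMatrix (γ L)) →
        limsup (fun L : ℝ => PhononBoltzmann.momentumMoment L (γ L)) atTop ≤ ENNReal.ofReal C₈ →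
      ∀ (lam t : ℝ), 0 < t →
      ∀ (n N : ℕ) (m m' : Fin (n + 1) → ℕ),
        m ∈ PhononBoltzmann.patterns n N → m' ∈ PhononBoltzmann.patterns n N →
      ∀ π : Equiv.Perm (Fin n), π ≠ 1 →
        (∀ L : ℝ, 0 < L →
          Summable (PhononBoltzmann.graphSummand e ω Q β μ L (γ L) N m m' π t)) ∧
        limsup (fun L : ℝ =>
            ‖PhononBoltzmann.graphValue e ω Q β μ L (γ L) lam N m m' π t‖ₑ) atTop
          ≤ ENNReal.ofReal (t ^ (-(1 / 2) : ℝ) * (C * lam ^ 2 * t) ^ N *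
              PhononBoltzmann.logStar t ^ 4) := by
  open PhononBoltzmann in
  obtain ⟨K, hK⟩ := exists_regular (d := d) (ρ := ρ) (C₁ := C₁) (C₂ := C₂) (C₄ := C₄) (C₅ := C₅)
    (C₇ := C₇) hd hβ hC₃ hC₆
  obtain ⟨C, hC, hbound⟩ := exists_graphLim_bound (d := d) hd hρ hC₅ K
  -- The `2` is the loss in `eventually_norm_graphBox_le`. The `+ 1` turns the bound on the limit
  -- superior of the moments into an eventual strict bound, and the maximum with `0` covers `C₈ ≤
  -- 0`.
  set A := 2 * (max C₈ 0 + 1) with hA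
  have hA1 : 1 ≤ A := by have := le_max_right C₈ 0; linarith
  refine ⟨A * C, by positivity, fun e ω Q μ hadm γ hγ hmom lam t ht n N m m' hm hm' π hπ => ?_⟩
  have H := hK e ω Q μ hadm
  refine ⟨fun L hL => H.summable_graphSummand hL ht.le hm hm' (hγ L hL), ?_⟩
  -- A nontrivial permutation forces `N ≥ n ≥ 1`, so the prefactor `A ≥ 1` can be absorbed as `A ≤ A
  -- ^ N`.
  have hN : N ≠ 0 := by
    obtain _ | n := n
    · exact absurd (Subsingleton.elim _ _) hπ
    · have h1 : n + 1 + 2 * ∑ j, m j = N := hm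
      omega
  set b := C ^ N * (t ^ N * t ^ (-(1 / 2) : ℝ)) with hb
  have hb0 : 0 < b := by positivity
  have hlim : ∀ p, ‖graphLim e ω (vertexWeight ω Q β μ) N m m' π t p‖ ≤ b * bracket p ^ 4 :=
    fun p => by
      have h1 := hbound e ω _ H t ht n N m m' hm hm' π hπ p
      rw [← ofReal_norm, ENNReal.ofReal_le_ofReal_iff (by have := bracket_pos p; positivity)] at h1
      exact h1.trans (le_of_eq (by rw [hb]; ring))
  have hmom' : ∀ᶠ L in atTop, momentumMoment L (γ L) < ENNReal.ofReal (max C₈ 0 + 1) := by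
    refine eventually_lt_of_limsup_lt (hmom.trans_lt ?_)
    rw [ENNReal.ofReal_lt_ofReal_iff (by positivity)]
    linarith [le_max_left C₈ 0]
  refine limsup_le_of_le (by isBoundedDefault) ?_
  filter_upwards [H.eventually_norm_graphBox_le (π := π) ht.le hm hm' hb0 hlim, hmom',
    eventually_gt_atTop 0] with L hbox hL hL0
  refine (H.enorm_graphValue_le hL0 ht.le hm hm' (hγ L hL0) lam (by positivity) hbox).trans ?_
  refine (mul_le_mul_right hL.le _).trans ?_
  rw [← ENNReal.ofReal_mul (by positivity)]
  refine ENNReal.ofReal_le_ofReal ?_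
  have h1 : A ≤ A ^ N := le_self_pow₀ hA1 hN
  -- The logarithms were already absorbed in the power of `t`, so here the factor `(log* t)⁴` only
  -- enlarges the bound.
  have h2 : (1 : ℝ) ≤ logStar t ^ 4 := one_le_pow₀ (le_max_left _ _)
  have h3 : 0 ≤ t ^ (-(1 / 2) : ℝ) * (A * C * lam ^ 2 * t) ^ N := by positivity
  calc (lam ^ 2) ^ N * (2 * b) * (max C₈ 0 + 1)
      = A * (C ^ N * (lam ^ 2) ^ N * t ^ N * t ^ (-(1 / 2) : ℝ)) := by rw [hb, hA]; ring
    _ ≤ A ^ N * (C ^ N * (lam ^ 2) ^ N * t ^ N * t ^ (-(1 / 2) : ℝ)) := by gcongr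
    _ = t ^ (-(1 / 2) : ℝ) * (A * C * lam ^ 2 * t) ^ N := by simp only [mul_pow]; ring
    _ ≤ _ := le_mul_of_one_le_right h3 h2
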